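/- Work in constructive mathematics with countable choice, that is, in intuitionistic arithmetic in all finite types over $\mathbb{N}$ and $\mathbb{Q}$ (intuitionistic logic, full induction, primitive recursion in all finite types, $\mathbb{Q}$ as the decidably ordered field of fractions, extensional equality of functions) together with the axiom of countable choice. Real numbers are regular sequences of rationals, $|x_m-x_n|\le \frac1{m+1}+\frac1{n+1}$, with the usual equality and order; a function $f:[0,1]\to\mathbb{R}$ is an operation that respects equality of reals, and it is continuous if it is continuous at each point of $[0,1]$. In this system the equivalence of the following two statements is derivable. 1. (LPO) For every binary sequence $(a_n)_{n\in\mathbb{N}}$, either $a_n=0$ for all $n$, or there exists $n$ with $a_n=1$. 2. (Rising Sun Lemma) Let $f:[0,1]\to\mathbb{R}$ be continuous and let $$E=\{x\in[0,1] \mid \exists y\in[0,1]:\ y>x \text{ and } f(y)>f(x)\}.$$ Then there is an at most countable family of pairwise disjoint, non-empty open intervals $I_n=(a_n,b_n)$ with endpoints in $[0,1]$ such that $E\cap(0,1)=\bigcup_n I_n$. Here "at most countable" means that the index set is $\{n\in\mathbb{N}\mid\lambda_n=0\}$ for an increasing binary sequence $\lambda$, and $I_n$ is non-empty if it is not the case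 that $I_n=\emptyset$. -/

import Mathlib

/-!
Constructive mathematics with countable choice, as a formal system: intuitionistic arithmetic in
all finite types (over the natural and the rational numbers), with extensional equality of
functions and the axiom of countable choice.  There is no excluded middle in it, so "the principle
`φ` is equivalent to the principle `ψ`" is the claim that `φ ↔ ψ` is derivable in this system.

Variables are de Bruijn indices; a context is a list of types, and terms and formulas are typed
and scoped by construction.
-/

namespace Bish

/-- The finite types over the natural numbers and the rational numbers. -/
inductive Ty : Type
  | nat : Ty
  | rat : Ty
  | fn : Ty → Ty → Ty

/-- Sequences of rational numbers (the regular ones among them are the real numbers). -/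
abbrev Ty.seq : Ty := Ty.fn Ty.nat Ty.rat

/-- A context: the types of the free variables, the most recently bound one first. -/
abbrev Ctx : Type := List Ty

/-- `Var Γ σ`: the variables of type `σ` in the context `Γ`. -/
inductive Var : Ctx → Ty → Type
  | zero {Γ : Ctx} {σ : Ty} : Var (σ :: Γ) σ
  | succ {Γ : Ctx} {σ τ : Ty} : Var Γ σ → Var (τ :: Γ) σ

/-- `Tm Γ σ`: the terms of type `σ` in the context `Γ`. -/
inductive Tm : Ctx → Ty → Type
  | var {Γ : Ctx} {σ : Ty} : Var Γ σ → Tm Γ σ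
  | app {Γ : Ctx} {σ τ : Ty} : Tm Γ (Ty.fn σ τ) → Tm Γ σ → Tm Γ τ
  | lam {Γ : Ctx} {σ τ : Ty} : Tm (σ :: Γ) τ → Tm Γ (Ty.fn σ τ)
  | zero {Γ : Ctx} : Tm Γ Ty.nat
  | succ {Γ : Ctx} : Tm Γ Ty.nat → Tm Γ Ty.nat
  /-- Primitive recursion: `natRec a f n` is `a` for `n = 0` and `f m (natRec a f m)` for
  `n = m + 1`. -/
  | natRec {Γ : Ctx} {σ : Ty} :
      Tm Γ σ → Tm Γ (Ty.fn Ty.nat (Ty.fn σ σ)) → Tm Γ Ty.nat → Tm Γ σ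
  | qzero {Γ : Ctx} : Tm Γ Ty.rat
  | qone {Γ : Ctx} : Tm Γ Ty.rat
  | qadd {Γ : Ctx} : Tm Γ Ty.rat → Tm Γ Ty.rat → Tm Γ Ty.rat
  | qneg {Γ : Ctx} : Tm Γ Ty.rat → Tm Γ Ty.rat
  | qmul {Γ : Ctx} : Tm Γ Ty.rat → Tm Γ Ty.rat → Tm Γ Ty.rat
  | qinv {Γ : Ctx} : Tm Γ Ty.rat → Tm Γ Ty.rat
  /-- The characteristic function of the order of the rationals: `1` if `a ≤ b`, else `0`. -/
  | qle {Γ : Ctx} : Tm Γ Ty.rat → Tm Γ Ty.rat → Tm Γ Ty.nat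

/-- `Fm Γ`: the formulas in the context `Γ`. -/
inductive Fm : Ctx → Type
  | eq {Γ : Ctx} {σ : Ty} : Tm Γ σ → Tm Γ σ → Fm Γ
  | bot {Γ : Ctx} : Fm Γ
  | and {Γ : Ctx} : Fm Γ → Fm Γ → Fm Γ
  | or {Γ : Ctx} : Fm Γ → Fm Γ → Fm Γ
  | imp {Γ : Ctx} : Fm Γ → Fm Γ → Fm Γ
  | all {Γ : Ctx} (σ : Ty) : Fm (σ :: Γ) → Fm Γ
  | ex {Γ : Ctx} (σ : Ty) : Fm (σ :: Γ) → Fm Γ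

/-! ### Renaming and substitution -/

/-- Type-preserving maps of variables. -/
abbrev Ren (Γ Δ : Ctx) : Type := ∀ σ : Ty, Var Γ σ → Var Δ σ

/-- Type-preserving maps from variables to terms. -/
abbrev Sub (Γ Δ : Ctx) : Type := ∀ σ : Ty, Var Γ σ → Tm Δ σ

/-- A renaming, carried under a binder. -/
def Ren.lift {Γ Δ : Ctx} (ρ : Ren Γ Δ) (τ : Ty) : Ren (τ :: Γ) (τ :: Δ)
  | _, Var.zero => Var.zero
  | _, Var.succ x => Var.succ (ρ _ x)

def Tm.rename : {Γ Δ : Ctx} → {σ : Ty} → Ren Γ Δ → Tm Γ σ → Tm Δ σ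
  | _, _, _, ρ, .var x => .var (ρ _ x)
  | _, _, _, ρ, .app f a => .app (f.rename ρ) (a.rename ρ)
  | _, _, _, ρ, .lam t => .lam (t.rename (ρ.lift _))
  | _, _, _, _, .zero => .zero
  | _, _, _, ρ, .succ n => .succ (n.rename ρ)
  | _, _, _, ρ, .natRec a f n => .natRec (a.rename ρ) (f.rename ρ) (n.rename ρ)
  | _, _, _, _, .qzero => .qzero
  | _, _, _, _, .qone => .qone
  | _, _, _, ρ, .qadd a b => .qadd (a.rename ρ) (b.rename ρ)
  | _, _, _, ρ, .qneg a => .qneg (a.rename ρ)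
  | _, _, _, ρ, .qmul a b => .qmul (a.rename ρ) (b.rename ρ)
  | _, _, _, ρ, .qinv a => .qinv (a.rename ρ)
  | _, _, _, ρ, .qle a b => .qle (a.rename ρ) (b.rename ρ)

/-- Weakening: the same term in a context with one more variable. -/
def Tm.wk {Γ : Ctx} {σ τ : Ty} (t : Tm Γ σ) : Tm (τ :: Γ) σ :=
  t.rename (fun _ x => Var.succ x)

/-- A substitution, carried under a binder. -/
def Sub.lift {Γ Δ : Ctx} (s : Sub Γ Δ) (τ : Ty) : Sub (τ :: Γ) (τ :: Δ)
  | _, Var.zero => .var Var.zero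
  | _, Var.succ x => (s _ x).wk

/-- The substitution that sends the last variable to `t` and the others where `s` sends them. -/
def Sub.cons {Γ Δ : Ctx} {τ : Ty} (t : Tm Δ τ) (s : Sub Γ Δ) : Sub (τ :: Γ) Δ
  | _, Var.zero => t
  | _, Var.succ x => s _ x

def Tm.subst : {Γ Δ : Ctx} → {σ : Ty} → Sub Γ Δ → Tm Γ σ → Tm Δ σ
  | _, _, _, s, .var x => s _ x
  | _, _, _, s, .app f a => .app (f.subst s) (a.subst s)
  | _, _, _, s, .lam t => .lam (t.subst (s.lift _))
  | _, _, _, _, .zero => .zero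
  | _, _, _, s, .succ n => .succ (n.subst s)
  | _, _, _, s, .natRec a f n => .natRec (a.subst s) (f.subst s) (n.subst s)
  | _, _, _, _, .qzero => .qzero
  | _, _, _, _, .qone => .qone
  | _, _, _, s, .qadd a b => .qadd (a.subst s) (b.subst s)
  | _, _, _, s, .qneg a => .qneg (a.subst s)
  | _, _, _, s, .qmul a b => .qmul (a.subst s) (b.subst s)
  | _, _, _, s, .qinv a => .qinv (a.subst s)
  | _, _, _, s, .qle a b => .qle (a.subst s) (b.subst s)

def Fm.rename : {Γ Δ : Ctx} → Ren Γ Δ → Fm Γ → Fm Δ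
  | _, _, ρ, .eq a b => .eq (a.rename ρ) (b.rename ρ)
  | _, _, _, .bot => .bot
  | _, _, ρ, .and φ ψ => .and (φ.rename ρ) (ψ.rename ρ)
  | _, _, ρ, .or φ ψ => .or (φ.rename ρ) (ψ.rename ρ)
  | _, _, ρ, .imp φ ψ => .imp (φ.rename ρ) (ψ.rename ρ)
  | _, _, ρ, .all σ φ => .all σ (φ.rename (ρ.lift σ))
  | _, _, ρ, .ex σ φ => .ex σ (φ.rename (ρ.lift σ))

def Fm.wk {Γ : Ctx} {τ : Ty} (φ : Fm Γ) : Fm (τ :: Γ) :=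
  φ.rename (fun _ x => Var.succ x)

def Fm.subst : {Γ Δ : Ctx} → Sub Γ Δ → Fm Γ → Fm Δ
  | _, _, s, .eq a b => .eq (a.subst s) (b.subst s)
  | _, _, _, .bot => .bot
  | _, _, s, .and φ ψ => .and (φ.subst s) (ψ.subst s)
  | _, _, s, .or φ ψ => .or (φ.subst s) (ψ.subst s)
  | _, _, s, .imp φ ψ => .imp (φ.subst s) (ψ.subst s)
  | _, _, s, .all σ φ => .all σ (φ.subst (s.lift σ))
  | _, _, s, .ex σ φ => .ex σ (φ.subst (s.lift σ))

/-- `t.inst a` is `t` with its last variable replaced by `a`. -/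
def Tm.inst {Γ : Ctx} {σ τ : Ty} (t : Tm (τ :: Γ) σ) (a : Tm Γ τ) : Tm Γ σ :=
  t.subst (Sub.cons a (fun _ x => .var x))

/-- `φ.inst a` is `φ` with its last variable replaced by `a`. -/
def Fm.inst {Γ : Ctx} {τ : Ty} (φ : Fm (τ :: Γ)) (a : Tm Γ τ) : Fm Γ :=
  φ.subst (Sub.cons a (fun _ x => .var x))

/-! ### Abbreviations -/

/-- The variables, counted from the most recently bound one. -/
abbrev v0 {Γ : Ctx} {σ : Ty} : Tm (σ :: Γ) σ := .var .zero
abbrev v1 {Γ : Ctx} {σ τ : Ty} : Tm (τ :: σ :: Γ) σ := .var (.succ .zero)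
abbrev v2 {Γ : Ctx} {σ τ υ : Ty} : Tm (υ :: τ :: σ :: Γ) σ := .var (.succ (.succ .zero))
abbrev v3 {Γ : Ctx} {σ τ υ χ : Ty} : Tm (χ :: υ :: τ :: σ :: Γ) σ :=
  .var (.succ (.succ (.succ .zero)))
abbrev v4 {Γ : Ctx} {σ τ υ χ ω : Ty} : Tm (ω :: χ :: υ :: τ :: σ :: Γ) σ :=
  .var (.succ (.succ (.succ (.succ .zero))))

def Fm.neg {Γ : Ctx} (φ : Fm Γ) : Fm Γ := .imp φ .bot

def Fm.iff {Γ : Ctx} (φ ψ : Fm Γ) : Fm Γ := .and (.imp φ ψ) (.imp ψ φ)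

/-- The natural number one. -/
def Tm.one {Γ : Ctx} : Tm Γ Ty.nat := .succ .zero

/-- `a ≤ b` for rationals. -/
def qLe {Γ : Ctx} (a b : Tm Γ Ty.rat) : Fm Γ := .eq (.qle a b) Tm.one

/-- `a < b` for rationals. -/
def qLt {Γ : Ctx} (a b : Tm Γ Ty.rat) : Fm Γ := (qLe b a).neg

/-- The natural number `n` as a rational, defined by recursion. -/
def natCast {Γ : Ctx} (n : Tm Γ Ty.nat) : Tm Γ Ty.rat :=
  .natRec .qzero (.lam (.lam (.qadd v0 .qone))) n

/-- The rational `1 / (n + 1)`. -/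
def unitFrac {Γ : Ctx} (n : Tm Γ Ty.nat) : Tm Γ Ty.rat := .qinv (.qadd (natCast n) .qone)

/-- The rational `2 / (n + 1)`. -/
def twoFrac {Γ : Ctx} (n : Tm Γ Ty.nat) : Tm Γ Ty.rat := .qadd (unitFrac n) (unitFrac n)

/-! ### Axioms and derivations -/

/-- The non-logical axioms. -/
inductive Ax : {Γ : Ctx} → Fm Γ → Prop
  /-- Functions are given by terms ... -/
  | beta {Γ : Ctx} {σ τ : Ty} (t : Tm (σ :: Γ) τ) (a : Tm Γ σ) :
      Ax (.eq (.app (.lam t) a) (t.inst a))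
  /-- ... and are equal if they have equal values. -/
  | funext {Γ : Ctx} {σ τ : Ty} (f g : Tm Γ (Ty.fn σ τ)) :
      Ax (.imp (.all σ (.eq (.app f.wk v0) (.app g.wk v0))) (.eq f g))
  | succ_ne_zero {Γ : Ctx} (n : Tm Γ Ty.nat) : Ax (Fm.neg (.eq (.succ n) .zero))
  | succ_inj {Γ : Ctx} (n m : Tm Γ Ty.nat) : Ax (.imp (.eq (.succ n) (.succ m)) (.eq n m))
  | rec_zero {Γ : Ctx} {σ : Ty} (a : Tm Γ σ) (f : Tm Γ (Ty.fn Ty.nat (Ty.fn σ σ))) :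
      Ax (.eq (.natRec a f .zero) a)
  | rec_succ {Γ : Ctx} {σ : Ty} (a : Tm Γ σ) (f : Tm Γ (Ty.fn Ty.nat (Ty.fn σ σ)))
      (n : Tm Γ Ty.nat) :
      Ax (.eq (.natRec a f (.succ n)) (.app (.app f n) (.natRec a f n)))
  /-- Induction, for every formula. -/
  | induction {Γ : Ctx} (φ : Fm (Ty.nat :: Γ)) :
      Ax (.imp (φ.inst .zero)
        (.imp (.all Ty.nat (.imp φ (φ.subst (Sub.cons (.succ v0) (fun _ x => .var x.succ)))))
          (.all Ty.nat φ)))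
  /-- Countable choice, for every type and every formula: if for all `n` there is `y` with
  `φ(n, y)`, then there is a function `g` with `φ(n, g n)` for all `n`. -/
  | countable_choice {Γ : Ctx} {σ : Ty} (φ : Fm (σ :: Ty.nat :: Γ)) :
      Ax (.imp (.all Ty.nat (.ex σ φ))
        (.ex (Ty.fn Ty.nat σ) (.all Ty.nat
          (φ.subst (Sub.cons (.app v1 v0) (Sub.cons v0 (fun _ x => .var x.succ.succ)))))))
  /- The rationals are an ordered field with a decidable order ... -/
  | qadd_assoc {Γ : Ctx} (a b c : Tm Γ Ty.rat) :
      Ax (.eq (.qadd (.qadd a b) c) (.qadd a (.qadd b c)))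
  | qadd_comm {Γ : Ctx} (a b : Tm Γ Ty.rat) : Ax (.eq (.qadd a b) (.qadd b a))
  | qadd_zero {Γ : Ctx} (a : Tm Γ Ty.rat) : Ax (.eq (.qadd a .qzero) a)
  | qadd_neg {Γ : Ctx} (a : Tm Γ Ty.rat) : Ax (.eq (.qadd a (.qneg a)) .qzero)
  | qmul_assoc {Γ : Ctx} (a b c : Tm Γ Ty.rat) :
      Ax (.eq (.qmul (.qmul a b) c) (.qmul a (.qmul b c)))
  | qmul_comm {Γ : Ctx} (a b : Tm Γ Ty.rat) : Ax (.eq (.qmul a b) (.qmul b a))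
  | qmul_one {Γ : Ctx} (a : Tm Γ Ty.rat) : Ax (.eq (.qmul a .qone) a)
  | qmul_add {Γ : Ctx} (a b c : Tm Γ Ty.rat) :
      Ax (.eq (.qmul a (.qadd b c)) (.qadd (.qmul a b) (.qmul a c)))
  | qmul_inv {Γ : Ctx} (a : Tm Γ Ty.rat) :
      Ax (.imp (Fm.neg (.eq a .qzero)) (.eq (.qmul a (.qinv a)) .qone))
  | qzero_ne_one {Γ : Ctx} : Ax (Γ := Γ) (Fm.neg (.eq .qzero .qone))
  | qle_char {Γ : Ctx} (a b : Tm Γ Ty.rat) :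
      Ax (.or (.eq (.qle a b) .zero) (.eq (.qle a b) Tm.one))
  | qle_trans {Γ : Ctx} (a b c : Tm Γ Ty.rat) : Ax (.imp (qLe a b) (.imp (qLe b c) (qLe a c)))
  | qle_antisymm {Γ : Ctx} (a b : Tm Γ Ty.rat) : Ax (.imp (qLe a b) (.imp (qLe b a) (.eq a b)))
  | qle_total {Γ : Ctx} (a b : Tm Γ Ty.rat) : Ax (.or (qLe a b) (qLe b a))
  | qadd_le {Γ : Ctx} (a b c : Tm Γ Ty.rat) : Ax (.imp (qLe a b) (qLe (.qadd a c) (.qadd b c)))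
  | qmul_nonneg {Γ : Ctx} (a b : Tm Γ Ty.rat) :
      Ax (.imp (qLe .qzero a) (.imp (qLe .qzero b) (qLe .qzero (.qmul a b))))
  /-- ... all of whose elements are fractions `(n - m) / (k + 1)` of natural numbers. -/
  | qfrac {Γ : Ctx} (a : Tm Γ Ty.rat) :
      Ax (.ex Ty.nat (.ex Ty.nat (.ex Ty.nat
        (.eq (.qmul a.wk.wk.wk (.qadd (natCast v0) .qone))
          (.qadd (natCast v2) (.qneg (natCast v1)))))))

/-- `Prf H φ`: the formula `φ` has an intuitionistic derivation (natural deduction) from the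
hypotheses in the list `H` and the axioms. -/
inductive Prf : {Γ : Ctx} → List (Fm Γ) → Fm Γ → Prop
  | ax {Γ : Ctx} {H : List (Fm Γ)} {φ : Fm Γ} : Ax φ → Prf H φ
  | hyp {Γ : Ctx} {H : List (Fm Γ)} {φ : Fm Γ} : φ ∈ H → Prf H φ
  | botE {Γ : Ctx} {H : List (Fm Γ)} {φ : Fm Γ} : Prf H .bot → Prf H φ
  | andI {Γ : Ctx} {H : List (Fm Γ)} {φ ψ : Fm Γ} : Prf H φ → Prf H ψ → Prf H (.and φ ψ)
  | andE₁ {Γ : Ctx} {H : List (Fm Γ)} {φ ψ : Fm Γ} : Prf H (.and φ ψ) → Prf H φ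
  | andE₂ {Γ : Ctx} {H : List (Fm Γ)} {φ ψ : Fm Γ} : Prf H (.and φ ψ) → Prf H ψ
  | orI₁ {Γ : Ctx} {H : List (Fm Γ)} {φ ψ : Fm Γ} : Prf H φ → Prf H (.or φ ψ)
  | orI₂ {Γ : Ctx} {H : List (Fm Γ)} {φ ψ : Fm Γ} : Prf H ψ → Prf H (.or φ ψ)
  | orE {Γ : Ctx} {H : List (Fm Γ)} {φ ψ χ : Fm Γ} :
      Prf H (.or φ ψ) → Prf (φ :: H) χ → Prf (ψ :: H) χ → Prf H χ
  | impI {Γ : Ctx} {H : List (Fm Γ)} {φ ψ : Fm Γ} : Prf (φ :: H) ψ → Prf H (.imp φ ψ)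
  | impE {Γ : Ctx} {H : List (Fm Γ)} {φ ψ : Fm Γ} : Prf H (.imp φ ψ) → Prf H φ → Prf H ψ
  | allI {Γ : Ctx} {H : List (Fm Γ)} {σ : Ty} {φ : Fm (σ :: Γ)} :
      Prf (H.map Fm.wk) φ → Prf H (.all σ φ)
  | allE {Γ : Ctx} {H : List (Fm Γ)} {σ : Ty} {φ : Fm (σ :: Γ)} (t : Tm Γ σ) :
      Prf H (.all σ φ) → Prf H (φ.inst t)
  | exI {Γ : Ctx} {H : List (Fm Γ)} {σ : Ty} {φ : Fm (σ :: Γ)} (t : Tm Γ σ) :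
      Prf H (φ.inst t) → Prf H (.ex σ φ)
  | exE {Γ : Ctx} {H : List (Fm Γ)} {σ : Ty} {φ : Fm (σ :: Γ)} {ψ : Fm Γ} :
      Prf H (.ex σ φ) → Prf (φ :: H.map Fm.wk) ψ.wk → Prf H ψ
  | eqI {Γ : Ctx} {H : List (Fm Γ)} {σ : Ty} (t : Tm Γ σ) : Prf H (.eq t t)
  | eqE {Γ : Ctx} {H : List (Fm Γ)} {σ : Ty} {s t : Tm Γ σ} (φ : Fm (σ :: Γ)) :
      Prf H (.eq s t) → Prf H (φ.inst s) → Prf H (φ.inst t)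

/-- `φ` is a theorem of constructive mathematics with countable choice. -/
def Provable (φ : Fm []) : Prop := Prf [] φ

/-! ### Real numbers inside the system -/

/-- `x` is a real number: a regular sequence of rationals, `|x m - x n| ≤ 1/(m+1) + 1/(n+1)`
(one inequality suffices, as it is required for all `m` and `n`). -/
def isReal {Γ : Ctx} (x : Tm Γ Ty.seq) : Fm Γ :=
  .all Ty.nat (.all Ty.nat
    (qLe (.app x.wk.wk v1) (.qadd (.app x.wk.wk v0) (.qadd (unitFrac v1) (unitFrac v0)))))

/-- `x ≤ y` for real numbers: `x n ≤ y n + 2/(n+1)` for all `n`. -/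
def rLe {Γ : Ctx} (x y : Tm Γ Ty.seq) : Fm Γ :=
  .all Ty.nat (qLe (.app x.wk v0) (.qadd (.app y.wk v0) (twoFrac v0)))

/-- `x < y` for real numbers: `x n + 2/(n+1) < y n` for some `n`. -/
def rLt {Γ : Ctx} (x y : Tm Γ Ty.seq) : Fm Γ :=
  .ex Ty.nat (qLt (.qadd (.app x.wk v0) (twoFrac v0)) (.app y.wk v0))

/-- `x = y` for real numbers: `|x n - y n| ≤ 2/(n+1)` for all `n`. -/
def rEq {Γ : Ctx} (x y : Tm Γ Ty.seq) : Fm Γ := .and (rLe x y) (rLe y x)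

/-- `|x - y| ≤ d` for real numbers `x`, `y` and a rational `d`:
`|x n - y n| ≤ d + 2/(n+1)` for all `n`. -/
def rClose {Γ : Ctx} (x y : Tm Γ Ty.seq) (d : Tm Γ Ty.rat) : Fm Γ :=
  .all Ty.nat (.and
    (qLe (.app x.wk v0) (.qadd (.app y.wk v0) (.qadd d.wk (twoFrac v0))))
    (qLe (.app y.wk v0) (.qadd (.app x.wk v0) (.qadd d.wk (twoFrac v0)))))

/-- The rational `q` as a real number. -/
def rConst {Γ : Ctx} (q : Tm Γ Ty.rat) : Tm Γ Ty.seq := .lam q.wk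

/-- `x` is a real number in `[0, 1]`. -/
def inUnit {Γ : Ctx} (x : Tm Γ Ty.seq) : Fm Γ :=
  .and (isReal x) (.and (rLe (rConst .qzero) x) (rLe x (rConst .qone)))

/-- `x` is a real number in the open interval `(a, b)`. -/
def inIoo {Γ : Ctx} (a b x : Tm Γ Ty.seq) : Fm Γ :=
  .and (isReal x) (.and (rLt a x) (rLt x b))

/-- `f` is a (point-wise) continuous function from `[0, 1]` to the real numbers: an operation that
maps points of `[0, 1]` to real numbers, respects equality of real numbers, and is continuous at
every point of `[0, 1]`. -/
def isCont {Γ : Ctx} (f : Tm Γ (Ty.fn Ty.seq Ty.seq)) : Fm Γ :=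
  .and (.all Ty.seq (.imp (inUnit v0) (isReal (.app f.wk v0))))
  (.and
    (.all Ty.seq (.all Ty.seq (.imp (inUnit v1) (.imp (inUnit v0)
      (.imp (rEq v1 v0) (rEq (.app f.wk.wk v1) (.app f.wk.wk v0)))))))
    -- in the innermost scope: `v3` is the point `x`, `v2` is `ε`, `v1` is `δ`, `v0` is `y`
    (.all Ty.seq (.imp (inUnit v0)
      (.all Ty.rat (.imp (qLt .qzero v0)
        (.ex Ty.rat (.and (qLt .qzero v0)
          (.all Ty.seq (.imp (inUnit v0) (.imp (rClose v3 v0 v1)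
            (rClose (.app f.wk.wk.wk.wk v3) (.app f.wk.wk.wk.wk v0) v2)))))))))))

/-- `x ∈ E`, where `E = {x ∈ [0, 1] | ∃ y ∈ [0, 1], y > x ∧ f y > f x}`. -/
def inShadow {Γ : Ctx} (f : Tm Γ (Ty.fn Ty.seq Ty.seq)) (x : Tm Γ Ty.seq) : Fm Γ :=
  .and (inUnit x)
    (.ex Ty.seq (.and (inUnit v0)
      (.and (rLt x.wk v0) (rLt (.app f.wk x.wk) (.app f.wk v0)))))

/-! ### The two principles -/

/-- `l` is a binary sequence. -/
def isBinary {Γ : Ctx} (l : Tm Γ (Ty.fn Ty.nat Ty.nat)) : Fm Γ :=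
  .all Ty.nat (.or (.eq (.app l.wk v0) .zero) (.eq (.app l.wk v0) Tm.one))

/-- `l` is an increasing binary sequence.  The set `{n | l n = 0}` is then an initial segment
of the natural numbers, possibly empty, possibly everything: an at most countable index set. -/
def isIncreasingBinary {Γ : Ctx} (l : Tm Γ (Ty.fn Ty.nat Ty.nat)) : Fm Γ :=
  .and (isBinary l)
    (.all Ty.nat (.imp (.eq (.app l.wk v0) Tm.one) (.eq (.app l.wk (.succ v0)) Tm.one)))

/-- The limited principle of omniscience. -/
def LPO : Fm [] :=
  .all (Ty.fn Ty.nat Ty.nat) (.imp (isBinary v0)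
    (.or (.all Ty.nat (.eq (.app v1 v0) .zero)) (.ex Ty.nat (.eq (.app v1 v0) Tm.one))))

/-- The intervals `(a n, b n)`, for `n` with `l n = 0`, are an at most countable family of pairwise
disjoint non-empty open intervals in `[0, 1]`. -/
def isIntervalFamily {Γ : Ctx} (l : Tm Γ (Ty.fn Ty.nat Ty.nat))
    (a b : Tm Γ (Ty.fn Ty.nat Ty.seq)) : Fm Γ :=
  .and (isIncreasingBinary l)
  (.and
    (.all Ty.nat (.imp (.eq (.app l.wk v0) .zero)
      (.and (inUnit (.app a.wk v0)) (.and (inUnit (.app b.wk v0))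
        (Fm.neg (.all Ty.seq
          (Fm.neg (inIoo (.app a.wk.wk v1) (.app b.wk.wk v1) v0))))))))
    -- in the innermost scope: `v2` and `v1` are the indices, `v0` is the point
    (.all Ty.nat (.all Ty.nat (.imp (.eq (.app l.wk.wk v1) .zero)
      (.imp (.eq (.app l.wk.wk v0) .zero) (.imp (Fm.neg (.eq v1 v0))
        (.all Ty.seq (Fm.neg (.and
          (inIoo (.app a.wk.wk.wk v2) (.app b.wk.wk.wk v2) v0)
          (inIoo (.app a.wk.wk.wk v1) (.app b.wk.wk.wk v1) v0))))))))))

/-- The Rising Sun Lemma: for every continuous `f : [0, 1] → ℝ` there is an at most countable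
family of pairwise disjoint non-empty open intervals in `[0, 1]` whose union is `E ∩ (0, 1)`. -/
def RisingSun : Fm [] :=
  .all (Ty.fn Ty.seq Ty.seq) (.imp (isCont v0)
    (.ex (Ty.fn Ty.nat Ty.nat) (.ex (Ty.fn Ty.nat Ty.seq) (.ex (Ty.fn Ty.nat Ty.seq)
      -- here `v3` is `f`, `v2` is the index sequence, `v1` and `v0` are the endpoints
      (.and (isIntervalFamily v2 v1 v0)
        (.all Ty.seq (Fm.iff
          (.and (inShadow v4 v0) (inIoo (rConst .qzero) (rConst .qone) v0))
          (.ex Ty.nat (.and (.eq (.app v4 v0) .zero)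
            (inIoo (.app v3 v0) (.app v2 v0) v1))))))))))

end Bish

/-! No derivation is written out in full. A Henkin construction (`Prf.of_models`) shows that a
formula is derivable from a list of hypotheses as soon as it holds in all prime models of them. The
formulas that hold in a prime model form a consistent, deductively closed theory with the
disjunction and the existence property. There ∧, ∨, ∃, equations and the order of the rationals
behave as in ordinary mathematics, so the computations take place in a linearly ordered field. An
implication or a universal formula is instead checked in all models of some formulas that hold
(`imp_of`, `all_of`), much as in Kripke semantics. The metatheory is classical, which is harmless,
since only the existence of a derivation is claimed.

LPO implies the Rising Sun Lemma. With countable choice, LPO decides every arithmetical formula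
(`Fm.IsArith.dec`), so in models of LPO such formulas may be read classically. Membership in E
quantifies over reals; it is replaced by an arithmetical condition. A rational interval [p, r] is
shaded if, for some rational y > r, the value f(y) exceeds a rational bound c for f on the rationals
of [p, r]. By continuity, the points of E ∩ (0, 1) are those strictly inside shaded intervals
(`Cont.exists_shaded`, `Cont.inShadow`). Overlapping shaded intervals can be joined (`Shaded.glue`),
without maxima or compactness: if the left interval has the larger bound, its y exceeds the bound on
the right interval and so lies beyond it. Hence "joined by a shaded interval" is transitive. The
first positive rational of each class, in an enumeration, represents a component. As shadedness is
decided, representatives can be listed without repetition (`exists_listing`) and endpoints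
approximated up to 1/(k+1) (`exists_components`).

The Rising Sun Lemma implies LPO. For a binary α let s be 1/(3(m+1)) if m is the first index with α
m = 1, and 0 if there is none; let f(x) = s x. If s > 0, then E ∩ (0, 1) is all of (0, 1); a point
of E, in turn, shows that s > 0. The value λ 0 is 0 or 1. If it is 1, there are no intervals, so α
is constantly 0. If it is 0, the interval (a, b) of index 0 is non-empty. If it had a point, then s
> 0, and 0 < a would be impossible: a would lie in another interval, which would meet (a, b).
Likewise b < 1 is impossible. Both conclusions are negations, so non-emptiness in the weak sense
suffices for them. Hence 1/2 lies in (a, b), so s > 0, and an m with α m = 1 is found. -/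

namespace Bish

/-! ### Substitution calculus -/

theorem Ren.lift_comp {Γ Δ Θ : Ctx} (ρ : Ren Γ Δ) (ρ' : Ren Δ Θ) (τ : Ty) :
    (fun σ x => ρ'.lift τ σ (ρ.lift τ σ x)) = Ren.lift (fun σ x => ρ' σ (ρ σ x)) τ := by
  funext σ x; cases x <;> rfl

theorem Tm.rename_rename {Γ Δ Θ : Ctx} {σ : Ty} (t : Tm Γ σ) (ρ : Ren Γ Δ) (ρ' : Ren Δ Θ) :
    (t.rename ρ).rename ρ' = t.rename (fun σ x => ρ' σ (ρ σ x)) := by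
  induction t generalizing Δ Θ with
  | lam t ih => simp only [Tm.rename, ih, Ren.lift_comp]
  | _ => simp only [Tm.rename, *]

theorem Sub.lift_ren {Γ Δ Θ : Ctx} (ρ : Ren Γ Δ) (s : Sub Δ Θ) (τ : Ty) :
    (fun σ x => s.lift τ σ (ρ.lift τ σ x)) = Sub.lift (fun σ x => s σ (ρ σ x)) τ := by
  funext σ x; cases x <;> rfl

theorem Tm.subst_rename {Γ Δ Θ : Ctx} {σ : Ty} (t : Tm Γ σ) (ρ : Ren Γ Δ) (s : Sub Δ Θ) :
    (t.rename ρ).subst s = t.subst (fun σ x => s σ (ρ σ x)) := by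
  induction t generalizing Δ Θ with
  | lam t ih => simp only [Tm.rename, Tm.subst, ih, Sub.lift_ren]
  | _ => simp only [Tm.rename, Tm.subst, *]

theorem Sub.ren_lift {Γ Δ Θ : Ctx} (s : Sub Γ Δ) (ρ : Ren Δ Θ) (τ : Ty) :
    (fun σ x => (s.lift τ σ x).rename (ρ.lift τ)) = Sub.lift (fun σ x => (s σ x).rename ρ) τ := by
  funext σ x
  cases x with
  | zero => rfl
  | succ x => simp only [Sub.lift, Tm.wk, Tm.rename_rename]; rfl

theorem Tm.rename_subst {Γ Δ Θ : Ctx} {σ : Ty} (t : Tm Γ σ) (s : Sub Γ Δ) (ρ : Ren Δ Θ) :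
    (t.subst s).rename ρ = t.subst (fun σ x => (s σ x).rename ρ) := by
  induction t generalizing Δ Θ with
  | lam t ih => simp only [Tm.rename, Tm.subst, ih, Sub.ren_lift]
  | _ => simp only [Tm.rename, Tm.subst, *]

theorem Sub.lift_comp {Γ Δ Θ : Ctx} (s : Sub Γ Δ) (s' : Sub Δ Θ) (τ : Ty) :
    (fun σ x => (s.lift τ σ x).subst (s'.lift τ)) = Sub.lift (fun σ x => (s σ x).subst s') τ := by
  funext σ x
  cases x with
  | zero => rfl
  | succ x => simp only [Sub.lift, Tm.wk, Tm.subst_rename, Tm.rename_subst]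

theorem Tm.subst_subst {Γ Δ Θ : Ctx} {σ : Ty} (t : Tm Γ σ) (s : Sub Γ Δ) (s' : Sub Δ Θ) :
    (t.subst s).subst s' = t.subst (fun σ x => (s σ x).subst s') := by
  induction t generalizing Δ Θ with
  | lam t ih => simp only [Tm.subst, ih, Sub.lift_comp]
  | _ => simp only [Tm.subst, *]

theorem Sub.lift_var {Γ Δ : Ctx} (ρ : Ren Γ Δ) (τ : Ty) :
    Sub.lift (fun σ x => .var (ρ σ x)) τ = fun σ x => .var (ρ.lift τ σ x) := by
  funext σ x; cases x <;> rfl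

theorem Tm.rename_eq_subst {Γ Δ : Ctx} {σ : Ty} (t : Tm Γ σ) (ρ : Ren Γ Δ) :
    t.rename ρ = t.subst (fun σ x => .var (ρ σ x)) := by
  induction t generalizing Δ with
  | lam t ih => simp only [Tm.rename, Tm.subst, ih, Sub.lift_var]
  | _ => simp only [Tm.rename, Tm.subst, *]

theorem Sub.lift_id {Γ : Ctx} (τ : Ty) :
    Sub.lift (fun σ (x : Var Γ σ) => Tm.var x) τ = fun _ x => .var x := by
  funext σ x; cases x <;> rfl

theorem Tm.subst_id {Γ : Ctx} {σ : Ty} (t : Tm Γ σ) : t.subst (fun _ x => .var x) = t := by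
  induction t with
  | lam t ih => simp only [Tm.subst, ih, Sub.lift_id]
  | _ => simp only [Tm.subst, *]

theorem Fm.subst_rename {Γ Δ Θ : Ctx} (φ : Fm Γ) (ρ : Ren Γ Δ) (s : Sub Δ Θ) :
    (φ.rename ρ).subst s = φ.subst (fun σ x => s σ (ρ σ x)) := by
  induction φ generalizing Δ Θ with
  | eq a b => simp only [Fm.rename, Fm.subst, Tm.subst_rename]
  | all σ φ ih => simp only [Fm.rename, Fm.subst, ih, Sub.lift_ren]
  | ex σ φ ih => simp only [Fm.rename, Fm.subst, ih, Sub.lift_ren]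
  | _ => simp only [Fm.rename, Fm.subst, *]

theorem Fm.rename_subst {Γ Δ Θ : Ctx} (φ : Fm Γ) (s : Sub Γ Δ) (ρ : Ren Δ Θ) :
    (φ.subst s).rename ρ = φ.subst (fun σ x => (s σ x).rename ρ) := by
  induction φ generalizing Δ Θ with
  | eq a b => simp only [Fm.rename, Fm.subst, Tm.rename_subst]
  | all σ φ ih => simp only [Fm.rename, Fm.subst, ih, Sub.ren_lift]
  | ex σ φ ih => simp only [Fm.rename, Fm.subst, ih, Sub.ren_lift]
  | _ => simp only [Fm.rename, Fm.subst, *]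

theorem Fm.subst_subst {Γ Δ Θ : Ctx} (φ : Fm Γ) (s : Sub Γ Δ) (s' : Sub Δ Θ) :
    (φ.subst s).subst s' = φ.subst (fun σ x => (s σ x).subst s') := by
  induction φ generalizing Δ Θ with
  | eq a b => simp only [Fm.subst, Tm.subst_subst]
  | all σ φ ih => simp only [Fm.subst, ih, Sub.lift_comp]
  | ex σ φ ih => simp only [Fm.subst, ih, Sub.lift_comp]
  | _ => simp only [Fm.subst, *]

theorem Fm.rename_eq_subst {Γ Δ : Ctx} (φ : Fm Γ) (ρ : Ren Γ Δ) :
    φ.rename ρ = φ.subst (fun σ x => .var (ρ σ x)) := by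
  induction φ generalizing Δ with
  | eq a b => simp only [Fm.rename, Fm.subst, Tm.rename_eq_subst]
  | all σ φ ih => simp only [Fm.rename, Fm.subst, ih, Sub.lift_var]
  | ex σ φ ih => simp only [Fm.rename, Fm.subst, ih, Sub.lift_var]
  | _ => simp only [Fm.rename, Fm.subst, *]

theorem Fm.subst_id {Γ : Ctx} (φ : Fm Γ) : φ.subst (fun _ x => .var x) = φ := by
  induction φ with
  | eq a b => simp only [Fm.subst, Tm.subst_id]
  | all σ φ ih => simp only [Fm.subst, ih, Sub.lift_id]
  | ex σ φ ih => simp only [Fm.subst, ih, Sub.lift_id]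
  | _ => simp only [Fm.subst, *]

theorem Tm.wk_subst_lift {Γ Δ : Ctx} {σ τ : Ty} (t : Tm Γ σ) (s : Sub Γ Δ) :
    t.wk.subst (s.lift τ) = (t.subst s).wk := by
  simp only [Tm.wk, Tm.subst_rename, Tm.rename_subst]; rfl

theorem Fm.wk_subst_lift {Γ Δ : Ctx} {τ : Ty} (φ : Fm Γ) (s : Sub Γ Δ) :
    φ.wk.subst (s.lift τ) = (φ.subst s).wk := by
  simp only [Fm.wk, Fm.subst_rename, Fm.rename_subst]; rfl

theorem Tm.wk_subst_cons {Γ Δ : Ctx} {σ τ : Ty} (t : Tm Γ σ) (a : Tm Δ τ) (s : Sub Γ Δ) :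
    t.wk.subst (Sub.cons a s) = t.subst s := by
  simp only [Tm.wk, Tm.subst_rename]; rfl

theorem Fm.wk_subst_cons {Γ Δ : Ctx} {τ : Ty} (φ : Fm Γ) (a : Tm Δ τ) (s : Sub Γ Δ) :
    φ.wk.subst (Sub.cons a s) = φ.subst s := by
  simp only [Fm.wk, Fm.subst_rename]; rfl

theorem Sub.lift_cons {Γ Δ Θ : Ctx} {τ : Ty} (s : Sub Γ Δ) (a : Tm Θ τ) (s' : Sub Δ Θ) :
    (fun σ x => (s.lift τ σ x).subst (Sub.cons a s')) =
      Sub.cons a (fun σ x => (s σ x).subst s') := by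
  funext σ x
  cases x with
  | zero => rfl
  | succ x => simp only [Sub.lift, Tm.wk_subst_cons]; rfl

theorem Tm.subst_lift_inst {Γ Δ : Ctx} {σ τ : Ty} (t : Tm (τ :: Γ) σ) (s : Sub Γ Δ)
    (a : Tm Δ τ) : (t.subst (s.lift τ)).inst a = t.subst (Sub.cons a s) := by
  simp only [Tm.inst, Tm.subst_subst, Sub.lift_cons, Tm.subst_id]

theorem Fm.subst_lift_inst {Γ Δ : Ctx} {τ : Ty} (φ : Fm (τ :: Γ)) (s : Sub Γ Δ)
    (a : Tm Δ τ) : (φ.subst (s.lift τ)).inst a = φ.subst (Sub.cons a s) := by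
  simp only [Fm.inst, Fm.subst_subst, Sub.lift_cons, Tm.subst_id]

theorem Sub.cons_comp {Γ Δ Θ : Ctx} {τ : Ty} (a : Tm Δ τ) (s : Sub Γ Δ) (s' : Sub Δ Θ) :
    (fun σ x => (Sub.cons a s σ x).subst s') =
      Sub.cons (a.subst s') (fun σ x => (s σ x).subst s') := by
  funext σ x; cases x <;> rfl

theorem Tm.inst_subst {Γ Δ : Ctx} {σ τ : Ty} (t : Tm (τ :: Γ) σ) (a : Tm Γ τ) (s : Sub Γ Δ) :
    (t.inst a).subst s = (t.subst (s.lift τ)).inst (a.subst s) := by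
  rw [Tm.subst_lift_inst, Tm.inst, Tm.subst_subst, Sub.cons_comp]; rfl

theorem Fm.inst_subst {Γ Δ : Ctx} {τ : Ty} (φ : Fm (τ :: Γ)) (a : Tm Γ τ) (s : Sub Γ Δ) :
    (φ.inst a).subst s = (φ.subst (s.lift τ)).inst (a.subst s) := by
  rw [Fm.subst_lift_inst, Fm.inst, Fm.subst_subst, Sub.cons_comp]; rfl

/-! ### Structural rules -/

/-- The axioms are schemes, so an instance goes to an instance. Only induction and choice, which
contain substitutions themselves, require two composite substitutions to be compared variable by
variable. -/
theorem Ax.subst {Γ Δ : Ctx} {φ : Fm Γ} (h : Ax φ) (s : Sub Γ Δ) : Ax (φ.subst s) := by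
  cases h with
  | beta t a =>
    simp only [Fm.subst, Tm.inst_subst]
    exact .beta _ _
  | funext f g =>
    simp only [Fm.subst, Tm.subst, Tm.wk_subst_lift]
    exact .funext _ _
  | succ_ne_zero n => exact .succ_ne_zero _
  | succ_inj n m => exact .succ_inj _ _
  | rec_zero a f => exact .rec_zero _ _
  | rec_succ a f n => exact .rec_succ _ _ _
  | induction φ =>
    have h := Ax.induction (φ.subst (s.lift Ty.nat))
    rw [show (Tm.zero : Tm Δ Ty.nat) = Tm.subst s .zero from rfl, ← Fm.inst_subst,
      Fm.subst_subst] at h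
    simp only [Fm.subst, Fm.subst_subst]
    convert h using 6
    funext σ x
    cases x with
    | zero => rfl
    | succ x =>
      simp only [Sub.lift, Sub.cons, Tm.wk_subst_cons, Tm.subst]
      simp only [Tm.wk, Tm.rename_eq_subst]
  | @countable_choice σ φ =>
    have h := Ax.countable_choice (φ.subst ((s.lift Ty.nat).lift σ))
    rw [Fm.subst_subst] at h
    simp only [Fm.subst, Fm.subst_subst]
    convert h using 5
    funext σ x
    match x with
    | .zero => rfl
    | .succ .zero => rfl
    | .succ (.succ x) =>
      simp only [Sub.lift, Sub.cons, Tm.wk_subst_cons, Tm.subst]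
      simp only [Tm.wk, Tm.rename_eq_subst, Tm.subst_subst, Tm.subst]
  | qadd_assoc a b c => exact .qadd_assoc _ _ _
  | qadd_comm a b => exact .qadd_comm _ _
  | qadd_zero a => exact .qadd_zero _
  | qadd_neg a => exact .qadd_neg _
  | qmul_assoc a b c => exact .qmul_assoc _ _ _
  | qmul_comm a b => exact .qmul_comm _ _
  | qmul_one a => exact .qmul_one _
  | qmul_add a b c => exact .qmul_add _ _ _
  | qmul_inv a => exact .qmul_inv _
  | qzero_ne_one => exact .qzero_ne_one
  | qle_char a b => exact .qle_char _ _
  | qle_trans a b c => exact .qle_trans _ _ _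
  | qle_antisymm a b => exact .qle_antisymm _ _
  | qle_total a b => exact .qle_total _ _
  | qadd_le a b c => exact .qadd_le _ _ _
  | qmul_nonneg a b => exact .qmul_nonneg _ _
  | qfrac a =>
    simp only [Fm.subst, Tm.subst, Tm.wk_subst_lift]
    exact .qfrac _

theorem List.map_wk_subst {Γ Δ : Ctx} {τ : Ty} (H : List (Fm Γ)) (s : Sub Γ Δ) :
    (H.map Fm.wk).map (Fm.subst (s.lift τ)) = (H.map (Fm.subst s)).map Fm.wk := by
  simp [Fm.wk_subst_lift]

theorem Prf.subst {Γ Δ : Ctx} {H : List (Fm Γ)} {φ : Fm Γ} (h : Prf H φ) (s : Sub Γ Δ) :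
    Prf (H.map (Fm.subst s)) (φ.subst s) := by
  induction h generalizing Δ with
  | ax h => exact .ax (h.subst s)
  | hyp h => exact .hyp (List.mem_map_of_mem h)
  | botE _ ih => exact .botE (ih s)
  | andI _ _ ih₁ ih₂ => exact .andI (ih₁ s) (ih₂ s)
  | andE₁ _ ih => exact .andE₁ (ih s)
  | andE₂ _ ih => exact .andE₂ (ih s)
  | orI₁ _ ih => exact .orI₁ (ih s)
  | orI₂ _ ih => exact .orI₂ (ih s)
  | orE _ _ _ ih ih₁ ih₂ => exact .orE (ih s) (ih₁ s) (ih₂ s)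
  | impI _ ih => exact .impI (ih s)
  | impE _ _ ih₁ ih₂ => exact .impE (ih₁ s) (ih₂ s)
  | allI _ ih =>
    have := ih (s.lift _)
    rw [List.map_wk_subst] at this
    exact .allI this
  | allE t _ ih =>
    rw [Fm.inst_subst]
    exact .allE _ (ih s)
  | exI t _ ih =>
    have := ih s
    rw [Fm.inst_subst] at this
    exact .exI _ this
  | exE _ _ ih₁ ih₂ =>
    have := ih₂ (s.lift _)
    rw [List.map_cons, List.map_wk_subst, Fm.wk_subst_lift] at this
    exact .exE (ih₁ s) this
  | eqI t => exact .eqI _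
  | eqE φ _ _ ih₁ ih₂ =>
    have := ih₂ s
    rw [Fm.inst_subst] at this ⊢
    exact .eqE _ (ih₁ s) this

theorem Prf.mono {Γ : Ctx} {H H' : List (Fm Γ)} {φ : Fm Γ} (h : Prf H φ) (hs : H ⊆ H') :
    Prf H' φ := by
  induction h with
  | ax h => exact .ax h
  | hyp h => exact .hyp (hs h)
  | botE _ ih => exact .botE (ih hs)
  | andI _ _ ih₁ ih₂ => exact .andI (ih₁ hs) (ih₂ hs)
  | andE₁ _ ih => exact .andE₁ (ih hs)
  | andE₂ _ ih => exact .andE₂ (ih hs)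
  | orI₁ _ ih => exact .orI₁ (ih hs)
  | orI₂ _ ih => exact .orI₂ (ih hs)
  | orE _ _ _ ih ih₁ ih₂ =>
    exact .orE (ih hs) (ih₁ (List.cons_subset_cons _ hs)) (ih₂ (List.cons_subset_cons _ hs))
  | impI _ ih => exact .impI (ih (List.cons_subset_cons _ hs))
  | impE _ _ ih₁ ih₂ => exact .impE (ih₁ hs) (ih₂ hs)
  | allI _ ih => exact .allI (ih (List.map_subset _ hs))
  | allE t _ ih => exact .allE _ (ih hs)
  | exI t _ ih => exact .exI _ (ih hs)
  | exE _ _ ih₁ ih₂ =>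
    exact .exE (ih₁ hs) (ih₂ (List.cons_subset_cons _ (List.map_subset _ hs)))
  | eqI t => exact .eqI _
  | eqE φ _ _ ih₁ ih₂ => exact .eqE _ (ih₁ hs) (ih₂ hs)

theorem Prf.wk {Γ : Ctx} {H : List (Fm Γ)} {φ : Fm Γ} {τ : Ty} (h : Prf H φ) :
    Prf (H.map (Fm.wk (τ := τ))) φ.wk := by
  have := h.subst (fun σ x => Tm.var (Var.succ (τ := τ) x))
  have e : (Fm.wk (τ := τ) : Fm Γ → _) = Fm.subst (fun σ x => Tm.var x.succ) :=
    funext fun φ => φ.rename_eq_subst _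
  rwa [e]

/-- Cut: the hypotheses of a derivation may be replaced by derivations of them. -/
theorem Prf.cut {Γ : Ctx} {H H' : List (Fm Γ)} {φ : Fm Γ} (h : Prf H φ)
    (hH : ∀ ψ ∈ H, Prf H' ψ) : Prf H' φ := by
  induction H generalizing φ with
  | nil => exact h.mono (by simp)
  | cons ψ H ih =>
    exact .impE (ih (.impI h) fun χ hχ => hH χ (by simp [hχ])) (hH ψ (by simp))

end Bish

namespace Bish

/-! ### Formulas are countable -/

def Ty.code : Ty → ℕ
  | .nat => 0
  | .rat => 1
  | .fn σ τ => Nat.pair σ.code τ.code + 2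

theorem Ty.code_injective : Function.Injective Ty.code := by
  intro σ
  induction σ with
  | nat => intro τ h; cases τ <;> simp_all [Ty.code]
  | rat => intro τ h; cases τ <;> simp_all [Ty.code]
  | fn σ₁ σ₂ ih₁ ih₂ =>
    intro τ h
    cases τ with
    | fn τ₁ τ₂ =>
      simp only [Ty.code, Nat.add_right_cancel_iff, Nat.pair_eq_pair] at h
      rw [ih₁ h.1, ih₂ h.2]
    | _ => simp [Ty.code] at h

def Var.code : {Γ : Ctx} → {σ : Ty} → Var Γ σ → ℕ
  | _, _, .zero => 0
  | _, _, .succ x => x.code + 1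

theorem Var.code_inj {Γ : Ctx} {σ : Ty} {x y : Var Γ σ} (h : x.code = y.code) : x = y := by
  induction x with
  | zero => cases y with
    | zero => rfl
    | succ y => simp [Var.code] at h
  | succ x ih => cases y with
    | zero => simp [Var.code] at h
    | succ y => rw [ih (by simpa [Var.code] using h)]

/-- Only `app` records a type: it is the one constructor whose arguments have a type not determined
by the context and the type of the whole term. -/
def Tm.code : {Γ : Ctx} → {σ : Ty} → Tm Γ σ → ℕ
  | _, _, .var x => Nat.pair 0 x.code
  | _, _, @Tm.app _ σ _ f a => Nat.pair 1 (Nat.pair σ.code (Nat.pair f.code a.code))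
  | _, _, .lam t => Nat.pair 2 t.code
  | _, _, .zero => Nat.pair 3 0
  | _, _, .succ n => Nat.pair 4 n.code
  | _, _, .natRec a f n => Nat.pair 5 (Nat.pair a.code (Nat.pair f.code n.code))
  | _, _, .qzero => Nat.pair 6 0
  | _, _, .qone => Nat.pair 7 0
  | _, _, .qadd a b => Nat.pair 8 (Nat.pair a.code b.code)
  | _, _, .qneg a => Nat.pair 9 a.code
  | _, _, .qmul a b => Nat.pair 10 (Nat.pair a.code b.code)
  | _, _, .qinv a => Nat.pair 11 a.code
  | _, _, .qle a b => Nat.pair 12 (Nat.pair a.code b.code)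

theorem Tm.code_inj {Γ : Ctx} {σ : Ty} {t u : Tm Γ σ} (h : t.code = u.code) : t = u := by
  induction t with
  | var x =>
    cases u <;> simp only [Tm.code, Nat.pair_eq_pair] at h <;> try omega
    rw [Var.code_inj h.2]
  | app f a ihf iha =>
    cases u <;> simp only [Tm.code, Nat.pair_eq_pair] at h <;> try omega
    obtain ⟨-, h₁, h₂, h₃⟩ := h
    cases Ty.code_injective h₁
    rw [ihf h₂, iha h₃]
  | lam t ih =>
    cases u <;> simp only [Tm.code, Nat.pair_eq_pair] at h <;> try omega
    rw [ih h.2]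
  | natRec a f n iha ihf ihn =>
    cases u <;> simp only [Tm.code, Nat.pair_eq_pair] at h <;> try omega
    rw [iha h.2.1, ihf h.2.2.1, ihn h.2.2.2]
  | zero => cases u <;> simp only [Tm.code, Nat.pair_eq_pair] at h <;> first | omega | rfl
  | qzero => cases u <;> simp only [Tm.code, Nat.pair_eq_pair] at h <;> first | omega | rfl
  | qone => cases u <;> simp only [Tm.code, Nat.pair_eq_pair] at h <;> first | omega | rfl
  | succ n ih =>
    cases u <;> simp only [Tm.code, Nat.pair_eq_pair] at h <;> try omega
    rw [ih h.2]
  | qneg n ih =>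
    cases u <;> simp only [Tm.code, Nat.pair_eq_pair] at h <;> try omega
    rw [ih h.2]
  | qinv n ih =>
    cases u <;> simp only [Tm.code, Nat.pair_eq_pair] at h <;> try omega
    rw [ih h.2]
  | qadd a b iha ihb =>
    cases u <;> simp only [Tm.code, Nat.pair_eq_pair] at h <;> try omega
    rw [iha h.2.1, ihb h.2.2]
  | qmul a b iha ihb =>
    cases u <;> simp only [Tm.code, Nat.pair_eq_pair] at h <;> try omega
    rw [iha h.2.1, ihb h.2.2]
  | qle a b iha ihb =>
    cases u <;> simp only [Tm.code, Nat.pair_eq_pair] at h <;> try omega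
    rw [iha h.2.1, ihb h.2.2]

def Fm.code : {Γ : Ctx} → Fm Γ → ℕ
  | _, @Fm.eq _ σ a b => Nat.pair 0 (Nat.pair σ.code (Nat.pair a.code b.code))
  | _, .bot => Nat.pair 1 0
  | _, .and φ ψ => Nat.pair 2 (Nat.pair φ.code ψ.code)
  | _, .or φ ψ => Nat.pair 3 (Nat.pair φ.code ψ.code)
  | _, .imp φ ψ => Nat.pair 4 (Nat.pair φ.code ψ.code)
  | _, .all σ φ => Nat.pair 5 (Nat.pair σ.code φ.code)
  | _, .ex σ φ => Nat.pair 6 (Nat.pair σ.code φ.code)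

theorem Fm.code_inj {Γ : Ctx} {φ ψ : Fm Γ} (h : φ.code = ψ.code) : φ = ψ := by
  induction φ with
  | eq a b =>
    cases ψ <;> simp only [Fm.code, Nat.pair_eq_pair] at h <;> try omega
    obtain ⟨-, h₁, h₂, h₃⟩ := h
    cases Ty.code_injective h₁
    rw [Tm.code_inj h₂, Tm.code_inj h₃]
  | bot => cases ψ <;> simp only [Fm.code, Nat.pair_eq_pair] at h <;> first | omega | rfl
  | and a b iha ihb =>
    cases ψ <;> simp only [Fm.code, Nat.pair_eq_pair] at h <;> try omega
    rw [iha h.2.1, ihb h.2.2]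
  | or a b iha ihb =>
    cases ψ <;> simp only [Fm.code, Nat.pair_eq_pair] at h <;> try omega
    rw [iha h.2.1, ihb h.2.2]
  | imp a b iha ihb =>
    cases ψ <;> simp only [Fm.code, Nat.pair_eq_pair] at h <;> try omega
    rw [iha h.2.1, ihb h.2.2]
  | all σ a ih =>
    cases ψ <;> simp only [Fm.code, Nat.pair_eq_pair] at h <;> try omega
    cases Ty.code_injective h.2.1
    rw [ih h.2.2]
  | ex σ a ih =>
    cases ψ <;> simp only [Fm.code, Nat.pair_eq_pair] at h <;> try omega
    cases Ty.code_injective h.2.1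
    rw [ih h.2.2]

theorem Fm.exists_enum (Γ : Ctx) : ∃ d : ℕ → Fm Γ, Function.Surjective d := by
  have : Countable (Fm Γ) := ⟨Fm.code, fun _ _ h => Fm.code_inj h⟩
  have : Nonempty (Fm Γ) := ⟨.bot⟩
  exact exists_surjective_nat _

/-- An enumeration of the formulas in a context. -/
noncomputable def Fm.enum (Γ : Ctx) : ℕ → Fm Γ := (Fm.exists_enum Γ).choose

theorem Fm.enum_surjective (Γ : Ctx) : Function.Surjective (Fm.enum Γ) :=
  (Fm.exists_enum Γ).choose_spec

/-! ### Equality -/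

theorem Prf.eq_symm {Γ : Ctx} {H : List (Fm Γ)} {σ : Ty} {s t : Tm Γ σ} (h : Prf H (.eq s t)) :
    Prf H (.eq t s) := by
  have := Prf.eqE (φ := .eq v0 s.wk) h
  simp only [Fm.inst, Fm.subst, Tm.wk_subst_cons, Tm.subst_id] at this
  exact this (.eqI s)

theorem Prf.eq_trans {Γ : Ctx} {H : List (Fm Γ)} {σ : Ty} {s t u : Tm Γ σ}
    (h : Prf H (.eq s t)) (h' : Prf H (.eq t u)) : Prf H (.eq s u) := by
  have := Prf.eqE (φ := .eq s.wk v0) h'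
  simp only [Fm.inst, Fm.subst, Tm.wk_subst_cons, Tm.subst_id] at this
  exact this h

theorem Prf.eq_app {Γ : Ctx} {H : List (Fm Γ)} {σ τ : Ty} {f g : Tm Γ (.fn σ τ)} {a b : Tm Γ σ}
    (h : Prf H (.eq f g)) (h' : Prf H (.eq a b)) : Prf H (.eq (.app f a) (.app g b)) := by
  have h₁ := Prf.eqE (φ := .eq (Tm.app f a).wk (.app v0 a.wk)) h
  have h₂ := Prf.eqE (φ := .eq (Tm.app f a).wk (.app g.wk v0)) h'
  simp only [Fm.inst, Fm.subst, Tm.subst, Tm.wk_subst_cons, Tm.subst_id] at h₁ h₂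
  exact h₂ (h₁ (.eqI _))

/-- Terms with provably equal substitutes are provably equal. -/
theorem Prf.eq_subst {Δ Γ : Ctx} {H : List (Fm Γ)} {σ : Ty} (t : Tm Δ σ) (s s' : Sub Δ Γ)
    (h : ∀ τ x, Prf H (.eq (s τ x) (s' τ x))) : Prf H (.eq (t.subst s) (t.subst s')) := by
  induction Δ generalizing σ with
  | nil =>
    rw [show s = s' from funext fun _ => funext fun x => nomatch x]
    exact .eqI _
  | cons τ Δ ih =>
    -- By β, substitution for the last variable is application of a λ-term, so congruence of
    -- application and induction on the context suffice. No induction on `t`, and hence no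
    -- congruence rule for λ, is needed.
    have key : ∀ s : Sub (τ :: Δ) Γ, Prf H (.eq
        (.app ((Tm.lam t).subst fun σ x => s σ x.succ) (s τ .zero)) (t.subst s)) := by
      intro s
      have hb := Prf.ax (H := H) (.beta (t.subst (Sub.lift (fun σ x => s σ x.succ) τ)) (s τ .zero))
      rw [Tm.subst_lift_inst] at hb
      rw [show Sub.cons (s τ .zero) (fun σ x => s σ x.succ) = s by
        funext σ x; cases x <;> rfl] at hb
      exact hb
    exact .eq_trans (key s).eq_symm (.eq_trans
      (.eq_app (ih (.lam t) _ _ fun τ x => h τ x.succ) (h _ _)) (key s'))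

theorem Prf.lift_eq {Δ Γ : Ctx} {H : List (Fm Γ)} {s s' : Sub Δ Γ} {υ : Ty}
    (h : ∀ τ x, Prf H (.eq (s τ x) (s' τ x))) (τ : Ty) (x : Var (υ :: Δ) τ) :
    Prf (H.map Fm.wk) (.eq (s.lift υ τ x) (s'.lift υ τ x)) := by
  cases x with
  | zero => exact .eqI _
  | succ x => exact (h τ x).wk

/-- This is the form in which a weakened quantified formula appears once it is instantiated at the
fresh variable. -/
theorem Fm.rename_lift_inst_var {Γ : Ctx} {τ : Ty} (φ : Fm (τ :: Γ)) :
    (φ.rename (Ren.lift (fun _ x => x.succ) τ)).inst v0 = φ := by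
  rw [Fm.inst, Fm.subst_rename]
  nth_rw 2 [← Fm.subst_id φ]
  congr 1
  funext σ x; cases x <;> rfl

/-- Formulas with provably equal substitutes are provably equivalent. -/
theorem Prf.congr_subst {Δ Γ : Ctx} {H : List (Fm Γ)} (φ : Fm Δ) (s s' : Sub Δ Γ)
    (h : ∀ τ x, Prf H (.eq (s τ x) (s' τ x))) (hφ : Prf H (φ.subst s)) :
    Prf H (φ.subst s') := by
  induction φ generalizing Γ with
  | eq a b =>
    exact .eq_trans (Prf.eq_subst a s s' h).eq_symm (.eq_trans hφ (Prf.eq_subst b s s' h))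
  | bot => exact hφ
  | and φ ψ ih₁ ih₂ => exact .andI (ih₁ s s' h hφ.andE₁) (ih₂ s s' h hφ.andE₂)
  | or φ ψ ih₁ ih₂ =>
    exact .orE hφ
      (.orI₁ (ih₁ s s' (fun τ x => (h τ x).mono (by simp)) (.hyp (by simp))))
      (.orI₂ (ih₂ s s' (fun τ x => (h τ x).mono (by simp)) (.hyp (by simp))))
  | imp φ ψ ih₁ ih₂ =>
    refine .impI (ih₂ s s' (fun τ x => (h τ x).mono (by simp)) (.impE (hφ.mono (by simp)) ?_))
    exact ih₁ s' s (fun τ x => (h τ x).eq_symm.mono (by simp)) (.hyp (by simp))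
  | all τ φ ih =>
    refine .allI (ih _ _ (Prf.lift_eq h) ?_)
    have := Prf.allE v0 (hφ.wk (τ := τ))
    rwa [Fm.rename_lift_inst_var] at this
  | ex τ φ ih =>
    refine .exE hφ ?_
    refine .exI v0 ?_
    rw [Fm.rename_lift_inst_var]
    exact ih _ _ (fun σ x => (Prf.lift_eq h σ x).mono (by simp)) (.hyp (by simp))

end Bish

namespace Bish

/-! ### Prime models -/

/-- Assignments of elements of `D` to the variables of a context. -/
abbrev Env (D : Ty → Type) (Δ : Ctx) : Type := ∀ σ : Ty, Var Δ σ → D σ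

/-- An assignment, extended by a value for the last variable. -/
def Env.cons {D : Ty → Type} {Δ : Ctx} {τ : Ty} (d : D τ) (e : Env D Δ) : Env D (τ :: Δ)
  | _, .zero => d
  | _, .succ x => e _ x

/-- A model in which the formulas that hold form a deductively closed theory with the disjunction
and the existence property.  Implications and universal formulas that hold have the expected
consequences, but an implication need not hold merely because its premise does not. -/
structure PrimeModel where
  D : Ty → Type
  eval : {Δ : Ctx} → {σ : Ty} → Tm Δ σ → Env D Δ → D σ
  holds : {Δ : Ctx} → Fm Δ → Env D Δ → Prop
  eval_var : ∀ {Δ : Ctx} {σ : Ty} (x : Var Δ σ) (e : Env D Δ), eval (.var x) e = e σ x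
  eval_subst : ∀ {Δ Θ : Ctx} {σ : Ty} (t : Tm Δ σ) (s : Sub Δ Θ) (e : Env D Θ),
    eval (t.subst s) e = eval t (fun σ x => eval (s σ x) e)
  holds_subst : ∀ {Δ Θ : Ctx} (φ : Fm Δ) (s : Sub Δ Θ) (e : Env D Θ),
    holds (φ.subst s) e ↔ holds φ (fun σ x => eval (s σ x) e)
  sound : ∀ {Δ : Ctx} {H : List (Fm Δ)} {φ : Fm Δ} {e : Env D Δ}, Prf H φ →
    (∀ ψ ∈ H, holds ψ e) → holds φ e
  holds_eq : ∀ {Δ : Ctx} {σ : Ty} (t u : Tm Δ σ) (e : Env D Δ),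
    holds (.eq t u) e ↔ eval t e = eval u e
  not_holds_bot : ∀ {Δ : Ctx} (e : Env D Δ), ¬ holds .bot e
  or_of_holds : ∀ {Δ : Ctx} {φ ψ : Fm Δ} {e : Env D Δ}, holds (.or φ ψ) e →
    holds φ e ∨ holds ψ e
  ex_of_holds : ∀ {Δ : Ctx} {σ : Ty} {φ : Fm (σ :: Δ)} {e : Env D Δ}, holds (.ex σ φ) e →
    ∃ d : D σ, holds φ (Env.cons d e)

/-! ### The Henkin construction -/

namespace Henkin

/-- A finite stage of the construction: hypotheses that do not prove the formula `χ`, and the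
formulas of the earlier contexts, listed again in the present one. -/
structure Stage where
  Γ : Ctx
  H : List (Fm Γ)
  χ : Fm Γ
  hist : ℕ → ℕ → Fm Γ
  not_prf : ¬ Prf H χ

/-- A superfluous variable of type `nat` is removed by substituting zero. Hence the construction may
add dummy variables without making new formulas of the old context derivable. -/
theorem prf_of_wk {Γ : Ctx} {H : List (Fm Γ)} {φ : Fm Γ}
    (h : Prf (H.map (Fm.wk (τ := Ty.nat))) φ.wk) : Prf H φ := by
  have := h.subst (Sub.cons .zero fun _ x => .var x)
  simpa [Fm.wk_subst_cons, Fm.subst_id, Function.comp_def] using this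

/-- If `w.χ` followed from both disjuncts, or from a fresh witness, it would follow from `θ` by
elimination. Where nothing is to be done, a dummy variable and the hypothesis `0 = 0` are added, so
that every step extends the context by exactly one variable. -/
theorem exists_extension (w : Stage) (θ : Fm w.Γ) : ∃ p : Σ τ : Ty, Fm (τ :: w.Γ),
    ¬ Prf (p.2 :: w.H.map Fm.wk) w.χ.wk ∧
    (∀ φ ψ, θ = .or φ ψ → Prf w.H θ → p.2 = φ.wk ∨ p.2 = ψ.wk) ∧
    (∀ σ φ, θ = .ex σ φ → Prf w.H θ → p = ⟨σ, φ⟩) := by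
  have add : ∀ φ : Fm w.Γ, ¬ Prf (φ :: w.H) w.χ →
      ¬ Prf (φ.wk (τ := .nat) :: w.H.map Fm.wk) w.χ.wk := fun φ h h' =>
    h (prf_of_wk (by simpa using h'))
  by_cases hθ : Prf w.H θ
  · cases θ with
    | or φ ψ =>
      by_cases hφ : Prf (φ :: w.H) w.χ
      · have hψ : ¬ Prf (ψ :: w.H) w.χ := fun hψ => w.not_prf (.orE hθ hφ hψ)
        refine ⟨⟨.nat, ψ.wk⟩, add _ hψ, fun φ' ψ' h _ => ?_, fun _ _ h => by cases h⟩
        cases h; exact .inr rfl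
      · refine ⟨⟨.nat, φ.wk⟩, add _ hφ, fun φ' ψ' h _ => ?_, fun _ _ h => by cases h⟩
        cases h; exact .inl rfl
    | ex σ φ =>
      refine ⟨⟨σ, φ⟩, fun h => w.not_prf (.exE hθ h), fun _ _ h => (by cases h), fun _ _ h _ => ?_⟩
      cases h; rfl
    | _ =>
      exact ⟨⟨.nat, Fm.wk (.eq .zero .zero)⟩,
        add _ fun h => w.not_prf (.impE (.impI h) (.eqI (.zero : Tm w.Γ .nat))),
        fun _ _ h => (by cases h), fun _ _ h => by cases h⟩
  · exact ⟨⟨.nat, Fm.wk (.eq .zero .zero)⟩,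
      add _ fun h => w.not_prf (.impE (.impI h) (.eqI (.zero : Tm w.Γ .nat))),
      fun _ _ _ h => (hθ h).elim, fun _ _ _ h => (hθ h).elim⟩

/-- The new variable and the new hypothesis by which the formula `θ` is taken care of. -/
noncomputable def extension (w : Stage) (θ : Fm w.Γ) : Σ τ : Ty, Fm (τ :: w.Γ) :=
  (exists_extension w θ).choose

/-- The formula to be taken care of at the stage `n`. -/
def Stage.task (w : Stage) (n : ℕ) : Fm w.Γ := w.hist n.unpair.1.unpair.1 n.unpair.1.unpair.2

/-- Row `n + 1` of the history enumerates the formulas of the new context; the other rows are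
weakened to it. -/
noncomputable def Stage.next (n : ℕ) (w : Stage) : Stage where
  Γ := (extension w (w.task n)).1 :: w.Γ
  H := (extension w (w.task n)).2 :: w.H.map Fm.wk
  χ := w.χ.wk
  hist i j := if i = n + 1 then Fm.enum _ j else (w.hist i j).wk
  not_prf := (exists_extension w (w.task n)).choose_spec.1

variable {Γ₀ : Ctx} {H₀ : List (Fm Γ₀)} {χ₀ : Fm Γ₀} (h₀ : ¬ Prf H₀ χ₀)

/-- Initially only row 0 of the history is meaningful. Row `n + 1` is overwritten when stage `n + 1`
is formed, and the task of stage `n` lies in a row of index at most `n`. -/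
noncomputable def chain : ℕ → Stage
  | 0 => ⟨Γ₀, H₀, χ₀, fun _ j => Fm.enum Γ₀ j, h₀⟩
  | n + 1 => (chain n).next n

/-- The inclusion of the variables of an earlier stage. -/
noncomputable def ren {n m : ℕ} (h : n ≤ m) : Ren (chain h₀ n).Γ (chain h₀ m).Γ := fun σ =>
  Nat.leRecOn (C := fun k => Var (chain h₀ k).Γ σ) h (fun {_} x => Var.succ x)

theorem ren_self (n : ℕ) : ren h₀ (le_refl n) = fun _ x => x := by
  funext σ x; exact Nat.leRecOn_self _

theorem ren_succ {n m : ℕ} (h : n ≤ m) :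
    ren h₀ (h.trans m.le_succ) = fun σ x => Var.succ (ren h₀ h σ x) := by
  funext σ x; exact Nat.leRecOn_succ h _

theorem ren_trans {n m k : ℕ} (h : n ≤ m) (h' : m ≤ k) :
    (fun σ x => ren h₀ h' σ (ren h₀ h σ x)) = ren h₀ (h.trans h') := by
  funext σ x; exact (Nat.leRecOn_trans h h' _).symm

/-- The substitution that belongs to the inclusion `ren`. -/
noncomputable def emb {n m : ℕ} (h : n ≤ m) : Sub (chain h₀ n).Γ (chain h₀ m).Γ :=
  fun σ x => .var (ren h₀ h σ x)

theorem emb_self (n : ℕ) : emb h₀ (le_refl n) = fun _ x => .var x := by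
  unfold emb; rw [ren_self]

theorem emb_trans {n m k : ℕ} (h : n ≤ m) (h' : m ≤ k) :
    (fun σ x => (emb h₀ h σ x).subst (emb h₀ h')) = emb h₀ (h.trans h') := by
  unfold emb; rw [← ren_trans h₀ h h']; rfl

theorem fm_emb_succ {n m : ℕ} (h : n ≤ m) (φ : Fm (chain h₀ n).Γ) :
    φ.subst (emb h₀ (h.trans m.le_succ)) = (φ.subst (emb h₀ h)).wk := by
  unfold emb
  rw [ren_succ]
  exact (Fm.rename_subst φ (fun σ x => Tm.var (ren h₀ h σ x)) (fun _ x => Var.succ x)).symm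

theorem hist_eq {n m : ℕ} (h : n ≤ m) (j : ℕ) :
    (chain h₀ m).hist n j = (Fm.enum _ j).subst (emb h₀ h) := by
  induction m, h using Nat.le_induction with
  | base =>
    rw [emb_self, Fm.subst_id]
    cases n with
    | zero => rfl
    | succ n => exact if_pos rfl
  | succ m h ih =>
    rw [fm_emb_succ h₀ h, ← ih]
    exact if_neg (by omega)

theorem prf_emb {n m : ℕ} (h : n ≤ m) {φ : Fm (chain h₀ n).Γ} (hφ : Prf (chain h₀ n).H φ) :
    Prf (chain h₀ m).H (φ.subst (emb h₀ h)) := by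
  induction m, h using Nat.le_induction with
  | base => rwa [emb_self, Fm.subst_id]
  | succ m h ih =>
    rw [fm_emb_succ h₀ h]
    exact ih.wk.mono (List.subset_cons_self _ _)

/-- Every formula of the stage `n` is the task of a later stage. -/
theorem exists_task (n : ℕ) (θ : Fm (chain h₀ n).Γ) : ∃ m, ∃ h : n ≤ m,
    (chain h₀ m).task m = θ.subst (emb h₀ h) := by
  obtain ⟨j, rfl⟩ := Fm.enum_surjective _ θ
  -- This number decodes to row `n`, entry `j`, and it is at least `n`, so the row exists by then.
  refine ⟨Nat.pair (Nat.pair n j) 0, (Nat.left_le_pair _ _).trans (Nat.left_le_pair _ _), ?_⟩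
  rw [Stage.task, ← hist_eq]
  simp

theorem or_stage {n : ℕ} {φ ψ : Fm (chain h₀ n).Γ} (h : Prf (chain h₀ n).H (.or φ ψ)) :
    ∃ m, ∃ h : n ≤ m, Prf (chain h₀ m).H (φ.subst (emb h₀ h)) ∨
      Prf (chain h₀ m).H (ψ.subst (emb h₀ h)) := by
  obtain ⟨m, hm, e⟩ := exists_task h₀ n (.or φ ψ)
  have hp := prf_emb h₀ hm h
  rw [← e] at hp
  refine ⟨m + 1, hm.trans m.le_succ, ?_⟩
  rw [fm_emb_succ h₀ hm, fm_emb_succ h₀ hm]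
  rcases (exists_extension (chain h₀ m) ((chain h₀ m).task m)).choose_spec.2.1 _ _ e hp with h | h
  · exact .inl (.hyp (h ▸ List.mem_cons_self))
  · exact .inr (.hyp (h ▸ List.mem_cons_self))

theorem ex_stage {n : ℕ} {σ : Ty} {φ : Fm (σ :: (chain h₀ n).Γ)}
    (h : Prf (chain h₀ n).H (.ex σ φ)) :
    ∃ m, ∃ h : n ≤ m, ∃ t : Tm (chain h₀ m).Γ σ,
      Prf (chain h₀ m).H (φ.subst (Sub.cons t (emb h₀ h))) := by
  obtain ⟨m, hm, e⟩ := exists_task h₀ n (.ex σ φ)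
  have hp := prf_emb h₀ hm h
  rw [← e] at hp
  have hx : extension (chain h₀ m) ((chain h₀ m).task m) = _ :=
    (exists_extension (chain h₀ m) ((chain h₀ m).task m)).choose_spec.2.2 _ _ e hp
  -- The type of the new variable is a component of `extension`. Generalizing the pair allows its
  -- equation to be eliminated by substitution.
  have key : ∀ p : Σ τ : Ty, Fm (τ :: (chain h₀ m).Γ),
      p = ⟨σ, φ.subst ((emb h₀ hm).lift σ)⟩ → ∃ t : Tm (p.1 :: (chain h₀ m).Γ) σ,
        φ.subst (Sub.cons t fun τ x => (emb h₀ hm τ x).wk) = p.2 := by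
    rintro _ rfl
    refine ⟨v0, congrArg (fun s => Fm.subst s φ) ?_⟩
    funext τ x; cases x <;> rfl
  obtain ⟨t, ht⟩ := key _ hx
  refine ⟨m + 1, hm.trans m.le_succ, t, ?_⟩
  have : emb h₀ (hm.trans m.le_succ) = fun τ x => (emb h₀ hm τ x).wk := by
    unfold emb; rw [ren_succ]; rfl
  rw [this]
  refine .hyp ?_
  exact ht ▸ List.mem_cons_self

/-! #### The limit -/

theorem sub_emb_emb {Δ : Ctx} {n m k : ℕ} (s : Sub Δ (chain h₀ n).Γ) (h : n ≤ m) (h' : m ≤ k) :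
    (fun σ x => ((s σ x).subst (emb h₀ h)).subst (emb h₀ h')) =
      fun σ x => (s σ x).subst (emb h₀ (h.trans h')) := by
  funext σ x; rw [Tm.subst_subst, emb_trans]

/-- Terms of the stages, identified if they are provably equal at a later stage. -/
def limSetoid (σ : Ty) : Setoid (Σ n, Tm (chain h₀ n).Γ σ) where
  r a b := ∃ k, ∃ (h : a.1 ≤ k) (h' : b.1 ≤ k),
    Prf (chain h₀ k).H (.eq (a.2.subst (emb h₀ h)) (b.2.subst (emb h₀ h')))
  iseqv := by
    refine ⟨fun a => ⟨a.1, le_rfl, le_rfl, .eqI _⟩, ?_, ?_⟩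
    · rintro a b ⟨k, h, h', p⟩
      exact ⟨k, h', h, p.eq_symm⟩
    · rintro a b c ⟨k, h₁, h₂, p⟩ ⟨l, h₃, h₄, q⟩
      have p' := prf_emb h₀ (le_max_left k l) p
      have q' := prf_emb h₀ (le_max_right k l) q
      simp only [Fm.subst, Tm.subst_subst, emb_trans] at p' q'
      exact ⟨max k l, _, _, p'.eq_trans q'⟩

def Lim (σ : Ty) : Type := Quotient (limSetoid h₀ σ)

def mk {n : ℕ} {σ : Ty} (t : Tm (chain h₀ n).Γ σ) : Lim h₀ σ := Quotient.mk _ ⟨n, t⟩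

theorem mk_eq_mk {n m : ℕ} {σ : Ty} {t : Tm (chain h₀ n).Γ σ} {u : Tm (chain h₀ m).Γ σ} :
    mk h₀ t = mk h₀ u ↔ ∃ k, ∃ (h : n ≤ k) (h' : m ≤ k),
      Prf (chain h₀ k).H (.eq (t.subst (emb h₀ h)) (u.subst (emb h₀ h'))) :=
  Quotient.eq (r := limSetoid h₀ σ)

theorem mk_emb {n m : ℕ} (h : n ≤ m) {σ : Ty} (t : Tm (chain h₀ n).Γ σ) :
    mk h₀ (t.subst (emb h₀ h)) = mk h₀ t := by
  rw [mk_eq_mk]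
  refine ⟨m, le_rfl, h, ?_⟩
  rw [Tm.subst_subst, emb_trans]
  exact .eqI _

/-- The substitution `s` represents the assignment `e`. -/
def Rep {Δ : Ctx} {n : ℕ} (s : Sub Δ (chain h₀ n).Γ) (e : Env (Lim h₀) Δ) : Prop :=
  ∀ σ x, mk h₀ (s σ x) = e σ x

theorem Rep.emb {Δ : Ctx} {n m : ℕ} {s : Sub Δ (chain h₀ n).Γ} {e : Env (Lim h₀) Δ}
    (h : Rep h₀ s e) (hm : n ≤ m) : Rep h₀ (fun σ x => (s σ x).subst (emb h₀ hm)) e :=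
  fun σ x => (mk_emb h₀ hm _).trans (h σ x)

theorem exists_rep {Δ : Ctx} (e : Env (Lim h₀) Δ) :
    ∃ n, ∃ s : Sub Δ (chain h₀ n).Γ, Rep h₀ s e := by
  induction Δ with
  | nil => exact ⟨0, fun _ x => (nomatch x), fun _ x => nomatch x⟩
  | cons τ Δ ih =>
    obtain ⟨n, s, hs⟩ := ih fun σ x => e σ x.succ
    obtain ⟨⟨m, t⟩, ht⟩ := Quotient.exists_rep (e τ .zero)
    refine ⟨max n m, Sub.cons (t.subst (Henkin.emb h₀ (le_max_right n m)))
      (fun σ x => (s σ x).subst (Henkin.emb h₀ (le_max_left n m))), fun σ x => ?_⟩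
    cases x with
    | zero => exact (mk_emb h₀ _ t).trans ht
    | succ x => exact hs.emb h₀ _ σ x

theorem rep_unique {Δ : Ctx} {n m : ℕ} {s : Sub Δ (chain h₀ n).Γ} {s' : Sub Δ (chain h₀ m).Γ}
    {e : Env (Lim h₀) Δ} (h : Rep h₀ s e) (h' : Rep h₀ s' e) :
    ∃ k, ∃ (hn : n ≤ k) (hm : m ≤ k), ∀ σ x, Prf (chain h₀ k).H
      (.eq ((s σ x).subst (emb h₀ hn)) ((s' σ x).subst (emb h₀ hm))) := by
  induction Δ with
  | nil => exact ⟨max n m, le_max_left _ _, le_max_right _ _, fun _ x => nomatch x⟩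
  | cons τ Δ ih =>
    obtain ⟨k, h₁, h₂, p⟩ := ih (s := fun σ x => s σ x.succ) (s' := fun σ x => s' σ x.succ)
      (e := fun σ x => e σ x.succ) (fun σ x => h σ x.succ) (fun σ x => h' σ x.succ)
    obtain ⟨l, h₃, h₄, q⟩ := (mk_eq_mk h₀).1 ((h τ .zero).trans (h' τ .zero).symm)
    refine ⟨max k l, h₁.trans (le_max_left _ _), h₂.trans (le_max_left _ _), fun σ x => ?_⟩
    cases x with
    | zero =>
      have := prf_emb h₀ (le_max_right k l) q
      simpa only [Fm.subst, Tm.subst_subst, emb_trans] using this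
    | succ x =>
      have := prf_emb h₀ (le_max_left k l) (p σ x)
      simpa only [Fm.subst, Tm.subst_subst, emb_trans] using this

/-- The choice of a representing substitution is immaterial, by `eval_eq`. -/
noncomputable def eval {Δ : Ctx} {σ : Ty} (t : Tm Δ σ) (e : Env (Lim h₀) Δ) : Lim h₀ σ :=
  mk h₀ (t.subst (exists_rep h₀ e).choose_spec.choose)

theorem eval_eq {Δ : Ctx} {σ : Ty} (t : Tm Δ σ) {e : Env (Lim h₀) Δ} {n : ℕ}
    {s : Sub Δ (chain h₀ n).Γ} (hs : Rep h₀ s e) : eval h₀ t e = mk h₀ (t.subst s) := by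
  obtain ⟨k, h₁, h₂, p⟩ := rep_unique h₀ (exists_rep h₀ e).choose_spec.choose_spec hs
  rw [eval, mk_eq_mk]
  refine ⟨k, h₁, h₂, ?_⟩
  rw [Tm.subst_subst, Tm.subst_subst]
  exact Prf.eq_subst t _ _ p

/-- Here some representation is asked for; by `holds_iff` any other one serves equally well, at a
possibly later stage. -/
def holds {Δ : Ctx} (φ : Fm Δ) (e : Env (Lim h₀) Δ) : Prop :=
  ∃ n, ∃ s : Sub Δ (chain h₀ n).Γ, Rep h₀ s e ∧ Prf (chain h₀ n).H (φ.subst s)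

theorem holds_iff {Δ : Ctx} (φ : Fm Δ) {e : Env (Lim h₀) Δ} {n : ℕ}
    {s : Sub Δ (chain h₀ n).Γ} (hs : Rep h₀ s e) :
    holds h₀ φ e ↔ ∃ m, ∃ h : n ≤ m,
      Prf (chain h₀ m).H (φ.subst fun σ x => (s σ x).subst (emb h₀ h)) := by
  constructor
  · rintro ⟨m, s', hs', p⟩
    obtain ⟨k, h₁, h₂, q⟩ := rep_unique h₀ hs' hs
    refine ⟨k, h₂, Prf.congr_subst φ _ _ q ?_⟩
    have := prf_emb h₀ h₁ p
    rwa [Fm.subst_subst] at this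
  · rintro ⟨m, h, p⟩
    exact ⟨m, _, hs.emb h₀ h, p⟩

theorem rep_comp {Δ Θ : Ctx} (s : Sub Δ Θ) {e : Env (Lim h₀) Θ} {n : ℕ}
    {s' : Sub Θ (chain h₀ n).Γ} (hs : Rep h₀ s' e) :
    Rep h₀ (fun σ x => (s σ x).subst s') (fun σ x => eval h₀ (s σ x) e) :=
  fun _ _ => (eval_eq h₀ _ hs).symm

/-- The list of premises is finite, so they are all derivable at a common stage; there the
substituted derivation is composed with their derivations by cut. -/
theorem sound {Δ : Ctx} {H : List (Fm Δ)} {φ : Fm Δ} {e : Env (Lim h₀) Δ} (hφ : Prf H φ)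
    (hH : ∀ ψ ∈ H, holds h₀ ψ e) : holds h₀ φ e := by
  obtain ⟨n, s, hs⟩ := exists_rep h₀ e
  have key : ∃ m, ∃ h : n ≤ m, ∀ ψ ∈ H,
      Prf (chain h₀ m).H (ψ.subst fun σ x => (s σ x).subst (emb h₀ h)) := by
    clear hφ
    induction H with
    | nil => exact ⟨n, le_rfl, by simp⟩
    | cons ψ H ih =>
      obtain ⟨m, h, p⟩ := ih fun χ hχ => hH χ (by simp [hχ])
      obtain ⟨m', h', q⟩ := (holds_iff h₀ ψ hs).1 (hH ψ (by simp))
      refine ⟨max m m', h.trans (le_max_left _ _), fun χ hχ => ?_⟩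
      rcases List.mem_cons.1 hχ with rfl | hχ
      · have := prf_emb h₀ (le_max_right m m') q
        rwa [Fm.subst_subst, sub_emb_emb] at this
      · have := prf_emb h₀ (le_max_left m m') (p χ hχ)
        rwa [Fm.subst_subst, sub_emb_emb] at this
  obtain ⟨m, h, p⟩ := key
  refine (holds_iff h₀ φ hs).2 ⟨m, h, (hφ.subst _).cut fun ψ hψ => ?_⟩
  obtain ⟨χ, hχ, rfl⟩ := List.mem_map.1 hψ
  exact p χ hχ

/-- The limit of the stages. -/
noncomputable def model : PrimeModel where
  D := Lim h₀
  eval := eval h₀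
  holds := holds h₀
  eval_var x e := by
    obtain ⟨n, s, hs⟩ := exists_rep h₀ e
    rw [eval_eq h₀ _ hs]; exact hs _ x
  eval_subst t s e := by
    obtain ⟨n, s', hs⟩ := exists_rep h₀ e
    rw [eval_eq h₀ _ hs, eval_eq h₀ _ (rep_comp h₀ s hs), Tm.subst_subst]
  holds_subst φ s e := by
    obtain ⟨n, s', hs⟩ := exists_rep h₀ e
    rw [holds_iff h₀ _ hs, holds_iff h₀ _ (rep_comp h₀ s hs)]
    simp only [Fm.subst_subst, Tm.subst_subst]
  sound := sound h₀
  holds_eq t u e := by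
    obtain ⟨n, s, hs⟩ := exists_rep h₀ e
    rw [holds_iff h₀ _ hs, eval_eq h₀ _ hs, eval_eq h₀ _ hs, mk_eq_mk]
    simp only [Fm.subst, Tm.subst_subst]
    exact ⟨fun ⟨m, h, p⟩ => ⟨m, h, h, p⟩, fun ⟨m, h, _, p⟩ => ⟨m, h, p⟩⟩
  not_holds_bot e := fun ⟨n, _, _, p⟩ => (chain h₀ n).not_prf (.botE p)
  or_of_holds := by
    rintro Δ φ ψ e ⟨n, s, hs, p⟩
    obtain ⟨m, h, p | p⟩ := or_stage h₀ p <;> rw [Fm.subst_subst] at p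
    · exact .inl ⟨m, _, hs.emb h₀ h, p⟩
    · exact .inr ⟨m, _, hs.emb h₀ h, p⟩
  ex_of_holds := by
    rintro Δ σ φ e ⟨n, s, hs, p⟩
    obtain ⟨m, h, t, p⟩ := ex_stage h₀ p
    rw [Fm.subst_subst, Sub.lift_cons] at p
    refine ⟨mk h₀ t, m, _, fun τ x => ?_, p⟩
    cases x with
    | zero => rfl
    | succ x => exact hs.emb h₀ h τ x

end Henkin

/-- Completeness: what holds in every prime model of the hypotheses is derivable from them. -/
theorem Prf.of_models {Γ : Ctx} {H : List (Fm Γ)} {φ : Fm Γ}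
    (h : ∀ (M : PrimeModel) (e : Env M.D Γ), (∀ ψ ∈ H, M.holds ψ e) → M.holds φ e) :
    Prf H φ := by
  by_contra h₀
  let e : Env (Henkin.model h₀).D Γ := fun σ x => Henkin.mk (n := 0) h₀ (.var x)
  have he : Henkin.Rep (n := 0) h₀ (fun _ x => .var x) e := fun _ _ => rfl
  obtain ⟨m, hm, p⟩ := (Henkin.holds_iff h₀ φ he).1 (h (Henkin.model h₀) e fun ψ hψ =>
    ⟨0, _, he, (Fm.subst_id ψ).symm ▸ Prf.hyp hψ⟩)
  -- The formula to be avoided at stage `m` is `φ` itself, weakened. If `φ` held in the limit, some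
  -- stage would derive its own `χ`.
  have hχ : ∀ m, (Henkin.chain h₀ m).χ = φ.subst (Henkin.emb h₀ m.zero_le) := by
    intro m
    induction m with
    | zero => rw [Henkin.emb_self]; exact (Fm.subst_id φ).symm
    | succ m ih =>
      exact (congrArg Fm.wk ih).trans (Henkin.fm_emb_succ h₀ m.zero_le φ).symm
  exact (Henkin.chain h₀ m).not_prf (by rw [hχ]; exact p)

end Bish

namespace Bish

/-! ### Assignments -/

@[simp] theorem Env.cons_zero {D : Ty → Type} {Δ : Ctx} {τ : Ty} (d : D τ) (e : Env D Δ) :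
    Env.cons d e τ .zero = d := rfl

@[simp] theorem Env.cons_succ {D : Ty → Type} {Δ : Ctx} {σ τ : Ty} (d : D τ) (e : Env D Δ)
    (x : Var Δ σ) : Env.cons d e σ (.succ x) = e σ x := rfl

/-- The assignment for the empty context. -/
def Env.nil {D : Ty → Type} : Env D [] := fun _ x => nomatch x

theorem Env.exists_cons {D : Ty → Type} {Δ : Ctx} {τ : Ty} (e : Env D (τ :: Δ)) :
    ∃ d e', e = Env.cons d e' :=
  ⟨e τ .zero, fun σ x => e σ x.succ, by funext σ x; cases x <;> rfl⟩

theorem Tm.rename_lift_inst_var {Γ : Ctx} {σ τ : Ty} (t : Tm (τ :: Γ) σ) :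
    (t.rename (Ren.lift (fun _ x => x.succ) τ)).inst v0 = t := by
  rw [Tm.inst, Tm.subst_rename]
  nth_rw 2 [← Tm.subst_id t]
  congr 1
  funext σ x; cases x <;> rfl

/-- The substitution for the empty context. -/
def Sub.nil {Δ : Ctx} : Sub [] Δ := fun _ x => nomatch x

namespace PrimeModel

variable (M : PrimeModel) {Δ : Ctx}

/-! ### Logic in a prime model -/

/-- All formulas of a list hold. -/
def Holds (H : List (Fm Δ)) (e : Env M.D Δ) : Prop := ∀ ψ ∈ H, M.holds ψ e

@[simp] theorem Holds_nil (e : Env M.D Δ) : M.Holds [] e := by simp [Holds]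

@[simp] theorem Holds_cons (φ : Fm Δ) (H : List (Fm Δ)) (e : Env M.D Δ) :
    M.Holds (φ :: H) e ↔ M.holds φ e ∧ M.Holds H e := by simp [Holds]

attribute [simp] eval_var holds_eq

theorem eval_nil (e : Env M.D Δ) :
    (fun σ x => M.eval ((Sub.nil : Sub [] Δ) σ x) e) = Env.nil := by
  funext σ x; cases x

theorem eval_cons {Θ : Ctx} {τ : Ty} (a : Tm Δ τ) (s : Sub Θ Δ) (e : Env M.D Δ) :
    (fun σ x => M.eval (Sub.cons a s σ x) e) =
      Env.cons (M.eval a e) (fun σ x => M.eval (s σ x) e) := by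
  funext σ x; cases x <;> rfl

@[simp] theorem eval_wk {σ τ : Ty} (t : Tm Δ σ) (d : M.D τ) (e : Env M.D Δ) :
    M.eval t.wk (Env.cons d e) = M.eval t e := by
  rw [Tm.wk, Tm.rename_eq_subst, M.eval_subst]
  simp

@[simp] theorem holds_wk {τ : Ty} (φ : Fm Δ) (d : M.D τ) (e : Env M.D Δ) :
    M.holds φ.wk (Env.cons d e) ↔ M.holds φ e := by
  rw [Fm.wk, Fm.rename_eq_subst, M.holds_subst]
  simp

theorem Holds_map_wk {τ : Ty} (H : List (Fm Δ)) (d : M.D τ) (e : Env M.D Δ) :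
    M.Holds (H.map Fm.wk) (Env.cons d e) ↔ M.Holds H e := by
  simp [Holds]

@[simp] theorem holds_inst {τ : Ty} (φ : Fm (τ :: Δ)) (t : Tm Δ τ) (e : Env M.D Δ) :
    M.holds (φ.inst t) e ↔ M.holds φ (Env.cons (M.eval t e) e) := by
  rw [Fm.inst, M.holds_subst, eval_cons]; simp

variable {M}

theorem holds_ax {φ : Fm Δ} (h : Ax φ) (e : Env M.D Δ) : M.holds φ e :=
  M.sound (H := []) (.ax h) (by simp)

@[simp] theorem holds_bot (e : Env M.D Δ) : M.holds .bot e ↔ False :=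
  iff_false_intro (M.not_holds_bot e)

@[simp] theorem holds_and (φ ψ : Fm Δ) (e : Env M.D Δ) :
    M.holds (.and φ ψ) e ↔ M.holds φ e ∧ M.holds ψ e := by
  refine ⟨fun h => ⟨?_, ?_⟩, fun h => ?_⟩
  · exact M.sound (H := [.and φ ψ]) (.andE₁ (.hyp (List.mem_singleton.2 rfl))) (by simpa using h)
  · exact M.sound (H := [.and φ ψ]) (.andE₂ (.hyp (List.mem_singleton.2 rfl))) (by simpa using h)
  · exact M.sound (H := [φ, ψ]) (.andI (.hyp (by simp)) (.hyp (by simp))) (by simpa using h)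

@[simp] theorem holds_or (φ ψ : Fm Δ) (e : Env M.D Δ) :
    M.holds (.or φ ψ) e ↔ M.holds φ e ∨ M.holds ψ e := by
  refine ⟨M.or_of_holds, fun h => ?_⟩
  rcases h with h | h
  · exact M.sound (H := [φ]) (.orI₁ (.hyp (by simp))) (by simpa using h)
  · exact M.sound (H := [ψ]) (.orI₂ (.hyp (by simp))) (by simpa using h)

@[simp] theorem holds_ex (σ : Ty) (φ : Fm (σ :: Δ)) (e : Env M.D Δ) :
    M.holds (.ex σ φ) e ↔ ∃ d, M.holds φ (Env.cons d e) := by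
  refine ⟨M.ex_of_holds, fun ⟨d, h⟩ => ?_⟩
  have : M.holds (Fm.ex σ φ).wk (Env.cons d e) := by
    refine M.sound (H := [φ]) (.exI v0 ?_) (by simpa using h)
    rw [Fm.rename_lift_inst_var]
    exact .hyp (by simp)
  simpa using this

theorem imp_mp {φ ψ : Fm Δ} {e : Env M.D Δ} (h : M.holds (.imp φ ψ) e) (h' : M.holds φ e) :
    M.holds ψ e :=
  M.sound (H := [.imp φ ψ, φ]) (.impE (φ := φ) (.hyp (by simp)) (.hyp (by simp))) (by simp [h, h'])

theorem all_at {σ : Ty} {φ : Fm (σ :: Δ)} {e : Env M.D Δ} (h : M.holds (.all σ φ) e)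
    (d : M.D σ) : M.holds φ (Env.cons d e) := by
  refine M.sound (H := [(Fm.all σ φ).wk]) ?_ (by simpa using h)
  have := Prf.allE v0 (Prf.hyp (H := [(Fm.all σ φ).wk]) (List.mem_singleton.2 rfl))
  rwa [Fm.rename_lift_inst_var] at this

theorem not_of_neg {φ : Fm Δ} {e : Env M.D Δ} (h : M.holds φ.neg e) : ¬ M.holds φ e :=
  fun h' => M.not_holds_bot e (imp_mp h h')

/-- Soundness turns a derivation from `H` into truth in `M`, and completeness reduces the derivation
to an argument in an arbitrary model. The list `H` carries over what is known in `M`; nothing else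
about `M` survives. -/
theorem imp_of {φ ψ : Fm Δ} {e : Env M.D Δ} (H : List (Fm Δ)) (hH : M.Holds H e)
    (h : ∀ (M' : PrimeModel) (e' : Env M'.D Δ), M'.Holds H e' → M'.holds φ e' → M'.holds ψ e') :
    M.holds (.imp φ ψ) e :=
  M.sound (.impI (Prf.of_models fun M' e' h' =>
    h M' e' (fun χ hχ => h' χ (by simp [hχ])) (h' φ (by simp)))) hH

theorem neg_of {φ : Fm Δ} {e : Env M.D Δ} (H : List (Fm Δ)) (hH : M.Holds H e)
    (h : ∀ (M' : PrimeModel) (e' : Env M'.D Δ), M'.Holds H e' → ¬ M'.holds φ e') :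
    M.holds φ.neg e :=
  imp_of H hH fun M' e' h₁ h₂ => (h M' e' h₁ h₂).elim

theorem all_of {σ : Ty} {φ : Fm (σ :: Δ)} {e : Env M.D Δ} (H : List (Fm Δ)) (hH : M.Holds H e)
    (h : ∀ (M' : PrimeModel) (e' : Env M'.D Δ) (d : M'.D σ), M'.Holds H e' →
      M'.holds φ (Env.cons d e')) : M.holds (.all σ φ) e := by
  refine M.sound (.allI (Prf.of_models fun M' e' h' => ?_)) hH
  obtain ⟨d, e', rfl⟩ := e'.exists_cons
  exact h M' e' d ((M'.Holds_map_wk H d e').1 h')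

/-! ### Operations -/

variable (M)

def app {σ τ : Ty} (f : M.D (.fn σ τ)) (x : M.D σ) : M.D τ :=
  M.eval (.app v1 v0) (Env.cons x (Env.cons f Env.nil))

def zero : M.D .nat := M.eval .zero Env.nil

def succ (n : M.D .nat) : M.D .nat := M.eval (.succ v0) (Env.cons n Env.nil)

/-- The natural number one. -/
def one : M.D .nat := M.succ M.zero

def natRec {σ : Ty} (a : M.D σ) (f : M.D (.fn .nat (.fn σ σ))) (n : M.D .nat) : M.D σ :=
  M.eval (.natRec v2 v1 v0) (Env.cons n (Env.cons f (Env.cons a Env.nil)))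

/-- The characteristic function of the order of the rationals. -/
def qleChar (a b : M.D .rat) : M.D .nat := M.eval (.qle v1 v0) (Env.cons b (Env.cons a Env.nil))

def cast (n : M.D .nat) : M.D .rat := M.eval (natCast v0) (Env.cons n Env.nil)

noncomputable instance : Zero (M.D .rat) := ⟨M.eval .qzero Env.nil⟩
noncomputable instance : One (M.D .rat) := ⟨M.eval .qone Env.nil⟩
noncomputable instance : Add (M.D .rat) :=
  ⟨fun a b => M.eval (.qadd v1 v0) (Env.cons b (Env.cons a Env.nil))⟩
noncomputable instance : Mul (M.D .rat) :=
  ⟨fun a b => M.eval (.qmul v1 v0) (Env.cons b (Env.cons a Env.nil))⟩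
noncomputable instance : Neg (M.D .rat) := ⟨fun a => M.eval (.qneg v0) (Env.cons a Env.nil)⟩

-- The axioms leave the inverse of zero open, while a `Field` requires it to be zero.
open Classical in
noncomputable instance : Inv (M.D .rat) :=
  ⟨fun a => if a = 0 then 0 else M.eval (.qinv v0) (Env.cons a Env.nil)⟩

instance : LE (M.D .rat) := ⟨fun a b => M.qleChar a b = M.one⟩

variable {M}

/-- Used to reduce each compound term to its constructor applied to variables, which is how the
operations of the model are defined. -/
theorem eval_eq_of_subst {Θ : Ctx} {σ : Ty} {t : Tm Δ σ} {u : Tm Θ σ} {s : Sub Θ Δ}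
    (h : t = u.subst s) (e : Env M.D Δ) : M.eval t e = M.eval u (fun σ x => M.eval (s σ x) e) := by
  rw [h, M.eval_subst]

@[simp] theorem eval_app {σ τ : Ty} (t : Tm Δ (.fn σ τ)) (u : Tm Δ σ) (e : Env M.D Δ) :
    M.eval (.app t u) e = M.app (M.eval t e) (M.eval u e) := by
  rw [eval_eq_of_subst (t := .app t u) (u := .app v1 v0) (s := .cons u (.cons t .nil)) rfl]; simp [app, eval_cons, eval_nil]

@[simp] theorem eval_zero (e : Env M.D Δ) : M.eval .zero e = M.zero := by
  rw [eval_eq_of_subst (t := .zero) (u := .zero) (s := .nil) rfl]; simp [zero, eval_nil]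

@[simp] theorem eval_succ (t : Tm Δ .nat) (e : Env M.D Δ) :
    M.eval (.succ t) e = M.succ (M.eval t e) := by
  rw [eval_eq_of_subst (t := .succ t) (u := .succ v0) (s := .cons t .nil) rfl]; simp [succ, eval_cons, eval_nil]

@[simp] theorem eval_one (e : Env M.D Δ) : M.eval Tm.one e = M.one := by
  simp [Tm.one, one]

@[simp] theorem eval_natRec {σ : Ty} (a : Tm Δ σ) (f : Tm Δ (.fn .nat (.fn σ σ))) (n : Tm Δ .nat)
    (e : Env M.D Δ) :
    M.eval (.natRec a f n) e = M.natRec (M.eval a e) (M.eval f e) (M.eval n e) := by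
  rw [eval_eq_of_subst (t := .natRec a f n) (u := .natRec v2 v1 v0) (s := .cons n (.cons f (.cons a .nil))) rfl]
  simp [natRec, eval_cons, eval_nil]

@[simp] theorem eval_natCast (n : Tm Δ .nat) (e : Env M.D Δ) :
    M.eval (natCast n) e = M.cast (M.eval n e) := by
  rw [eval_eq_of_subst (t := natCast n) (u := natCast v0) (s := .cons n .nil) rfl]; simp [cast, eval_cons, eval_nil]

@[simp] theorem eval_qzero (e : Env M.D Δ) : M.eval .qzero e = 0 := by
  rw [eval_eq_of_subst (t := .qzero) (u := .qzero) (s := .nil) rfl, eval_nil]; rfl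

@[simp] theorem eval_qone (e : Env M.D Δ) : M.eval .qone e = 1 := by
  rw [eval_eq_of_subst (t := .qone) (u := .qone) (s := .nil) rfl, eval_nil]; rfl

@[simp] theorem eval_qadd (a b : Tm Δ .rat) (e : Env M.D Δ) :
    M.eval (.qadd a b) e = M.eval a e + M.eval b e := by
  rw [eval_eq_of_subst (t := .qadd a b) (u := .qadd v1 v0) (s := .cons b (.cons a .nil)) rfl, eval_cons,
    eval_cons, eval_nil]
  rfl

@[simp] theorem eval_qmul (a b : Tm Δ .rat) (e : Env M.D Δ) :
    M.eval (.qmul a b) e = M.eval a e * M.eval b e := by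
  rw [eval_eq_of_subst (t := .qmul a b) (u := .qmul v1 v0) (s := .cons b (.cons a .nil)) rfl, eval_cons,
    eval_cons, eval_nil]
  rfl

@[simp] theorem eval_qneg (a : Tm Δ .rat) (e : Env M.D Δ) :
    M.eval (.qneg a) e = - M.eval a e := by
  rw [eval_eq_of_subst (t := .qneg a) (u := .qneg v0) (s := .cons a .nil) rfl, eval_cons, eval_nil]
  rfl

theorem eval_qinv {a : Tm Δ .rat} {e : Env M.D Δ} (h : M.eval a e ≠ 0) :
    M.eval (.qinv a) e = (M.eval a e)⁻¹ := by
  rw [eval_eq_of_subst (t := .qinv a) (u := .qinv v0) (s := .cons a .nil) rfl, eval_cons, eval_nil]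
  exact (if_neg h).symm

@[simp] theorem eval_qle (a b : Tm Δ .rat) (e : Env M.D Δ) :
    M.eval (.qle a b) e = M.qleChar (M.eval a e) (M.eval b e) := by
  rw [eval_eq_of_subst (t := .qle a b) (u := .qle v1 v0) (s := .cons b (.cons a .nil)) rfl]; simp [qleChar, eval_cons, eval_nil]

@[simp] theorem app_eval_lam {σ τ : Ty} (t : Tm (σ :: Δ) τ) (e : Env M.D Δ) (d : M.D σ) :
    M.app (M.eval (.lam t) e) d = M.eval t (Env.cons d e) := by
  have := holds_ax (.beta (t.rename (Ren.lift (fun _ x => x.succ) σ)) v0) (Env.cons d e)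
  rw [Tm.rename_lift_inst_var, holds_eq, eval_app, eval_var, Env.cons_zero] at this
  rw [← this]
  exact congrArg (M.app · d) (M.eval_wk (.lam t) d e).symm

@[simp] theorem holds_qLe (a b : Tm Δ .rat) (e : Env M.D Δ) :
    M.holds (qLe a b) e ↔ M.eval a e ≤ M.eval b e := by
  simp [qLe]; rfl

theorem succ_ne_zero (n : M.D .nat) : M.succ n ≠ M.zero := by
  simpa using not_of_neg (holds_ax (.succ_ne_zero v0) (Env.cons n Env.nil))

@[simp] theorem natRec_zero {σ : Ty} (a : M.D σ) (f : M.D (.fn .nat (.fn σ σ))) :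
    M.natRec a f M.zero = a := by
  simpa using holds_ax (.rec_zero v0 v1) (Env.cons a (Env.cons f Env.nil))

@[simp] theorem natRec_succ {σ : Ty} (a : M.D σ) (f : M.D (.fn .nat (.fn σ σ))) (n : M.D .nat) :
    M.natRec a f (M.succ n) = M.app (M.app f n) (M.natRec a f n) := by
  simpa using holds_ax (.rec_succ v0 v1 v2) (Env.cons a (Env.cons f (Env.cons n Env.nil)))

@[simp] theorem natRec_one {σ : Ty} (a : M.D σ) (f : M.D (.fn .nat (.fn σ σ))) :
    M.natRec a f M.one = M.app (M.app f M.zero) a := by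
  rw [one, natRec_succ, natRec_zero]

theorem one_ne_zero' : M.one ≠ M.zero := succ_ne_zero _

/-! ### The ordered field of rationals -/

theorem qle_total (a b : M.D .rat) : a ≤ b ∨ b ≤ a := by
  simpa using holds_ax (.qle_total v0 v1) (Env.cons a (Env.cons b Env.nil))

theorem qle_antisymm {a b : M.D .rat} (h : a ≤ b) (h' : b ≤ a) : a = b := by
  simpa using imp_mp (imp_mp (holds_ax (.qle_antisymm v0 v1) (Env.cons a (Env.cons b Env.nil)))
    (by simpa)) (by simpa)

theorem qle_refl (a : M.D .rat) : a ≤ a := by simpa using qle_total a a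

theorem qleChar_eq_one_iff {a b : M.D .rat} : M.qleChar a b = M.one ↔ a ≤ b := Iff.rfl

theorem qleChar_eq_zero_iff {a b : M.D .rat} : M.qleChar a b = M.zero ↔ ¬ a ≤ b := by
  have h := holds_ax (.qle_char v0 v1) (Env.cons a (Env.cons b Env.nil))
  simp only [holds_or, holds_eq, eval_qle, eval_var, Env.cons_zero, Env.cons_succ, eval_zero,
    eval_one] at h
  rw [← qleChar_eq_one_iff]
  refine ⟨fun h₁ h₂ => one_ne_zero' (h₂.symm.trans h₁), fun h' => h.resolve_right h'⟩

/-- The characteristic function takes only the values 0 and 1, so failure of `a ≤ b` is the equation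
`qle a b = 0`. Being a formula that holds, it can be carried to other models and refutes `a ≤ b`
there. -/
theorem holds_not_qLe (a b : Tm Δ .rat) (e : Env M.D Δ) :
    M.holds (qLe a b).neg e ↔ ¬ M.eval a e ≤ M.eval b e := by
  refine ⟨fun h => by simpa using not_of_neg h, fun h => ?_⟩
  refine neg_of [.eq (.qle a b) .zero] (by simpa [qleChar_eq_zero_iff]) fun M' e' h' => ?_
  simpa [qleChar_eq_zero_iff] using h'

/-- Equality of rationals is decidable. -/
theorem holds_ne_rat (a b : Tm Δ .rat) (e : Env M.D Δ) :
    M.holds (Fm.eq a b).neg e ↔ M.eval a e ≠ M.eval b e := by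
  refine ⟨fun h => by simpa using not_of_neg h, fun h => ?_⟩
  -- Distinct rationals fail to satisfy one of the two inequalities, and this failure is preserved
  -- in other models.
  refine neg_of [.or (qLe a b).neg (qLe b a).neg] ?_ fun M' e' h' => ?_
  · simp only [Holds_cons, holds_or, holds_not_qLe, Holds_nil, and_true]
    by_contra hn
    push Not at hn
    exact h (qle_antisymm hn.1 hn.2)
  · simp only [Holds_cons, holds_or, holds_not_qLe, Holds_nil, and_true, holds_eq] at h' ⊢
    intro hn
    rw [hn] at h'
    exact h'.elim (· (qle_refl _)) (· (qle_refl _))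

noncomputable instance : Field (M.D .rat) := Field.ofMinimalAxioms _
  (fun a b c => by
    simpa using holds_ax (.qadd_assoc v0 v1 v2) (Env.cons a (Env.cons b (Env.cons c Env.nil))))
  (fun a => by
    have h₁ := holds_ax (.qadd_zero v0) (Env.cons a Env.nil)
    have h₂ := holds_ax (.qadd_comm v0 .qzero) (Env.cons a Env.nil)
    simp only [holds_eq, eval_qadd, eval_var, Env.cons_zero, eval_qzero] at h₁ h₂
    rw [← h₂, h₁])
  (fun a => by
    have h₁ := holds_ax (.qadd_neg v0) (Env.cons a Env.nil)
    have h₂ := holds_ax (.qadd_comm v0 (.qneg v0)) (Env.cons a Env.nil)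
    simp only [holds_eq, eval_qadd, eval_var, Env.cons_zero, eval_qzero, eval_qneg] at h₁ h₂
    rw [← h₂, h₁])
  (fun a b c => by
    simpa using holds_ax (.qmul_assoc v0 v1 v2) (Env.cons a (Env.cons b (Env.cons c Env.nil))))
  (fun a b => by simpa using holds_ax (.qmul_comm v0 v1) (Env.cons a (Env.cons b Env.nil)))
  (fun a => by
    have h₁ := holds_ax (.qmul_one v0) (Env.cons a Env.nil)
    have h₂ := holds_ax (.qmul_comm v0 .qone) (Env.cons a Env.nil)
    simp only [holds_eq, eval_qmul, eval_var, Env.cons_zero, eval_qone] at h₁ h₂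
    rw [← h₂, h₁])
  (fun a ha => by
    have hn : M.holds (Fm.neg (.eq v0 .qzero)) (Env.cons a Env.nil) := by
      simpa [holds_ne_rat] using ha
    have h := imp_mp (holds_ax (.qmul_inv v0) (Env.cons a Env.nil)) hn
    rw [holds_eq, eval_qmul, eval_qinv (by simpa using ha)] at h
    simpa using h)
  (if_pos rfl)
  (fun a b c => by
    simpa using holds_ax (.qmul_add v0 v1 v2) (Env.cons a (Env.cons b (Env.cons c Env.nil))))
  ⟨0, 1, by simpa using not_of_neg (holds_ax .qzero_ne_one (M := M) Env.nil)⟩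

end PrimeModel
end Bish

namespace Bish
namespace PrimeModel

variable {M : PrimeModel} {Δ : Ctx}

noncomputable instance : LinearOrder (M.D .rat) where
  le_refl := qle_refl
  le_trans a b c h h' := by
    simpa using imp_mp (imp_mp (holds_ax (.qle_trans v0 v1 v2)
      (Env.cons a (Env.cons b (Env.cons c Env.nil)))) (by simpa)) (by simpa)
  le_antisymm _ _ := qle_antisymm
  le_total := qle_total
  toDecidableLE := Classical.decRel _

instance : IsStrictOrderedRing (M.D .rat) := by
  have hadd : ∀ a b : M.D .rat, a ≤ b → ∀ c, a + c ≤ b + c := fun a b h c => by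
    simpa using imp_mp (holds_ax (.qadd_le v0 v1 v2)
      (Env.cons a (Env.cons b (Env.cons c Env.nil)))) (by simpa)
  have hmul : ∀ a b : M.D .rat, 0 ≤ a → 0 ≤ b → 0 ≤ a * b := fun a b h h' => by
    simpa using imp_mp (imp_mp (holds_ax (.qmul_nonneg v0 v1)
      (Env.cons a (Env.cons b Env.nil))) (by simpa)) (by simpa)
  have : IsOrderedAddMonoid (M.D .rat) := ⟨hadd, fun a b h c => by simpa [add_comm] using hadd a b h c⟩
  have h01 : (0 : M.D .rat) ≤ 1 := by
    rcases le_total (0 : M.D .rat) 1 with h | h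
    · exact h
    · have := hmul (-1) (-1) (by simpa using h) (by simpa using h)
      simpa using this
  have : ZeroLEOneClass (M.D .rat) := ⟨h01⟩
  refine IsStrictOrderedRing.of_mul_pos fun a b ha hb => ?_
  exact lt_of_le_of_ne (hmul a b ha.le hb.le) (mul_ne_zero ha.ne' hb.ne').symm

@[simp] theorem holds_qLt (a b : Tm Δ .rat) (e : Env M.D Δ) :
    M.holds (qLt a b) e ↔ M.eval a e < M.eval b e := by
  rw [qLt, holds_not_qLe, not_le]

/-! ### Natural numbers -/

@[simp] theorem cast_zero : M.cast M.zero = 0 := by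
  have : M.cast M.zero = M.eval (natCast .zero) Env.nil := (eval_natCast _ _).symm
  rw [this, natCast, eval_natRec]
  simp

@[simp] theorem cast_succ (n : M.D .nat) : M.cast (M.succ n) = M.cast n + 1 := by
  have h₁ : M.cast (M.succ n) = M.eval (natCast (.succ v0)) (Env.cons n Env.nil) := by simp
  have h₂ : M.cast n = M.eval (natCast v0) (Env.cons n Env.nil) := by simp
  rw [h₁, h₂, natCast, natCast, eval_natRec, eval_natRec]
  simp

@[simp] theorem cast_one : M.cast M.one = 1 := by simp [one]

/-- Induction: it suffices to derive the two premises from hypotheses that hold. -/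
theorem all_nat_of {φ : Fm (.nat :: Δ)} {e : Env M.D Δ} (H : List (Fm Δ)) (hH : M.Holds H e)
    (h0 : ∀ (M' : PrimeModel) (e' : Env M'.D Δ), M'.Holds H e' →
      M'.holds φ (Env.cons M'.zero e'))
    (hs : ∀ (M' : PrimeModel) (e' : Env M'.D Δ) (n : M'.D .nat), M'.Holds H e' →
      M'.holds φ (Env.cons n e') → M'.holds φ (Env.cons (M'.succ n) e')) :
    M.holds (.all .nat φ) e := by
  refine imp_mp (imp_mp (holds_ax (.induction φ) e) ?_) ?_
  · simpa using h0 M e hH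
  · refine M.sound (.allI (.impI (Prf.of_models fun M' e' h' => ?_))) hH
    obtain ⟨n, e', rfl⟩ := e'.exists_cons
    have h₁ : M'.Holds H e' :=
      (M'.Holds_map_wk H n e').1 fun χ hχ => h' χ (List.mem_cons_of_mem _ hχ)
    rw [M'.holds_subst, eval_cons]
    simpa using hs M' e' n h₁ (h' _ List.mem_cons_self)

theorem nat_cases (n : M.D .nat) : n = M.zero ∨ ∃ m, n = M.succ m := by
  have := all_at (all_nat_of (M := M) (e := Env.nil)
    (φ := .or (.eq v0 .zero) (.ex .nat (.eq v1 (.succ v0)))) [] (by simp) (by simp) (by simp)) n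
  simpa using this

theorem cast_nonneg (n : M.D .nat) : 0 ≤ M.cast n := by
  have := all_at (all_nat_of (M := M) (e := Env.nil) (φ := qLe .qzero (natCast v0)) [] (by simp)
    (by simp) fun M' e' n _ h => ?_) n
  · simpa using this
  · simp only [holds_qLe, eval_qzero, eval_natCast, eval_var, Env.cons_zero, cast_succ] at h ⊢
    linarith

/-- Addition of natural numbers. -/
def _root_.Bish.natAdd {Γ : Ctx} (m n : Tm Γ .nat) : Tm Γ .nat :=
  .natRec m (.lam (.lam (.succ v0))) n

def add (m n : M.D .nat) : M.D .nat := M.eval (natAdd v1 v0) (Env.cons n (Env.cons m Env.nil))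

@[simp] theorem eval_natAdd (m n : Tm Δ .nat) (e : Env M.D Δ) :
    M.eval (natAdd m n) e = add (M.eval m e) (M.eval n e) := by
  rw [eval_eq_of_subst (t := natAdd m n) (u := natAdd v1 v0) (s := .cons n (.cons m .nil)) rfl]
  simp [add, eval_cons, eval_nil]

@[simp] theorem add_zero (m : M.D .nat) : add m M.zero = m := by
  have h : add m M.zero = M.eval (natAdd v0 .zero) (Env.cons m Env.nil) := by simp
  rw [h, natAdd, eval_natRec]
  simp

@[simp] theorem add_succ (m n : M.D .nat) : add m (M.succ n) = M.succ (add m n) := by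
  have h₁ : add m (M.succ n) = M.eval (natAdd v1 (.succ v0)) (Env.cons n (Env.cons m Env.nil)) := by
    simp
  have h₂ : add m n = M.eval (natAdd v1 v0) (Env.cons n (Env.cons m Env.nil)) := by simp
  rw [h₁, h₂, natAdd, natAdd, eval_natRec, eval_natRec]
  simp

@[simp] theorem zero_add (n : M.D .nat) : add M.zero n = n := by
  have := all_at (all_nat_of (M := M) (e := Env.nil) (φ := .eq (natAdd .zero v0) v0) [] (by simp)
    (by simp) (by simp +contextual)) n
  simpa using this

theorem succ_add (m n : M.D .nat) : add (M.succ m) n = M.succ (add m n) := by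
  have := all_at (all_nat_of (M := M) (e := Env.cons m Env.nil)
    (φ := .eq (natAdd (.succ v1) v0) (.succ (natAdd v1 v0))) [] (by simp)
    (by simp) (by simp +contextual)) n
  simpa using this

@[simp] theorem cast_add (m n : M.D .nat) : M.cast (add m n) = M.cast m + M.cast n := by
  have := all_at (all_nat_of (M := M) (e := Env.cons m Env.nil)
    (φ := .eq (natCast (natAdd v1 v0)) (.qadd (natCast v1) (natCast v0))) [] (by simp)
    (by simp) (by simp +contextual [add_assoc])) n
  simpa using this

theorem exists_add (m n : M.D .nat) : ∃ k, add m k = n ∨ add n k = m := by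
  have := all_at (all_nat_of (M := M) (e := Env.cons m Env.nil) (φ := .ex .nat
    (.or (.eq (natAdd v2 v0) v1) (.eq (natAdd v1 v0) v2))) [] (by simp) ?_ ?_) n
  · simpa using this
  · intro M' e' _
    obtain ⟨m, e', rfl⟩ := e'.exists_cons
    simp only [holds_ex, holds_or, holds_eq, eval_natAdd, eval_var, Env.cons_zero, Env.cons_succ]
    exact ⟨m, .inr (zero_add m)⟩
  · intro M' e' n _ h
    simp only [holds_ex, holds_or, holds_eq, eval_natAdd, eval_var, Env.cons_zero,
      Env.cons_succ] at h ⊢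
    obtain ⟨k, h | h⟩ := h
    · exact ⟨M'.succ k, .inl (by rw [add_succ, h])⟩
    · rcases nat_cases k with rfl | ⟨k, rfl⟩
      · exact ⟨M'.one, .inl (by rw [← h]; simp [one])⟩
      · exact ⟨k, .inr (by rw [← h, succ_add, add_succ])⟩

/-- The language has no order on `nat`; throughout, natural numbers are compared through their
casts, with gaps of at least 1 as the mark of discreteness. -/
theorem nat_trichotomy (m n : M.D .nat) :
    m = n ∨ M.cast m + 1 ≤ M.cast n ∨ M.cast n + 1 ≤ M.cast m := by
  obtain ⟨k, h | h⟩ := exists_add m n <;> rcases nat_cases k with rfl | ⟨k, rfl⟩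
  · exact .inl (by simpa using h)
  · refine .inr (.inl ?_)
    rw [← h, cast_add, cast_succ]
    linarith [cast_nonneg k]
  · exact .inl (by simpa using h.symm)
  · refine .inr (.inr ?_)
    rw [← h, cast_add, cast_succ]
    linarith [cast_nonneg k]

theorem cast_injective : Function.Injective M.cast := by
  intro m n h
  rcases nat_trichotomy m n with h' | h' | h'
  · exact h'
  · linarith
  · linarith

theorem cast_succ_le {m n : M.D .nat} (h : M.cast m < M.cast n) : M.cast m + 1 ≤ M.cast n := by
  rcases nat_trichotomy m n with rfl | h' | h'
  · exact (lt_irrefl _ h).elim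
  · exact h'
  · linarith

theorem cast_le_of_lt_succ {m n : M.D .nat} (h : M.cast m < M.cast n + 1) :
    M.cast m ≤ M.cast n := by
  by_contra h'
  linarith [cast_succ_le (not_le.1 h')]

theorem exists_cast_sub {m n : M.D .nat} (h : M.cast m ≤ M.cast n) :
    ∃ k, M.cast k = M.cast n - M.cast m := by
  obtain ⟨k, hk | hk⟩ := exists_add m n
  · exact ⟨k, by rw [← hk, cast_add]; ring⟩
  · refine ⟨M.zero, ?_⟩
    have := cast_nonneg k
    rw [← hk, cast_add] at h
    rw [← hk, cast_add, cast_zero]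
    linarith

theorem exists_cast_mul (m n : M.D .nat) : ∃ k, M.cast k = M.cast m * M.cast n := by
  have := all_at (all_nat_of (M := M) (e := Env.cons m Env.nil) (φ := .ex .nat
    (.eq (natCast v0) (.qmul (natCast v2) (natCast v1)))) [] (by simp) ?_ ?_) n
  · simpa using this
  · intro M' e' _
    simpa using ⟨M'.zero, cast_zero⟩
  · intro M' e' n _ h
    obtain ⟨m, e', rfl⟩ := e'.exists_cons
    simp only [holds_ex, holds_eq, eval_qmul, eval_natCast, eval_var, Env.cons_zero,
      Env.cons_succ] at h ⊢
    obtain ⟨k, h⟩ := h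
    exact ⟨add k m, by rw [cast_add, h, cast_succ]; ring⟩

/-- Equality of natural numbers is decidable. -/
theorem holds_ne_nat (a b : Tm Δ .nat) (e : Env M.D Δ) :
    M.holds (Fm.eq a b).neg e ↔ M.eval a e ≠ M.eval b e := by
  refine ⟨fun h => by simpa using not_of_neg h, fun h => ?_⟩
  -- Decidability is inherited from the rationals along the injective cast.
  refine neg_of [(Fm.eq (natCast a) (natCast b)).neg] ?_ fun M' e' h' => ?_
  · simpa [holds_ne_rat] using cast_injective.ne h
  · simp only [Holds_cons, holds_ne_rat, eval_natCast, Holds_nil, and_true] at h'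
    rw [holds_eq]
    exact fun hn => h' (by rw [hn])

theorem exists_frac (q : M.D .rat) :
    ∃ m n k, q * (M.cast k + 1) = M.cast m - M.cast n := by
  have h := holds_ax (.qfrac v0) (Env.cons q Env.nil)
  simpa [sub_eq_add_neg] using h

theorem exists_nonneg_frac {q : M.D .rat} (hq : 0 ≤ q) : ∃ m k, q * (M.cast k + 1) = M.cast m := by
  obtain ⟨m, n, k, h⟩ := exists_frac q
  have h' : 0 ≤ q * (M.cast k + 1) := mul_nonneg hq (by linarith [cast_nonneg k])
  obtain ⟨l, hl⟩ := exists_cast_sub (M := M) (m := n) (n := m) (by linarith)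
  exact ⟨l, k, by rw [hl, h]⟩

theorem exists_le_cast (q : M.D .rat) : ∃ n, q ≤ M.cast n := by
  rcases le_total q 0 with h | h
  · exact ⟨M.zero, by simpa⟩
  · obtain ⟨m, k, hk⟩ := exists_nonneg_frac h
    exact ⟨m, by nlinarith [cast_nonneg k]⟩

/-- The rational `1 / (n + 1)`. -/
noncomputable def unit (n : M.D .nat) : M.D .rat := (M.cast n + 1)⁻¹

@[simp] theorem eval_unitFrac (t : Tm Δ .nat) (e : Env M.D Δ) :
    M.eval (unitFrac t) e = unit (M.eval t e) := by
  have : M.eval (.qadd (natCast t) .qone) e = M.cast (M.eval t e) + 1 := by simp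
  rw [unitFrac, eval_qinv, this, unit]
  rw [this]
  exact (by linarith [cast_nonneg (M.eval t e)] : 0 < M.cast (M.eval t e) + 1).ne'

@[simp] theorem eval_twoFrac (t : Tm Δ .nat) (e : Env M.D Δ) :
    M.eval (twoFrac t) e = 2 * unit (M.eval t e) := by
  simp [twoFrac, two_mul]

theorem cast_add_one_pos (n : M.D .nat) : 0 < M.cast n + 1 := by linarith [cast_nonneg n]

theorem unit_pos (n : M.D .nat) : 0 < unit n := inv_pos.2 (cast_add_one_pos n)

theorem unit_mul (n : M.D .nat) : unit n * (M.cast n + 1) = 1 :=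
  inv_mul_cancel₀ (cast_add_one_pos n).ne'

theorem unit_le_one (n : M.D .nat) : unit n ≤ 1 :=
  inv_le_one_of_one_le₀ (by linarith [cast_nonneg n])

theorem unit_anti {m n : M.D .nat} (h : M.cast m ≤ M.cast n) : unit n ≤ unit m :=
  inv_anti₀ (cast_add_one_pos m) (by linarith)

/-- Beyond any `m` there are arbitrarily small unit fractions. -/
theorem exists_unit_lt {ε : M.D .rat} (h : 0 < ε) (m : M.D .nat) :
    ∃ n, M.cast m ≤ M.cast n ∧ unit n < ε := by
  obtain ⟨k, hk⟩ := exists_le_cast ε⁻¹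
  refine ⟨add m k, by simpa using cast_nonneg k, ?_⟩
  rw [unit, inv_lt_comm₀ (cast_add_one_pos _) h, cast_add]
  linarith [cast_nonneg m]

end PrimeModel
end Bish

namespace Bish

/-! ### Arithmetical formulas and omniscience -/

/-- The limited principle of omniscience, in an arbitrary context. -/
def lpo {Γ : Ctx} : Fm Γ :=
  .all (Ty.fn Ty.nat Ty.nat) (.imp (isBinary v0)
    (.or (.all Ty.nat (.eq (.app v1 v0) .zero)) (.ex Ty.nat (.eq (.app v1 v0) Tm.one))))

/-- The natural and the rational numbers. -/
def Ty.IsNum (σ : Ty) : Prop := σ = .nat ∨ σ = .rat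

@[simp] theorem Ty.isNum_nat : Ty.nat.IsNum := .inl rfl
@[simp] theorem Ty.isNum_rat : Ty.rat.IsNum := .inr rfl

/-- Formulas whose equations and quantifiers are about natural and rational numbers only. -/
def Fm.IsArith : {Γ : Ctx} → Fm Γ → Prop
  | _, @Fm.eq _ σ _ _ => σ.IsNum
  | _, .bot => True
  | _, .and φ ψ => φ.IsArith ∧ ψ.IsArith
  | _, .or φ ψ => φ.IsArith ∧ ψ.IsArith
  | _, .imp φ ψ => φ.IsArith ∧ ψ.IsArith
  | _, .all σ φ => σ.IsNum ∧ φ.IsArith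
  | _, .ex σ φ => σ.IsNum ∧ φ.IsArith

theorem Fm.IsArith.subst {Γ Δ : Ctx} {φ : Fm Γ} (h : φ.IsArith) (s : Sub Γ Δ) :
    (φ.subst s).IsArith := by
  induction φ generalizing Δ with
  | eq a b => exact h
  | bot => trivial
  | and φ ψ ih₁ ih₂ => exact ⟨ih₁ h.1 s, ih₂ h.2 s⟩
  | or φ ψ ih₁ ih₂ => exact ⟨ih₁ h.1 s, ih₂ h.2 s⟩
  | imp φ ψ ih₁ ih₂ => exact ⟨ih₁ h.1 s, ih₂ h.2 s⟩
  | all σ φ ih => exact ⟨h.1, ih h.2 _⟩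
  | ex σ φ ih => exact ⟨h.1, ih h.2 _⟩

@[simp] theorem isArith_eq {Γ : Ctx} {σ : Ty} (a b : Tm Γ σ) : (Fm.eq a b).IsArith ↔ σ.IsNum :=
  Iff.rfl
@[simp] theorem isArith_and {Γ : Ctx} (φ ψ : Fm Γ) :
    (Fm.and φ ψ).IsArith ↔ φ.IsArith ∧ ψ.IsArith := Iff.rfl
@[simp] theorem isArith_or {Γ : Ctx} (φ ψ : Fm Γ) :
    (Fm.or φ ψ).IsArith ↔ φ.IsArith ∧ ψ.IsArith := Iff.rfl
@[simp] theorem isArith_imp {Γ : Ctx} (φ ψ : Fm Γ) :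
    (Fm.imp φ ψ).IsArith ↔ φ.IsArith ∧ ψ.IsArith := Iff.rfl
@[simp] theorem isArith_all {Γ : Ctx} {σ : Ty} (φ : Fm (σ :: Γ)) :
    (Fm.all σ φ).IsArith ↔ σ.IsNum ∧ φ.IsArith := Iff.rfl
@[simp] theorem isArith_ex {Γ : Ctx} {σ : Ty} (φ : Fm (σ :: Γ)) :
    (Fm.ex σ φ).IsArith ↔ σ.IsNum ∧ φ.IsArith := Iff.rfl
@[simp] theorem isArith_qLe {Γ : Ctx} (a b : Tm Γ .rat) : (qLe a b).IsArith := Ty.isNum_nat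
@[simp] theorem isArith_qLt {Γ : Ctx} (a b : Tm Γ .rat) : (qLt a b).IsArith :=
  ⟨Ty.isNum_nat, trivial⟩
@[simp] theorem isArith_neg {Γ : Ctx} (φ : Fm Γ) : φ.neg.IsArith ↔ φ.IsArith := and_iff_left trivial

namespace PrimeModel

variable {M : PrimeModel} {Δ : Ctx}

/-- Prime models of the limited principle of omniscience. -/
class Omniscient (M : PrimeModel) : Prop where
  holds_LPO : M.holds LPO Env.nil

/-- The formula is closed, so its truth does not depend on the assignment. With `lpo` among the
hypotheses, every model to which an argument moves is omniscient again. -/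
theorem holds_lpo_iff (e : Env M.D Δ) : M.holds lpo e ↔ M.Omniscient := by
  have : M.holds (lpo : Fm Δ) e ↔ M.holds LPO Env.nil := by
    rw [show (lpo : Fm Δ) = LPO.subst Sub.nil from rfl, M.holds_subst, eval_nil]
  rw [this]
  exact ⟨fun h => ⟨h⟩, fun h => h.1⟩

@[simp] theorem holds_lpo [M.Omniscient] (e : Env M.D Δ) : M.holds lpo e :=
  (holds_lpo_iff e).2 inferInstance

/-- The formula is decidable in every omniscient model. -/
def _root_.Bish.Fm.Dec (φ : Fm Δ) : Prop :=
  ∀ (M : PrimeModel) [M.Omniscient] (e : Env M.D Δ), M.holds φ e ∨ M.holds φ.neg e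

theorem _root_.Bish.Fm.Dec.subst {Θ : Ctx} {φ : Fm Θ} (h : φ.Dec) (s : Sub Θ Δ) :
    (φ.subst s).Dec := by
  intro M _ e
  have := h M (fun σ x => M.eval (s σ x) e)
  rwa [← M.holds_subst, ← M.holds_subst] at this

/-- Countable choice turns the decisions of the instances of `φ` into a binary sequence, and LPO
decides whether it ever takes the value 1. The instances have to be decided in all omniscient
models, because the premise of choice is a universal formula. -/
theorem _root_.Bish.Fm.Dec.ex_nat {φ : Fm (.nat :: Δ)} (hφ : φ.Dec) : (Fm.ex .nat φ).Dec := by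
  intro M _ e
  let χ : Fm (.nat :: .nat :: Δ) := .or (.and (.eq v0 Tm.one) φ.wk) (.and (.eq v0 .zero) φ.neg.wk)
  have h₁ : M.holds (.all .nat (.ex .nat χ)) e := by
    refine all_of [lpo] (by simp) fun M' e' n h' => ?_
    simp only [Holds_cons, holds_lpo_iff, Holds_nil, and_true] at h'
    rw [holds_ex]
    rcases hφ M' (Env.cons n e') with h | h
    · exact ⟨M'.one, by simp [χ, h]⟩
    · exact ⟨M'.zero, by simp [χ, h]⟩
  have h₂ := imp_mp (holds_ax (.countable_choice χ) e) h₁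
  rw [holds_ex] at h₂
  obtain ⟨g, hg⟩ := h₂
  set χ' := χ.subst (Sub.cons (.app v1 v0) (Sub.cons v0
    (fun _ x => .var x.succ.succ : Sub Δ (.nat :: .fn .nat .nat :: Δ)))) with hχ'
  have hχ : ∀ (M' : PrimeModel) (e' : Env M'.D Δ) (g : M'.D (.fn .nat .nat)) (n : M'.D .nat),
      M'.holds χ' (Env.cons n (Env.cons g e')) ↔
        (M'.app g n = M'.one ∧ M'.holds φ (Env.cons n e')) ∨
        (M'.app g n = M'.zero ∧ M'.holds φ.neg (Env.cons n e')) := by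
    intro M' e' g n
    rw [hχ', M'.holds_subst, eval_cons, eval_cons]
    simp [χ]
  have hb : M.holds (isBinary v0) (Env.cons g e) := by
    refine all_of [.all .nat χ'] (by simpa using hg) fun M' e' n h' => ?_
    obtain ⟨g, e', rfl⟩ := e'.exists_cons
    simp only [Holds_cons, Holds_nil, and_true] at h'
    have h := all_at h' n
    rw [hχ] at h
    simp only [holds_or, holds_eq, eval_app, eval_wk, eval_var, Env.cons_zero, eval_zero, eval_one]
    tauto
  have h := imp_mp (all_at (holds_lpo e) g) hb
  rw [holds_or] at h
  rcases h with h | h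
  · right
    have : M.holds (Fm.ex .nat φ).wk.neg (Env.cons g e) := by
      refine neg_of [.all .nat (.eq (.app v1 v0) .zero), .all .nat χ'] ?_ fun M' e' h' hn => ?_
      · simpa using ⟨h, hg⟩
      · obtain ⟨g, e', rfl⟩ := e'.exists_cons
        simp only [Holds_cons, Holds_nil, and_true] at h'
        rw [holds_wk, holds_ex] at hn
        obtain ⟨n, hn⟩ := hn
        have h₁ := all_at h'.1 n
        have h₂ := all_at h'.2 n
        rw [hχ] at h₂
        simp only [holds_eq, eval_app, eval_var, Env.cons_zero, Env.cons_succ, eval_zero] at h₁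
        rcases h₂ with h₂ | h₂
        · exact one_ne_zero' (h₂.1.symm.trans h₁)
        · exact not_of_neg h₂.2 hn
    exact (M.holds_wk (Fm.ex .nat φ).neg g e).1 this
  · left
    rw [holds_ex] at h ⊢
    obtain ⟨n, hn⟩ := h
    have h₂ := all_at hg n
    rw [hχ] at h₂
    simp only [holds_eq, eval_app, eval_var, Env.cons_zero, Env.cons_succ, eval_one] at hn
    rcases h₂ with h₂ | h₂
    · exact ⟨n, h₂.2⟩
    · exact (one_ne_zero' (hn.symm.trans h₂.1)).elim

/-- Every rational is `(m - n) / (k + 1)`, so the quantifier becomes three quantifiers over natural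
numbers. -/
theorem _root_.Bish.Fm.Dec.ex_rat {φ : Fm (.rat :: Δ)} (hφ : φ.Dec) : (Fm.ex .rat φ).Dec := by
  intro M _ e
  let s : Sub (.rat :: Δ) (.nat :: .nat :: .nat :: Δ) :=
    Sub.cons (.qmul (.qadd (natCast v2) (.qneg (natCast v1))) (unitFrac v0))
      (fun _ x => .var x.succ.succ.succ)
  have key : ∀ (M' : PrimeModel) (e' : Env M'.D Δ),
      M'.holds (.ex .nat (.ex .nat (.ex .nat (φ.subst s)))) e' ↔ M'.holds (.ex .rat φ) e' := by
    intro M' e'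
    have : ∀ m n k, M'.holds (φ.subst s) (Env.cons k (Env.cons n (Env.cons m e'))) ↔
        M'.holds φ (Env.cons ((M'.cast m - M'.cast n) * unit k) e') := by
      intro m n k
      rw [M'.holds_subst, eval_cons]
      simp [sub_eq_add_neg]
    simp only [holds_ex, this]
    constructor
    · rintro ⟨m, n, k, h⟩
      exact ⟨_, h⟩
    · rintro ⟨q, h⟩
      obtain ⟨m, n, k, hq⟩ := exists_frac q
      refine ⟨m, n, k, ?_⟩
      rwa [← hq, mul_assoc, mul_comm _ (unit k), unit_mul, mul_one]
  rcases (((hφ.subst s).ex_nat).ex_nat).ex_nat M e with h | h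
  · exact .inl ((key M e).1 h)
  · refine .inr (neg_of [Fm.neg (.ex .nat (.ex .nat (.ex .nat (φ.subst s))))] (by simpa using h) ?_)
    intro M' e' h' hn
    simp only [Holds_cons, Holds_nil, and_true] at h'
    exact not_of_neg h' ((key M' e').2 hn)

theorem _root_.Bish.Fm.Dec.ex_num {σ : Ty} (hσ : σ.IsNum) {φ : Fm (σ :: Δ)} (hφ : φ.Dec) :
    (Fm.ex σ φ).Dec := by
  rcases hσ with rfl | rfl
  exacts [hφ.ex_nat, hφ.ex_rat]

theorem _root_.Bish.Fm.Dec.neg {φ : Fm Δ} (hφ : φ.Dec) : φ.neg.Dec := by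
  intro M _ e
  rcases hφ M e with h | h
  · refine .inr (neg_of [φ] (by simpa using h) fun M' e' h' hn => not_of_neg hn (by simpa using h'))
  · exact .inl h

/-- In omniscient models, arithmetical formulas are decidable. -/
theorem _root_.Bish.Fm.IsArith.dec {φ : Fm Δ} (h : φ.IsArith) : φ.Dec := by
  induction φ with
  | eq a b =>
    intro M _ e
    rcases h with rfl | rfl
    · rw [holds_eq, holds_ne_nat]; exact em _
    · rw [holds_eq, holds_ne_rat]; exact em _
  | bot => exact fun M _ e => .inr (neg_of [] (by simp) (by simp))
  | and φ ψ ih₁ ih₂ =>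
    intro M _ e
    rcases ih₁ h.1 M e with h₁ | h₁
    · rcases ih₂ h.2 M e with h₂ | h₂
      · exact .inl (by simp [h₁, h₂])
      · refine .inr (neg_of [ψ.neg] (by simpa using h₂) fun M' e' h' hn => ?_)
        exact not_of_neg (by simpa using h') ((holds_and _ _ _).1 hn).2
    · refine .inr (neg_of [φ.neg] (by simpa using h₁) fun M' e' h' hn => ?_)
      exact not_of_neg (by simpa using h') ((holds_and _ _ _).1 hn).1
  | or φ ψ ih₁ ih₂ =>
    intro M _ e
    rcases ih₁ h.1 M e with h₁ | h₁
    · exact .inl (by simp [h₁])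
    · rcases ih₂ h.2 M e with h₂ | h₂
      · exact .inl (by simp [h₂])
      · refine .inr (neg_of [φ.neg, ψ.neg] (by simpa using ⟨h₁, h₂⟩) fun M' e' h' hn => ?_)
        simp only [Holds_cons, Holds_nil, and_true] at h'
        exact ((holds_or _ _ _).1 hn).elim (not_of_neg h'.1) (not_of_neg h'.2)
  | imp φ ψ ih₁ ih₂ =>
    intro M _ e
    rcases ih₁ h.1 M e with h₁ | h₁
    · rcases ih₂ h.2 M e with h₂ | h₂
      · exact .inl (imp_of [ψ] (by simpa using h₂) fun M' e' h' _ => by simpa using h')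
      · refine .inr (neg_of [φ, ψ.neg] (by simpa using ⟨h₁, h₂⟩) fun M' e' h' hn => ?_)
        simp only [Holds_cons, Holds_nil, and_true] at h'
        exact not_of_neg h'.2 (imp_mp hn h'.1)
    · refine .inl (imp_of [φ.neg] (by simpa using h₁) fun M' e' h' hn => ?_)
      exact (not_of_neg (by simpa using h') hn).elim
  | all σ φ ih =>
    intro M _ e
    -- Decide whether there is a counterexample. If there is none, its absence is a formula that
    -- holds, and in every omniscient model of it each instance must be decided positively.
    rcases Fm.Dec.ex_num h.1 (ih h.2).neg M e with h₁ | h₁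
    · refine .inr (neg_of [.ex σ φ.neg] (by simpa using h₁) fun M' e' h' hn => ?_)
      simp only [Holds_cons, Holds_nil, and_true, holds_ex] at h'
      obtain ⟨d, hd⟩ := h'
      exact not_of_neg hd (all_at hn d)
    · refine .inl (all_of [lpo, (Fm.ex σ φ.neg).neg] (by simpa using h₁) fun M' e' d h' => ?_)
      simp only [Holds_cons, Holds_nil, and_true, holds_lpo_iff] at h'
      obtain ⟨_, h'⟩ := h'
      refine (ih h.2 M' (Env.cons d e')).resolve_right fun hd => not_of_neg h' ?_
      rw [holds_ex]
      exact ⟨d, hd⟩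
  | ex σ φ ih => exact Fm.Dec.ex_num h.1 (ih h.2)

section Omniscient

variable [M.Omniscient]

/-- A decided premise leaves two cases: the conclusion holds, or the negated premise does. Either of
them derives the implication. With `holds_neg` and `holds_all`, this gives arithmetical formulas
their classical truth conditions. -/
theorem holds_imp {φ : Fm Δ} (h : φ.IsArith) (ψ : Fm Δ) (e : Env M.D Δ) :
    M.holds (.imp φ ψ) e ↔ (M.holds φ e → M.holds ψ e) := by
  refine ⟨imp_mp, fun h' => ?_⟩
  rcases h.dec M e with h₁ | h₁
  · exact imp_of [ψ] (by simpa using h' h₁) fun M' e' h' _ => by simpa using h'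
  · exact imp_of [φ.neg] (by simpa using h₁) fun M' e' h' hn =>
      (not_of_neg (by simpa using h') hn).elim

theorem holds_neg {φ : Fm Δ} (h : φ.IsArith) (e : Env M.D Δ) :
    M.holds φ.neg e ↔ ¬ M.holds φ e := by
  rw [Fm.neg, holds_imp h, holds_bot]

/-- If every element of the model satisfies `φ`, then `∃ ¬φ` does not hold; being decidable, it is
refuted by a formula that holds, and that formula derives the universal statement. -/
theorem holds_all {σ : Ty} (hσ : σ.IsNum) {φ : Fm (σ :: Δ)} (h : φ.IsArith) (e : Env M.D Δ) :
    M.holds (.all σ φ) e ↔ ∀ d, M.holds φ (Env.cons d e) := by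
  refine ⟨all_at, fun h' => ?_⟩
  by_contra hn
  have hex : ¬ M.holds (.ex σ φ.neg) e := by
    rw [holds_ex]
    exact fun ⟨d, hd⟩ => not_of_neg hd (h' d)
  have : (Fm.ex σ φ.neg).IsArith := ⟨hσ, by simpa⟩
  rw [← holds_neg this] at hex
  refine hn (all_of [lpo, (Fm.ex σ φ.neg).neg] (by simpa using hex) fun M' e' d h' => ?_)
  simp only [Holds_cons, Holds_nil, and_true, holds_lpo_iff] at h'
  obtain ⟨_, h'⟩ := h'
  by_contra hd
  rw [← holds_neg h] at hd
  exact not_of_neg h' ((holds_ex _ _ _).2 ⟨d, hd⟩)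

/-- Induction for arithmetical predicates. -/
theorem nat_induction {P : M.D .nat → Prop} (φ : Fm (.nat :: Δ)) (e : Env M.D Δ)
    (hφ : φ.IsArith) (hP : ∀ n, M.holds φ (Env.cons n e) ↔ P n) (h0 : P M.zero)
    (hs : ∀ n, P n → P (M.succ n)) (n : M.D .nat) : P n := by
  have h := holds_ax (.induction φ) e
  rw [← hP]
  refine all_at (imp_mp (imp_mp h ?_) ?_) n
  · simpa [hP] using h0
  · refine Iff.mpr (holds_all Ty.isNum_nat (by exact ⟨hφ, hφ.subst _⟩) e) fun d => ?_
    rw [holds_imp hφ, M.holds_subst, eval_cons, hP]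
    simpa [hP] using hs d

/-- The least number principle for arithmetical predicates. -/
theorem exists_least {P : M.D .nat → Prop} (φ : Fm (.nat :: Δ)) (e : Env M.D Δ)
    (hφ : φ.IsArith) (hP : ∀ n, M.holds φ (Env.cons n e) ↔ P n) (h : ∃ n, P n) :
    ∃ n, P n ∧ ∀ m, M.cast m < M.cast n → ¬ P m := by
  by_contra hn
  push Not at hn
  let s : Sub (.nat :: Δ) (.nat :: .nat :: Δ) := Sub.cons v0 (fun _ x => .var x.succ.succ)
  -- Without a least element, induction on `n` shows that `P` fails everywhere below `n`.
  have key := nat_induction (M := M) (P := fun n => ∀ m, M.cast m < M.cast n → ¬ P m)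
    (.all .nat (.imp (qLt (natCast v0) (natCast v1)) (φ.subst s).neg)) e
    ⟨Ty.isNum_nat, isArith_qLt _ _, by simpa using hφ.subst s⟩ ?_ ?_ ?_
  · obtain ⟨n, hn⟩ := h
    exact key (M.succ n) n (by rw [cast_succ]; linarith) hn
  · intro n
    refine Iff.trans (holds_all Ty.isNum_nat
      (by exact ⟨isArith_qLt _ _, by simpa using hφ.subst s⟩) _)
      (forall_congr' fun m => ?_)
    rw [holds_imp (isArith_qLt _ _), holds_neg (hφ.subst s), M.holds_subst, eval_cons]
    simp [hP]
  · intro m hm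
    rw [cast_zero] at hm
    linarith [cast_nonneg m]
  · intro n ih m hm hPm
    obtain ⟨k, hk, hPk⟩ := hn m hPm
    rw [cast_succ] at hm
    exact ih k (by linarith [cast_le_of_lt_succ hm]) hPk

/-- Countable choice for arithmetical relations. -/
theorem exists_choice {σ : Ty} (hσ : σ.IsNum) {P : M.D .nat → M.D σ → Prop}
    (φ : Fm (σ :: .nat :: Δ)) (e : Env M.D Δ) (hφ : φ.IsArith)
    (hP : ∀ n y, M.holds φ (Env.cons y (Env.cons n e)) ↔ P n y) (h : ∀ n, ∃ y, P n y) :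
    ∃ g : M.D (.fn .nat σ), ∀ n, P n (M.app g n) := by
  have h₁ : M.holds (.all .nat (.ex σ φ)) e := by
    refine Iff.mpr (holds_all Ty.isNum_nat (by exact ⟨hσ, hφ⟩) e) fun n => ?_
    rw [holds_ex]
    simpa [hP] using h n
  have h₂ := imp_mp (holds_ax (.countable_choice φ) e) h₁
  rw [holds_ex] at h₂
  obtain ⟨g, hg⟩ := h₂
  refine ⟨g, fun n => ?_⟩
  have := all_at hg n
  rw [M.holds_subst, eval_cons, eval_cons] at this
  simpa [hP] using this

/-- Countable choice for double sequences of numbers. -/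
theorem exists_choice₂ {σ : Ty} (hσ : σ.IsNum) {P : M.D .nat → M.D .nat → M.D σ → Prop}
    (φ : Fm (σ :: .nat :: .nat :: Δ)) (e : Env M.D Δ) (hφ : φ.IsArith)
    (hP : ∀ n k y, M.holds φ (Env.cons y (Env.cons k (Env.cons n e))) ↔ P n k y)
    (h : ∀ n k, ∃ y, P n k y) :
    ∃ g : M.D (.fn .nat (.fn .nat σ)), ∀ n k, P n k (M.app (M.app g n) k) := by
  have h₁ : M.holds (.all .nat (.all .nat (.ex σ φ))) e := by
    refine Iff.mpr (holds_all Ty.isNum_nat (by exact ⟨Ty.isNum_nat, hσ, hφ⟩) e) fun n => ?_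
    refine Iff.mpr (holds_all Ty.isNum_nat (by exact ⟨hσ, hφ⟩) _) fun k => ?_
    rw [holds_ex]
    simpa [hP] using h n k
  -- The inner choice yields, for each `n`, a function of `k`; the outer one selects these
  -- functions. Between them stands a statement about functions, which is not arithmetical, so it is
  -- derived by `all_of` and not evaluated.
  have h₂ := imp_mp (holds_ax (.countable_choice _) e)
    (all_of [.all .nat (.all .nat (.ex σ φ))] (by simpa using h₁) fun M' e' n h' =>
      imp_mp (holds_ax (.countable_choice φ) (Env.cons n e')) (all_at (by simpa using h') n))
  rw [holds_ex] at h₂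
  obtain ⟨g, hg⟩ := h₂
  refine ⟨g, fun n k => ?_⟩
  have h₃ := all_at hg n
  rw [M.holds_subst, eval_cons, eval_cons] at h₃
  have h₄ := all_at h₃ k
  rw [M.holds_subst, eval_cons, eval_cons] at h₄
  simpa [hP] using h₄

end Omniscient

end PrimeModel
end Bish

namespace Bish
namespace PrimeModel

variable {M : PrimeModel} {Δ : Ctx}

/-! ### Real numbers in a prime model -/

/-- The rational `q` as a real number. -/
def const (q : M.D .rat) : M.D .seq := M.eval (rConst v0) (Env.cons q Env.nil)

@[simp] theorem app_const (q : M.D .rat) (n : M.D .nat) : M.app (const q) n = q := by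
  simp [const, rConst]

@[simp] theorem eval_rConst (t : Tm Δ .rat) (e : Env M.D Δ) :
    M.eval (rConst t) e = const (M.eval t e) := by
  have : rConst t = (rConst v0).subst (Sub.cons t Sub.nil) := by
    simp only [rConst, Tm.subst, Tm.wk_subst_lift]; rfl
  rw [this, M.eval_subst, eval_cons, eval_nil, const]

def IsReal (x : M.D .seq) : Prop := ∀ m n, M.app x m ≤ M.app x n + (unit m + unit n)

def RLt (x y : M.D .seq) : Prop := ∃ n, M.app x n + 2 * unit n < M.app y n

/-- `|x - y| ≤ d`. -/
def RClose (x y : M.D .seq) (d : M.D .rat) : Prop := ∀ n,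
  M.app x n ≤ M.app y n + (d + 2 * unit n) ∧ M.app y n ≤ M.app x n + (d + 2 * unit n)

def InUnit (x : M.D .seq) : Prop :=
  IsReal x ∧ (∀ n, 0 ≤ M.app x n + 2 * unit n) ∧ ∀ n, M.app x n ≤ 1 + 2 * unit n

def InIoo (a b x : M.D .seq) : Prop := IsReal x ∧ RLt a x ∧ RLt x b

theorem IsReal.of_holds {x : Tm Δ .seq} {e : Env M.D Δ} (h : M.holds (isReal x) e) :
    IsReal (M.eval x e) := fun m n => by
  simpa using all_at (all_at h m) n

theorem InUnit.of_holds {x : Tm Δ .seq} {e : Env M.D Δ} (h : M.holds (inUnit x) e) :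
    InUnit (M.eval x e) := by
  simp only [inUnit, holds_and] at h
  exact ⟨.of_holds h.1, fun n => by simpa using all_at h.2.1 n,
    fun n => by simpa using all_at h.2.2 n⟩

@[simp] theorem holds_rLt (x y : Tm Δ .seq) (e : Env M.D Δ) :
    M.holds (rLt x y) e ↔ RLt (M.eval x e) (M.eval y e) := by
  simp [rLt, RLt]

theorem le_of_forall_unit {a b c : M.D .rat} (hc : 0 ≤ c) (h : ∀ n, a ≤ b + c * unit n) :
    a ≤ b := by
  by_contra hn
  -- The denominator is `c + 1` because `c` may be zero.
  obtain ⟨n, -, hu⟩ := exists_unit_lt (M := M) (ε := (a - b) / (c + 1))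
    (div_pos (by linarith) (by linarith)) M.zero
  rw [lt_div_iff₀ (by linarith)] at hu
  nlinarith [h n, unit_pos n]

theorem exists_unit_lt' {ε : M.D .rat} (h : 0 < ε) : ∃ n : M.D .nat, unit n < ε := by
  obtain ⟨n, -, hn⟩ := exists_unit_lt h M.zero
  exact ⟨n, hn⟩

theorem isReal_const (q : M.D .rat) : IsReal (const q) := fun m n => by
  simp only [app_const]; linarith [unit_pos m, unit_pos n]

theorem inUnit_const {q : M.D .rat} (h0 : 0 ≤ q) (h1 : q ≤ 1) : InUnit (const q) :=
  ⟨isReal_const q, fun n => by simp only [app_const]; linarith [unit_pos n],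
    fun n => by simp only [app_const]; linarith [unit_pos n]⟩

theorem InUnit.nonneg {x : M.D .seq} (h : InUnit x) (n : M.D .nat) : 0 ≤ M.app x n + unit n :=
  -- One unit of `k` comes from regularity and two from the slack in the order of reals.
  le_of_forall_unit (c := 3) (by norm_num) fun k => by
    linarith [h.1 k n, h.2.1 k]

theorem InUnit.le_one {x : M.D .seq} (h : InUnit x) (n : M.D .nat) : M.app x n - unit n ≤ 1 :=
  le_of_forall_unit (c := 3) (by norm_num) fun k => by
    linarith [h.1 n k, h.2.2 k]

/-- A real lies within 1/(i+1) of its term of index `i`, so disjoint rational enclosures decide the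
order. At a common index `k`, regularity of both sequences and the slack in the order cost four
units, whence the division by 4. -/
theorem RLt.of_lt {x y : M.D .seq} (hx : IsReal x) (hy : IsReal y) {i j : M.D .nat}
    (h : M.app x i + unit i < M.app y j - unit j) : RLt x y := by
  obtain ⟨k, hk⟩ := exists_unit_lt' (M := M) (ε := (M.app y j - unit j - (M.app x i + unit i)) / 4)
    (by linarith)
  exact ⟨k, by linarith [hx k i, hy j k]⟩

theorem RLt.const_of_lt {y : M.D .seq} {q : M.D .rat} (hy : IsReal y) {j : M.D .nat}
    (h : q < M.app y j - unit j) : RLt (const q) y := by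
  obtain ⟨k, hk⟩ := exists_unit_lt' (M := M) (ε := M.app y j - unit j - q) (by linarith)
  exact .of_lt (isReal_const q) hy (i := k) (j := j) (by rw [app_const]; linarith)

theorem RLt.of_lt_const {x : M.D .seq} {q : M.D .rat} (hx : IsReal x) {i : M.D .nat}
    (h : M.app x i + unit i < q) : RLt x (const q) := by
  obtain ⟨k, hk⟩ := exists_unit_lt' (M := M) (ε := q - (M.app x i + unit i)) (by linarith)
  exact .of_lt hx (isReal_const q) (i := i) (j := k) (by rw [app_const]; linarith)

theorem RLt.exists_lower {y : M.D .seq} {q : M.D .rat} (h : RLt (const q) y) :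
    ∃ j, q < M.app y j - unit j := by
  obtain ⟨j, hj⟩ := h
  exact ⟨j, by rw [app_const] at hj; linarith [unit_pos j]⟩

theorem RLt.exists_upper {x : M.D .seq} {q : M.D .rat} (h : RLt x (const q)) :
    ∃ i, M.app x i + unit i < q := by
  obtain ⟨i, hi⟩ := h
  exact ⟨i, by rw [app_const] at hi; linarith [unit_pos i]⟩

theorem IsReal.lower_le_upper {x : M.D .seq} (hx : IsReal x) (i j : M.D .nat) :
    M.app x j - unit j ≤ M.app x i + unit i := by linarith [hx j i]

theorem RLt.trans {x y z : M.D .seq} (hx : IsReal x) (hy : IsReal y) (hz : IsReal z)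
    (h : RLt x y) (h' : RLt y z) : RLt x z := by
  obtain ⟨i, hi⟩ := h
  obtain ⟨j, hj⟩ := h'
  exact .of_lt hx hz (i := i) (j := j) (by linarith [hy.lower_le_upper j i])

theorem RLt.irrefl {x : M.D .seq} : ¬ RLt x x := fun ⟨n, hn⟩ => by linarith [unit_pos n]

/-- Points of the unit interval have rational approximations in the unit interval. -/
theorem InUnit.exists_approx {x : M.D .seq} (h : InUnit x) {η : M.D .rat} (hη : 0 < η) :
    ∃ t, 0 ≤ t ∧ t ≤ 1 ∧ ∀ n, M.app x n - unit n - η ≤ t ∧ t ≤ M.app x n + unit n + η := by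
  obtain ⟨k, hk⟩ := exists_unit_lt' hη
  refine ⟨max 0 (min 1 (M.app x k)), le_max_left _ _, max_le zero_le_one (min_le_left _ _),
    fun n => ⟨?_, ?_⟩⟩
  · refine le_max_of_le_right (le_min ?_ ?_)
    · linarith [h.le_one n]
    · linarith [h.1 n k]
  · refine max_le ?_ ((min_le_right _ _).trans ?_)
    · linarith [h.nonneg n]
    · linarith [h.1 k n]

/-! ### Continuous functions and intervals in the shadow -/

/-- Only what the formula `isCont` entails for the elements of one model. -/
structure Cont (f : M.D (.fn .seq .seq)) : Prop where
  isReal : ∀ {x}, InUnit x → IsReal (M.app f x)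
  cont : ∀ {x}, InUnit x → ∀ {ε}, 0 < ε → ∃ δ, 0 < δ ∧ ∀ y, InUnit y → RClose x y δ →
    RClose (M.app f x) (M.app f y) ε

/-- `InShadow f x`: there is a point to the right of `x` at which `f` has a greater value. -/
def InShadow (f : M.D (.fn .seq .seq)) (x : M.D .seq) : Prop :=
  InUnit x ∧ ∃ y, InUnit y ∧ RLt x y ∧ RLt (M.app f x) (M.app f y)

/-- The rational interval `[p, r]` lies in the shadow, in a uniform way: at a rational to the right
of `r`, the value of `f` exceeds a bound for the values on `[p, r]`. -/
def Shaded (f : M.D (.fn .seq .seq)) (p r : M.D .rat) : Prop :=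
  0 ≤ p ∧ p ≤ r ∧ ∃ y c n, r < y ∧ y ≤ 1 ∧ c + unit n < M.app (M.app f (const y)) n ∧
    ∀ t, p ≤ t → t ≤ r → ∀ k, M.app (M.app f (const t)) k ≤ c + unit k

variable {f : M.D (.fn .seq .seq)}

theorem Shaded.lt_one {p r : M.D .rat} (h : Shaded f p r) : r < 1 := by
  obtain ⟨-, -, y, -, -, h₁, h₂, -⟩ := h
  linarith

theorem Shaded.mono {p r p' r' : M.D .rat} (h : Shaded f p r) (hp : p ≤ p') (hpr : p' ≤ r')
    (hr : r' ≤ r) : Shaded f p' r' := by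
  obtain ⟨h₁, h₂, y, c, n, h₃, h₄, h₅, h₆⟩ := h
  exact ⟨h₁.trans hp, hpr, y, c, n, hr.trans_lt h₃, h₄, h₅,
    fun t ht ht' => h₆ t (hp.trans ht) (ht'.trans hr)⟩

/-- Overlapping shaded intervals can be joined. -/
theorem Shaded.glue {p r p' r' : M.D .rat} (h : Shaded f p r) (h' : Shaded f p' r')
    (hp : p ≤ p') (hpr : p' ≤ r) (hr : r ≤ r') : Shaded f p r' := by
  obtain ⟨h₁, h₂, y, c, n, h₃, h₄, h₅, h₆⟩ := h
  obtain ⟨h₁', h₂', y', c', n', h₃', h₄', h₅', h₆'⟩ := h'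
  have key : ∀ d, c ≤ d → c' ≤ d → ∀ t, p ≤ t → t ≤ r' → ∀ k,
      M.app (M.app f (const t)) k ≤ d + unit k := by
    intro d hd hd' t ht ht' k
    rcases le_total t r with htr | htr
    · linarith [h₆ t ht htr k]
    · linarith [h₆' t (hpr.trans htr) ht' k]
  refine ⟨h₁, by linarith, ?_⟩
  -- The larger of the two bounds holds on the union; what remains is a point beyond `r'` with a
  -- value above it.
  rcases le_total c c' with hc | hc
  · exact ⟨y', c', n', h₃', h₄', h₅', key c' hc le_rfl⟩
  · by_cases hy : y ≤ r'
    -- If `y` were in `[p', r']`, its value would be at most `c'`, hence at most `c`, which it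
    -- exceeds.
    · have := h₆' y (by linarith) hy n
      linarith
    · exact ⟨y, c, n, not_le.1 hy, h₄, h₅, key c le_rfl hc⟩

theorem RClose.of_bounds {x : M.D .seq} {t δ : M.D .rat}
    (h : ∀ n, M.app x n - unit n - δ ≤ t ∧ t ≤ M.app x n + unit n + δ) :
    RClose x (const t) δ := fun n => by
  have := h n
  have := unit_pos n
  rw [app_const]
  constructor <;> linarith

/-- A point of the shadow lies in a shaded rational interval. -/
theorem Cont.exists_shaded (hf : Cont f) {x : M.D .seq} (h : InShadow f x)
    (h0 : RLt (const 0) x) (h1 : RLt x (const 1)) :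
    ∃ p r, RLt (const p) x ∧ RLt x (const r) ∧ Shaded f p r := by
  obtain ⟨hx, y, hy, ⟨i, hi⟩, ⟨j, hj⟩⟩ := h
  have hfx := hf.isReal hx
  have hfy := hf.isReal hy
  -- The gap between the enclosures of `f x` and `f y` is `4 ε`. One `ε` pays for replacing `y` by a
  -- rational, one for the variation of `f` near `x`; the rest leaves room for the index errors.
  obtain ⟨ε, hε, hεd⟩ : ∃ ε, 0 < ε ∧
      M.app (M.app f x) j + unit j + 4 * ε = M.app (M.app f y) j - unit j :=
    ⟨(M.app (M.app f y) j - unit j - (M.app (M.app f x) j + unit j)) / 4, by linarith, by ring⟩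
  obtain ⟨δ₁, hδ₁, hc₁⟩ := hf.cont hy hε
  obtain ⟨δ₂, hδ₂, hc₂⟩ := hf.cont hx hε
  -- The tolerance keeps `y'` where `f` is close to `f y`, and, being half of the gap, to the right
  -- of `x`.
  obtain ⟨y', hy0, hy1, hyy⟩ := hy.exists_approx
    (η := min δ₁ ((M.app y i - M.app x i - 2 * unit i) / 2)) (lt_min hδ₁ (by linarith))
  have hy' := inUnit_const hy0 hy1
  have hyx : M.app x i + unit i < y' := by
    linarith [(hyy i).1, min_le_right δ₁ ((M.app y i - M.app x i - 2 * unit i) / 2)]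
  have hcl := hc₁ _ hy' (.of_bounds fun n => by
    have := hyy n
    have := min_le_left δ₁ ((M.app y i - M.app x i - 2 * unit i) / 2)
    constructor <;> linarith)
  obtain ⟨l, hl⟩ := exists_unit_lt' (M := M) (ε := ε / 4) (by linarith)
  -- The points within two units of the term `x m` are within three units of `x`; three units must
  -- stay below `δ₂` and must not reach `y'`.
  obtain ⟨m, hm⟩ := exists_unit_lt' (M := M) (ε := min (δ₂ / 3) ((y' - (M.app x i + unit i)) / 3))
    (lt_min (by linarith) (by linarith))
  have hm₁ := hm.trans_le (min_le_left _ _)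
  have hm₂ := hm.trans_le (min_le_right _ _)
  have hum := unit_pos m
  have hxm := hx.1 m i
  refine ⟨max 0 (M.app x m - 2 * unit m), min 1 (M.app x m + 2 * unit m), ?_, ?_,
    le_max_left _ _, ?_, y', M.app (M.app f x) j + unit j + ε, l, ?_, hy1, ?_, ?_⟩
  · rcases max_choice 0 (M.app x m - 2 * unit m) with h | h <;> rw [h]
    · exact h0
    · exact .const_of_lt hx.1 (j := m) (by linarith)
  · rcases min_choice 1 (M.app x m + 2 * unit m) with h | h <;> rw [h]
    · exact h1
    · exact .of_lt_const hx.1 (i := m) (by linarith)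
  · have := hx.nonneg m
    have := hx.le_one m
    exact max_le (le_min zero_le_one (by linarith)) (le_min (by linarith) (by linarith))
  · exact (min_le_right _ _).trans_lt (by linarith)
  · linarith [(hcl l).1, hfy j l]
  · intro t ht ht' k
    have ht0 : 0 ≤ t := (le_max_left _ _).trans ht
    have ht1 : t ≤ 1 := ht'.trans (min_le_left _ _)
    have hta := (le_max_right _ _).trans ht
    have htb := ht'.trans (min_le_right _ _)
    have hct := hc₂ _ (inUnit_const ht0 ht1) (.of_bounds fun n => by
      have := hx.1 n m
      have := hx.1 m n
      constructor <;> linarith)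
    have hft := hf.isReal (inUnit_const ht0 ht1)
    refine le_of_forall_unit (c := 4) (by norm_num) fun n => ?_
    linarith [hft k n, (hct n).2, hfx n j]

/-- The points of shaded rational intervals belong to the shadow. -/
theorem Cont.inShadow (hf : Cont f) {x : M.D .seq} (hx : IsReal x) {p r : M.D .rat}
    (h : Shaded f p r) (hp : RLt (const p) x) (hr : RLt x (const r)) :
    InShadow f x ∧ RLt (const 0) x ∧ RLt x (const 1) := by
  obtain ⟨h₁, h₂, y, c, n, h₃, h₄, h₅, h₆⟩ := h
  obtain ⟨i, hi⟩ := hp.exists_lower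
  obtain ⟨j, hj⟩ := hr.exists_upper
  have hxu : InUnit x := ⟨hx, fun k => by linarith [hx i k, unit_pos k],
    fun k => by linarith [hx k j, unit_pos k]⟩
  have hy : InUnit (const y) := inUnit_const (by linarith) h₄
  refine ⟨⟨hxu, const y, hy, .of_lt_const hx (i := j) (by linarith), ?_⟩,
    .const_of_lt hx (j := i) (by linarith), .of_lt_const hx (i := j) (by linarith)⟩
  obtain ⟨ε, hε, hεd⟩ : ∃ ε, 0 < ε ∧ c + 2 * ε = M.app (M.app f (const y)) n - unit n :=
    ⟨(M.app (M.app f (const y)) n - unit n - c) / 2, by linarith, by ring⟩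
  obtain ⟨δ, hδ, hc⟩ := hf.cont hxu hε
  -- A rational this close to `x` is within `δ` of it and still lies in `[p, r]`, where the bound
  -- `c` applies.
  obtain ⟨η, hη, hη₁, hη₂, hη₃⟩ : ∃ η : M.D .rat, 0 < η ∧ η ≤ δ ∧
      η ≤ M.app x i - unit i - p ∧ η ≤ r - (M.app x j + unit j) :=
    ⟨min δ (min (M.app x i - unit i - p) (r - (M.app x j + unit j))),
      lt_min hδ (lt_min (by linarith) (by linarith)), min_le_left _ _,
      (min_le_right _ _).trans (min_le_left _ _), (min_le_right _ _).trans (min_le_right _ _)⟩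
  obtain ⟨t, ht0, ht1, ht⟩ := hxu.exists_approx hη
  have hct := hc _ (inUnit_const ht0 ht1) (.of_bounds fun n => by
    have := ht n
    constructor <;> linarith)
  obtain ⟨k, hk⟩ := exists_unit_lt' (M := M) (ε := ε / 4) (by linarith)
  refine .of_lt (hf.isReal hxu) (hf.isReal hy) (i := k) (j := n) ?_
  linarith [(hct k).1, h₆ t (by linarith [(ht i).1]) (by linarith [(ht j).2]) k]

end PrimeModel
end Bish

/-! ### Shadedness as an arithmetical formula, and enumerations. -/

namespace Bish

/-- The formula that says that the rational interval `[p, r]` is shaded. -/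
def shaded {Γ : Ctx} (f : Tm Γ (.fn .seq .seq)) (p r : Tm Γ .rat) : Fm Γ :=
  .and (qLe .qzero p) (.and (qLe p r) (.ex .rat (.ex .rat (.ex .nat
    (.and (qLt r.wk.wk.wk v2) (.and (qLe v2 .qone)
      (.and (qLt (.qadd v1 (unitFrac v0)) (.app (.app f.wk.wk.wk (rConst v2)) v0))
        (.all .rat (.imp (qLe p.wk.wk.wk.wk v0) (.imp (qLe v0 r.wk.wk.wk.wk)
          (.all .nat (qLe (.app (.app f.wk.wk.wk.wk.wk (rConst v1)) v0)
            (.qadd v3 (unitFrac v0))))))))))))))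

namespace PrimeModel

variable {M : PrimeModel} {Δ : Ctx}

/-- The number (i+j)² + i lies between (i+j)² and the next square, so it determines `i + j`, and
then `i`. It serves as a pairing code. -/
theorem pair_inj {i j i' j' : M.D .nat}
    (h : (M.cast i + M.cast j) * (M.cast i + M.cast j) + M.cast i =
      (M.cast i' + M.cast j') * (M.cast i' + M.cast j') + M.cast i') : i = i' ∧ j = j' := by
  have key : M.cast i + M.cast j = M.cast i' + M.cast j' := by
    rcases nat_trichotomy (add i j) (add i' j') with h' | h' | h'
    · simpa using congrArg M.cast h'
    · rw [cast_add, cast_add] at h'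
      nlinarith [cast_nonneg i, cast_nonneg j, cast_nonneg i', cast_nonneg j']
    · rw [cast_add, cast_add] at h'
      nlinarith [cast_nonneg i, cast_nonneg j, cast_nonneg i', cast_nonneg j']
  rw [key] at h
  have h₁ : M.cast i = M.cast i' := by linarith
  exact ⟨cast_injective h₁, cast_injective (by linarith)⟩

section Omniscient

variable [M.Omniscient]

@[simp] theorem _root_.Bish.isArith_shaded (f : Tm Δ (.fn .seq .seq)) (p r : Tm Δ .rat) :
    (shaded f p r).IsArith := by
  simp [shaded]

@[simp] theorem holds_shaded (f : Tm Δ (.fn .seq .seq)) (p r : Tm Δ .rat) (e : Env M.D Δ) :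
    M.holds (shaded f p r) e ↔ Shaded (M.eval f e) (M.eval p e) (M.eval r e) := by
  simp [shaded, Shaded, holds_all, holds_imp]

theorem holds_isReal (x : Tm Δ .seq) (e : Env M.D Δ) :
    M.holds (isReal x) e ↔ IsReal (M.eval x e) := by
  simp [isReal, IsReal, holds_all]

theorem holds_inUnit (x : Tm Δ .seq) (e : Env M.D Δ) :
    M.holds (inUnit x) e ↔ InUnit (M.eval x e) := by
  simp [inUnit, InUnit, holds_isReal, rLe, holds_all]

theorem holds_inIoo (a b x : Tm Δ .seq) (e : Env M.D Δ) :
    M.holds (inIoo a b x) e ↔ InIoo (M.eval a e) (M.eval b e) (M.eval x e) := by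
  simp [inIoo, InIoo, holds_isReal]

theorem holds_rClose (x y : Tm Δ .seq) (d : Tm Δ .rat) (e : Env M.D Δ) :
    M.holds (rClose x y d) e ↔ RClose (M.eval x e) (M.eval y e) (M.eval d e) := by
  simp [rClose, RClose, holds_all]

theorem holds_inShadow (f : Tm Δ (.fn .seq .seq)) (x : Tm Δ .seq) (e : Env M.D Δ) :
    M.holds (inShadow f x) e ↔ InShadow (M.eval f e) (M.eval x e) := by
  simp [inShadow, InShadow, holds_inUnit]

theorem Cont.of_holds {f : Tm Δ (.fn .seq .seq)} {e : Env M.D Δ} (h : M.holds (isCont f) e) :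
    Cont (M.eval f e) := by
  simp only [isCont, holds_and] at h
  obtain ⟨h₁, -, h₃⟩ := h
  refine ⟨fun {x} hx => ?_, fun {x} hx {ε} hε => ?_⟩
  · simpa [holds_isReal] using imp_mp (all_at h₁ x) (by simpa [holds_inUnit])
  · have h := imp_mp (all_at (imp_mp (all_at h₃ x) (by simpa [holds_inUnit])) ε) (by simpa)
    rw [holds_ex] at h
    obtain ⟨δ, h⟩ := h
    rw [holds_and] at h
    refine ⟨δ, by simpa using h.1, fun y hy hxy => ?_⟩
    have := imp_mp (imp_mp (all_at h.2 y) (by simpa [holds_inUnit])) (by simpa [holds_rClose])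
    simpa [holds_rClose] using this

/-! ### Enumerations in an omniscient model -/

/-- The non-negative rationals can be enumerated. -/
theorem exists_rat_enum : ∃ g : M.D (.fn .nat .rat), ∀ q, 0 ≤ q → ∃ n, M.app g n = q := by
  -- The value at the code of `(i, j)` is `i / (j + 1)`. At numbers that are not codes it is
  -- unconstrained, so `g` may have negative values.
  obtain ⟨g, hg⟩ := exists_choice (M := M) Ty.isNum_rat
    (P := fun n q => ∀ i j, M.cast n =
      (M.cast i + M.cast j) * (M.cast i + M.cast j) + M.cast i → q * (M.cast j + 1) = M.cast i)
    (.all .nat (.all .nat (.imp (.eq (natCast v3) (.qadd (.qmul (.qadd (natCast v1) (natCast v0))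
      (.qadd (natCast v1) (natCast v0))) (natCast v1)))
      (.eq (.qmul v2 (.qadd (natCast v0) .qone)) (natCast v1))))) Env.nil
    (by simp) (by simp [holds_all, holds_imp]) (fun n => by
      by_cases h : ∃ i j, M.cast n = (M.cast i + M.cast j) * (M.cast i + M.cast j) + M.cast i
      · obtain ⟨i, j, h⟩ := h
        refine ⟨M.cast i * unit j, fun i' j' h' => ?_⟩
        obtain ⟨rfl, rfl⟩ := pair_inj (h.symm.trans h')
        rw [mul_assoc, unit_mul, mul_one]
      · exact ⟨0, fun i j h' => (h ⟨i, j, h'⟩).elim⟩)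
  refine ⟨g, fun q hq => ?_⟩
  obtain ⟨i, k, h⟩ := exists_nonneg_frac hq
  obtain ⟨m, hm⟩ := exists_cast_mul (add i k) (add i k)
  refine ⟨add m i, mul_right_cancel₀ (cast_add_one_pos k).ne' ?_⟩
  rw [h]
  exact hg _ i k (by rw [cast_add, hm, cast_add])

/-- The elements of an arithmetical set of natural numbers can be listed without repetition. -/
theorem exists_listing {C : M.D .nat → Prop} (φ : Fm (.nat :: Δ)) (e : Env M.D Δ)
    (hφ : φ.IsArith) (hC : ∀ n, M.holds φ (Env.cons n e) ↔ C n) :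
    ∃ l g : M.D (.fn .nat .nat), (∀ n, M.app l n = M.zero ∨ M.app l n = M.one) ∧
      (∀ n, M.app l n = M.one → M.app l (M.succ n) = M.one) ∧
      (∀ n, M.app l n = M.zero → C (M.app g n)) ∧
      (∀ n m, M.app l n = M.zero → M.app l m = M.zero → n ≠ m → M.app g n ≠ M.app g m) ∧
      ∀ c, C c → ∃ n, M.app l n = M.zero ∧ M.app g n = c := by
  obtain ⟨χ, hχ⟩ := exists_choice (M := M) Ty.isNum_nat
    (P := fun n y => (y = M.one ∧ C n) ∨ (y = M.zero ∧ ¬ C n))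
    (.or (.and (.eq v0 Tm.one) φ.wk) (.and (.eq v0 .zero) φ.wk.neg)) e
    (by simp [Fm.wk, Fm.rename_eq_subst, hφ.subst])
    (fun n y => by
      have : φ.wk.neg (Γ := .nat :: .nat :: Δ) = φ.neg.wk := rfl
      simp [this, holds_neg hφ, hC])
    (fun n => by by_cases h : C n <;> simp [h])
  have hχ₁ : ∀ n, M.app χ n = M.one ↔ C n := fun n => by
    have := hχ n
    have : M.one ≠ M.zero := one_ne_zero'
    grind
  have hχ₀ : ∀ n, ¬ C n → M.app χ n = M.zero := fun n hn => by
    have := hχ n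
    tauto
  -- `nx n` is the least element of `C` from `n` on, or just some number at least `n` if there is
  -- none.
  obtain ⟨nx, hnx⟩ := exists_choice (M := M) Ty.isNum_nat
    (P := fun n m => M.cast n ≤ M.cast m ∧
      ((M.app χ m = M.one ∧ ∀ k, M.cast n ≤ M.cast k → M.app χ k = M.one → M.cast m ≤ M.cast k) ∨
        ∀ k, M.cast n ≤ M.cast k → ¬ M.app χ k = M.one))
    (.and (qLe (natCast v1) (natCast v0)) (.or
      (.and (.eq (.app v2 v0) Tm.one) (.all .nat (.imp (qLe (natCast v2) (natCast v0))
        (.imp (.eq (.app v3 v0) Tm.one) (qLe (natCast v1) (natCast v0))))))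
      (.all .nat (.imp (qLe (natCast v2) (natCast v0)) (Fm.eq (.app v3 v0) Tm.one).neg))))
    (Env.cons χ Env.nil) (by simp)
    (by simp [holds_all, holds_imp, holds_neg]) (fun n => by
      by_cases h : ∃ k, M.cast n ≤ M.cast k ∧ M.app χ k = M.one
      · obtain ⟨m, hm, hm'⟩ := exists_least (M := M)
          (P := fun k => M.cast n ≤ M.cast k ∧ M.app χ k = M.one)
          (.and (qLe (natCast v1) (natCast v0)) (.eq (.app v2 v0) Tm.one))
          (Env.cons n (Env.cons χ Env.nil)) (by simp) (by simp) h
        refine ⟨m, hm.1, .inl ⟨hm.2, fun k hk hk' => ?_⟩⟩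
        by_contra hn
        exact hm' k (not_le.1 hn) ⟨hk, hk'⟩
      · push Not at h
        exact ⟨n, le_rfl, .inr h⟩)
  -- The search for the entry of index `n` starts at `u n`: this is 0 for the first entry, and
  -- afterwards one more than the preceding entry. The entry itself is `g n = nx (u n)`.
  let F : M.D (.fn .nat (.fn .nat .nat)) :=
    M.eval (.lam (.lam (.succ (.app v2 v0)))) (Env.cons nx Env.nil)
  let u : M.D .nat → M.D .nat := M.natRec M.zero F
  have hu0 : u M.zero = M.zero := natRec_zero _ _
  have hus : ∀ n, u (M.succ n) = M.succ (M.app nx (u n)) := fun n => by simp [u, F]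
  let g : M.D (.fn .nat .nat) :=
    M.eval (.lam (.app v2 (.natRec .zero v1 v0))) (Env.cons F (Env.cons nx Env.nil))
  have hg : ∀ n, M.app g n = M.app nx (u n) := fun n => by simp [g, u]
  -- The recursion exchanges 0 and 1: `l n` is 0 exactly if the search for entry `n` has succeeded.
  let l : M.D (.fn .nat .nat) :=
    M.eval (.lam (.natRec Tm.one (.lam (.lam .zero)) (.app v2 (.app v1 v0))))
      (Env.cons g (Env.cons χ Env.nil))
  have hl₀ : ∀ n, C (M.app g n) → M.app l n = M.zero := fun n hn => by
    simp [l, (hχ₁ _).2 hn]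
  have hl₁ : ∀ n, ¬ C (M.app g n) → M.app l n = M.one := fun n hn => by
    simp [l, hχ₀ _ hn]
  have hlC : ∀ n, M.app l n = M.zero → C (M.app g n) := fun n hn => by
    by_contra h
    exact one_ne_zero' ((hl₁ n h).symm.trans hn)
  simp only [hχ₁] at hnx
  have hug : ∀ n, M.cast (u n) ≤ M.cast (M.app g n) := fun n => by rw [hg]; exact (hnx _).1
  have hmin : ∀ n k, M.cast (u n) ≤ M.cast k → C k → C (M.app g n) ∧
      M.cast (M.app g n) ≤ M.cast k := fun n k hk hk' => by
    rw [hg]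
    rcases (hnx (u n)).2 with h | h
    · exact ⟨h.1, h.2 k hk hk'⟩
    · exact (h k hk hk').elim
  have hA : ∀ n, M.cast n ≤ M.cast (u n) := nat_induction (M := M)
    (qLe (natCast v0) (natCast (.natRec .zero v1 v0))) (Env.cons F Env.nil) (by simp)
    (by simp [u]) (by simp [hu0]) fun n ih => by
      rw [hus, cast_succ, cast_succ, ← hg]
      linarith [hug n]
  have hB : ∀ i j, M.cast i < M.cast j → M.cast (M.app g i) < M.cast (u j) := fun i =>
    nat_induction (M := M) (.imp (qLt (natCast v1) (natCast v0))
      (qLt (natCast (.app v2 v1)) (natCast (.natRec .zero v3 v0))))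
      (Env.cons i (Env.cons g (Env.cons F Env.nil))) (by simp)
      (by simp [u, holds_imp]) (fun h => by linarith [cast_nonneg i, (cast_zero (M := M))])
      fun n ih h => by
        rw [hus, cast_succ, ← hg]
        rw [cast_succ] at h
        rcases (cast_le_of_lt_succ h).eq_or_lt with h' | h'
        · rw [cast_injective h']; linarith
        · linarith [ih h', hug n]
  refine ⟨l, g, fun n => ?_, fun n hn => ?_, hlC, fun n m hn hm hnm heq => ?_, fun c hc => ?_⟩
  · by_cases h : C (M.app g n)
    · exact .inl (hl₀ n h)
    · exact .inr (hl₁ n h)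
  -- An element found by a later search would have made the earlier search succeed as well.
  · refine hl₁ _ fun h => ?_
    have h' := (hmin n _ ?_ h).1
    · exact one_ne_zero' (hn.symm.trans (hl₀ n h'))
    · have := hug (M.succ n)
      rw [hus, cast_succ, ← hg] at this
      linarith [hug n]
  · rcases nat_trichotomy n m with h | h | h
    · exact hnm h
    · have := hB n m (by linarith)
      rw [heq] at this
      linarith [hug m]
    · have := hB m n (by linarith)
      rw [← heq] at this
      linarith [hug n]
  -- The starting points `u` grow beyond `c`. If `k + 1` is the first index at which this happens,
  -- then `u k ≤ c`, so entry `k` is at most `c`; and `c < u (k+1)` makes it at least `c`.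
  · obtain ⟨n, hn, hn'⟩ := exists_least (M := M) (P := fun n => M.cast c < M.cast (u n))
      (qLt (natCast v1) (natCast (.natRec .zero v2 v0))) (Env.cons c (Env.cons F Env.nil))
      (by simp) (by simp [u]) ⟨M.succ c, by have := hA (M.succ c); rw [cast_succ] at this; linarith⟩
    rcases nat_cases n with rfl | ⟨k, rfl⟩
    · rw [hu0, cast_zero] at hn
      linarith [cast_nonneg c]
    · have hk := not_lt.1 (hn' k (by rw [cast_succ]; linarith))
      obtain ⟨h₁, h₂⟩ := hmin k c hk hc
      refine ⟨k, hl₀ k h₁, cast_injective (le_antisymm h₂ ?_)⟩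
      rw [hus, cast_succ, ← hg] at hn
      exact cast_le_of_lt_succ hn

end Omniscient

end PrimeModel
end Bish

/-! ### The components of the shadow: representatives and endpoints. -/

namespace Bish

/-- The formula that says that `(a n, b n)`, for `l n = 0`, are the components of the shadow in
`(0, 1)`, and that `r n` is a rational in `(a n, b n)`. -/
def components {Γ : Ctx} (f : Tm Γ (.fn .seq .seq)) (l : Tm Γ (.fn .nat .nat))
    (r : Tm Γ (.fn .nat .rat)) (a b : Tm Γ (.fn .nat .seq)) : Fm Γ :=
  .and (isIncreasingBinary l) (.and
    (.all .nat (.imp (.eq (.app l.wk v0) .zero) (.and (qLt .qzero (.app r.wk v0)) (.all .nat (.and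
      (.and (shaded f.wk.wk (.app (.app a.wk.wk v1) v0) (.app r.wk.wk v1))
        (shaded f.wk.wk (.qadd (.app (.app a.wk.wk v1) v0) (.qneg (unitFrac v0)))
          (.app r.wk.wk v1)).neg)
      (.and (shaded f.wk.wk (.app r.wk.wk v1) (.app (.app b.wk.wk v1) v0))
        (shaded f.wk.wk (.app r.wk.wk v1)
          (.qadd (.app (.app b.wk.wk v1) v0) (unitFrac v0))).neg))))))
    (.and
      (.all .nat (.all .nat (.imp (.eq (.app l.wk.wk v1) .zero) (.imp (.eq (.app l.wk.wk v0) .zero)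
        (.imp (Fm.eq v1 v0).neg
          (shaded f.wk.wk (.app r.wk.wk v1) (.app r.wk.wk v0)).neg)))))
      (.all .rat (.imp (qLt .qzero v0) (.imp (shaded f.wk v0 v0)
        (.ex .nat (.and (.eq (.app l.wk.wk v0) .zero)
          (.or (shaded f.wk.wk v1 (.app r.wk.wk v0)) (shaded f.wk.wk (.app r.wk.wk v0) v1)))))))))

namespace PrimeModel

variable {M : PrimeModel} {Δ : Ctx}

/-- The approximation of index `k` to the left endpoint still bounds a shaded interval ending at `r
n`, and no longer does so when moved left by 1/(k+1); similarly on the right. Regularity of both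
endpoint sequences follows from this. The last two clauses say that each component meeting the
positive rationals has exactly one representative. -/
def Components (f : M.D (.fn .seq .seq)) (l : M.D (.fn .nat .nat)) (r : M.D (.fn .nat .rat))
    (a b : M.D (.fn .nat .seq)) : Prop :=
  ((∀ n, M.app l n = M.zero ∨ M.app l n = M.one) ∧
    ∀ n, M.app l n = M.one → M.app l (M.succ n) = M.one) ∧
  (∀ n, M.app l n = M.zero → 0 < M.app r n ∧ ∀ k,
    (Shaded f (M.app (M.app a n) k) (M.app r n) ∧
      ¬ Shaded f (M.app (M.app a n) k - unit k) (M.app r n)) ∧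
    (Shaded f (M.app r n) (M.app (M.app b n) k) ∧
      ¬ Shaded f (M.app r n) (M.app (M.app b n) k + unit k))) ∧
  (∀ n m, M.app l n = M.zero → M.app l m = M.zero → ¬ n = m →
    ¬ Shaded f (M.app r n) (M.app r m)) ∧
  ∀ q, 0 < q → Shaded f q q → ∃ n, M.app l n = M.zero ∧
    (Shaded f q (M.app r n) ∨ Shaded f (M.app r n) q)

section Omniscient

variable [M.Omniscient]

theorem holds_components (f : Tm Δ (.fn .seq .seq)) (l : Tm Δ (.fn .nat .nat))
    (r : Tm Δ (.fn .nat .rat)) (a b : Tm Δ (.fn .nat .seq)) (e : Env M.D Δ) :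
    M.holds (components f l r a b) e ↔
      Components (M.eval f e) (M.eval l e) (M.eval r e) (M.eval a e) (M.eval b e) := by
  simp [components, Components, isIncreasingBinary, isBinary, holds_all, holds_imp, holds_neg,
    sub_eq_add_neg]

variable {f : M.D (.fn .seq .seq)}

/-- Otherwise steps of 1/(k+1) to the left could be repeated forever, while a shaded interval does
not extend below 0. -/
theorem Shaded.exists_left {r : M.D .rat} (h : Shaded f r r) (k : M.D .nat) :
    ∃ q, Shaded f q r ∧ ¬ Shaded f (q - unit k) r := by
  by_contra hn
  push Not at hn
  have key : ∀ j, Shaded f (r - M.cast j * unit k) r := nat_induction (M := M)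
    (shaded v1 (.qadd v2 (.qneg (.qmul (natCast v0) (unitFrac v3)))) v2)
    (Env.cons f (Env.cons r (Env.cons k Env.nil))) (by simp) (by simp [sub_eq_add_neg])
    (by simpa using h) fun j hj => by
      have := hn _ hj
      rwa [sub_sub, ← add_one_mul, ← cast_succ] at this
  -- After this many steps the left end is at most -1.
  obtain ⟨j, hj⟩ := exists_le_cast ((r + 1) * (M.cast k + 1))
  have h₁ := (key j).1
  have h₂ : r + 1 ≤ M.cast j * unit k := by
    rw [unit, ← div_eq_mul_inv, le_div_iff₀ (cast_add_one_pos k)]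
    exact hj
  linarith

/-- Otherwise steps to the right would carry a shaded interval past 1. -/
theorem Shaded.exists_right {r : M.D .rat} (h : Shaded f r r) (k : M.D .nat) :
    ∃ q, Shaded f r q ∧ ¬ Shaded f r (q + unit k) := by
  by_contra hn
  push Not at hn
  have key : ∀ j, Shaded f r (r + M.cast j * unit k) := nat_induction (M := M)
    (shaded v1 v2 (.qadd v2 (.qmul (natCast v0) (unitFrac v3))))
    (Env.cons f (Env.cons r (Env.cons k Env.nil))) (by simp) (by simp)
    (by simpa using h) fun j hj => by
      have := hn _ hj
      rwa [_root_.add_assoc, ← add_one_mul, ← cast_succ] at this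
  obtain ⟨j, hj⟩ := exists_le_cast (M := M) (1 * (M.cast k + 1))
  have h₁ := (key j).lt_one
  have h₀ := h.1
  have h₂ : 1 ≤ M.cast j * unit k := by
    rw [unit, ← div_eq_mul_inv, le_div_iff₀ (cast_add_one_pos k)]
    exact hj
  linarith

/-- Rationals in the same component of the shadow. -/
def SameComponent (f : M.D (.fn .seq .seq)) (p q : M.D .rat) : Prop :=
  Shaded f p q ∨ Shaded f q p

-- If `q` lies between the other two points, the intervals are glued at `q`; if it is extreme, the
-- interval sought is part of one of the given ones.
omit [M.Omniscient] in
theorem SameComponent.trans {p q r : M.D .rat} (h : SameComponent f p q)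
    (h' : SameComponent f q r) : SameComponent f p r := by
  rcases h with h | h <;> rcases h' with h' | h'
  · exact .inl (h.glue h' h.2.1 le_rfl h'.2.1)
  · rcases le_total p r with hpr | hpr
    · exact .inl (h.mono le_rfl hpr h'.2.1)
    · exact .inr (h'.mono le_rfl hpr h.2.1)
  · rcases le_total p r with hpr | hpr
    · exact .inl (h'.mono h.2.1 hpr le_rfl)
    · exact .inr (h.mono h'.2.1 hpr le_rfl)
  · exact .inr (h'.glue h h'.2.1 le_rfl h.2.1)

theorem exists_components (f : M.D (.fn .seq .seq)) : ∃ l r a b, Components f l r a b := by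
  obtain ⟨ρ, hρ⟩ := exists_rat_enum (M := M)
  obtain ⟨a, ha⟩ := exists_choice₂ (M := M) Ty.isNum_rat
    (P := fun n k q => Shaded f (M.app ρ n) (M.app ρ n) →
      Shaded f q (M.app ρ n) ∧ ¬ Shaded f (q - unit k) (M.app ρ n))
    (.imp (shaded v3 (.app v4 v2) (.app v4 v2)) (.and (shaded v3 v0 (.app v4 v2))
      (shaded v3 (.qadd v0 (.qneg (unitFrac v1))) (.app v4 v2)).neg))
    (Env.cons f (Env.cons ρ Env.nil)) (by simp)
    (by simp [holds_imp, holds_neg, sub_eq_add_neg]) (fun n k => by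
      by_cases h : Shaded f (M.app ρ n) (M.app ρ n)
      · simpa [h] using h.exists_left k
      · exact ⟨0, fun h' => (h h').elim⟩)
  obtain ⟨b, hb⟩ := exists_choice₂ (M := M) Ty.isNum_rat
    (P := fun n k q => Shaded f (M.app ρ n) (M.app ρ n) →
      Shaded f (M.app ρ n) q ∧ ¬ Shaded f (M.app ρ n) (q + unit k))
    (.imp (shaded v3 (.app v4 v2) (.app v4 v2)) (.and (shaded v3 (.app v4 v2) v0)
      (shaded v3 (.app v4 v2) (.qadd v0 (unitFrac v1))).neg))
    (Env.cons f (Env.cons ρ Env.nil)) (by simp)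
    (by simp [holds_imp, holds_neg]) (fun n k => by
      by_cases h : Shaded f (M.app ρ n) (M.app ρ n)
      · simpa [h] using h.exists_right k
      · exact ⟨0, fun h' => (h h').elim⟩)
  -- `C` consists of the indices of representatives: positive shaded rationals that come first in
  -- their component. Positivity is imposed because a component may contain 0, which is not a point
  -- of `(0, 1)`, and because `ρ` may have negative values.
  obtain ⟨l, g, hl, hl', hC, hinj, hsurj⟩ := exists_listing (M := M)
    (C := fun n => 0 < M.app ρ n ∧ Shaded f (M.app ρ n) (M.app ρ n) ∧
      ∀ m, M.cast m < M.cast n → 0 < M.app ρ m →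
        ¬ SameComponent f (M.app ρ m) (M.app ρ n))
    (.and (qLt .qzero (.app v2 v0)) (.and (shaded v1 (.app v2 v0) (.app v2 v0))
      (.all .nat (.imp (qLt (natCast v0) (natCast v1)) (.imp (qLt .qzero (.app v3 v0))
        (Fm.or (shaded v2 (.app v3 v0) (.app v3 v1)) (shaded v2 (.app v3 v1) (.app v3 v0))).neg)))))
    (Env.cons f (Env.cons ρ Env.nil)) (by simp)
    (by simp [holds_all, holds_imp, holds_neg, SameComponent])
  have happ : ∀ {σ : Ty} (h : M.D (.fn .nat σ)), ∃ h' : M.D (.fn .nat σ),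
      ∀ n, M.app h' n = M.app h (M.app g n) := fun h =>
    ⟨M.eval (.lam (.app v2 (.app v1 v0))) (Env.cons g (Env.cons h Env.nil)), fun n => by simp⟩
  obtain ⟨r', hr'⟩ := happ ρ
  obtain ⟨a', ha'⟩ := happ a
  obtain ⟨b', hb'⟩ := happ b
  refine ⟨l, r', a', b', ⟨hl, hl'⟩, fun n hn => ?_, fun n m hn hm hnm h => ?_, fun q hq hqs => ?_⟩
  · have h := hC n hn
    simp only [hr', ha', hb']
    exact ⟨h.1, fun k => ⟨ha _ k h.2.1, hb _ k h.2.1⟩⟩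
  · rw [hr', hr'] at h
    obtain ⟨h₁, -, h₂⟩ := hC n hn
    obtain ⟨h₃, -, h₄⟩ := hC m hm
    rcases nat_trichotomy (M.app g n) (M.app g m) with h' | h' | h'
    · exact hinj n m hn hm hnm h'
    · exact h₄ _ (by linarith) h₁ (.inl h)
    · exact h₂ _ (by linarith) h₃ (.inr h)
  · obtain ⟨i, rfl⟩ := hρ q hq.le
    -- The first positive rational in the component of `ρ i`; by transitivity it is also first in
    -- its own component.
    obtain ⟨m, ⟨hm₁, hm₂⟩, hm⟩ := exists_least (M := M)
      (P := fun m => 0 < M.app ρ m ∧ SameComponent f (M.app ρ m) (M.app ρ i))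
      (.and (qLt .qzero (.app v3 v0)) (.or (shaded v2 (.app v3 v0) (.app v3 v1))
        (shaded v2 (.app v3 v1) (.app v3 v0)))) (Env.cons i (Env.cons f (Env.cons ρ Env.nil)))
      (by simp) (by simp [SameComponent]) ⟨i, hq, .inl hqs⟩
    have hmm : Shaded f (M.app ρ m) (M.app ρ m) := by
      rcases hm₂ with h | h
      · exact h.mono le_rfl le_rfl h.2.1
      · exact h.mono h.2.1 le_rfl le_rfl
    obtain ⟨n, hn, hgn⟩ := hsurj m ⟨hm₁, hmm, fun k hk hk0 hs => hm k hk ⟨hk0, hs.trans hm₂⟩⟩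
    refine ⟨n, hn, ?_⟩
    rw [hr', hgn]
    exact hm₂.symm

end Omniscient

/-! ### The intervals `(a n, b n)`: endpoints, disjointness, covering. -/

section Components

variable {f : M.D (.fn .seq .seq)} {l : M.D (.fn .nat .nat)} {r : M.D (.fn .nat .rat)}
  {a b : M.D (.fn .nat .seq)} (h : Components f l r a b) {n : M.D .nat}
  (hn : M.app l n = M.zero)
include h hn

/-- Otherwise the interval excluded in the choice of `a n` would be part of a shaded one. Applied to
another term of `a n`, this is regularity. -/
theorem Components.left_lt {q : M.D .rat} (hq : Shaded f q (M.app r n)) (k : M.D .nat) :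
    M.app (M.app a n) k - unit k < q := by
  obtain ⟨⟨h₁, h₂⟩, -⟩ := (h.2.1 n hn).2 k
  by_contra hlt
  exact h₂ (hq.mono (not_lt.1 hlt) (by linarith [h₁.2.1, unit_pos k]) le_rfl)

theorem Components.lt_right {q : M.D .rat} (hq : Shaded f (M.app r n) q) (k : M.D .nat) :
    q < M.app (M.app b n) k + unit k := by
  obtain ⟨-, h₁, h₂⟩ := (h.2.1 n hn).2 k
  by_contra hlt
  exact h₂ (hq.mono le_rfl (by linarith [h₁.2.1, unit_pos k]) (not_lt.1 hlt))

theorem Components.shaded : Shaded f (M.app r n) (M.app r n) := by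
  obtain ⟨⟨h₁, -⟩, -⟩ := (h.2.1 n hn).2 M.zero
  exact h₁.mono h₁.2.1 le_rfl le_rfl

theorem Components.inUnit_left : InUnit (M.app a n) := by
  have hs := fun k => ((h.2.1 n hn).2 k).1.1
  refine ⟨fun i j => by linarith [h.left_lt hn (hs j) i, unit_pos j], fun k => ?_, fun k => ?_⟩
  · linarith [(hs k).1, unit_pos k]
  · linarith [(hs k).2.1, (hs k).lt_one, unit_pos k]

theorem Components.inUnit_right : InUnit (M.app b n) := by
  have hs := fun k => ((h.2.1 n hn).2 k).2.1
  refine ⟨fun i j => by linarith [h.lt_right hn (hs i) j, unit_pos i], fun k => ?_, fun k => ?_⟩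
  · linarith [(hs k).1, (hs k).2.1, unit_pos k]
  · linarith [(hs k).lt_one, unit_pos k]

theorem Components.inIoo_of_shaded {x : M.D .seq} (hx : IsReal x) {p q : M.D .rat}
    (hp : Shaded f p (M.app r n)) (hq : Shaded f (M.app r n) q) (hpx : RLt (const p) x)
    (hxq : RLt x (const q)) : InIoo (M.app a n) (M.app b n) x := by
  obtain ⟨i, hi⟩ := hpx.exists_lower
  obtain ⟨j, hj⟩ := hxq.exists_upper
  obtain ⟨k, hk⟩ := exists_unit_lt' (M := M) (ε := (M.app x i - unit i - p) / 2) (by linarith)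
  obtain ⟨m, hm⟩ := exists_unit_lt' (M := M) (ε := (q - (M.app x j + unit j)) / 2) (by linarith)
  exact ⟨hx, .of_lt (h.inUnit_left hn).1 hx (i := k) (j := i) (by linarith [h.left_lt hn hp k]),
    .of_lt hx (h.inUnit_right hn).1 (i := j) (j := m) (by linarith [h.lt_right hn hq m])⟩

theorem Components.exists_shaded {x : M.D .seq} (hx : InIoo (M.app a n) (M.app b n) x) :
    ∃ p q, Shaded f p (M.app r n) ∧ Shaded f (M.app r n) q ∧ RLt (const p) x ∧
      RLt x (const q) := by
  obtain ⟨hx, ⟨i, hi⟩, ⟨j, hj⟩⟩ := hx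
  exact ⟨_, _, ((h.2.1 n hn).2 i).1.1, ((h.2.1 n hn).2 j).2.1,
    .const_of_lt hx (j := i) (by linarith [unit_pos i]),
    .of_lt_const hx (i := j) (by linarith [unit_pos j])⟩

/-- The representative is a point of the shadow, so a shaded interval surrounds it and extends the
component strictly to both sides. -/
theorem Components.exists_inIoo (hf : Cont f) :
    InIoo (M.app a n) (M.app b n) (const (M.app r n)) := by
  have hs := h.shaded hn
  have h0 := (h.2.1 n hn).1
  obtain ⟨-, -, y, c, k, h₃, h₄, h₅, h₆⟩ := id hs
  have hr := inUnit_const h0.le hs.lt_one.le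
  have hy := inUnit_const (h0.le.trans h₃.le) h₄
  have hlt : ∀ {p q : M.D .rat}, p < q → RLt (const p) (const q) := fun {p q} hpq => by
    obtain ⟨j, hj⟩ := exists_unit_lt' (M := M) (ε := q - p) (by linarith)
    exact .const_of_lt (isReal_const q) (j := j) (by rw [app_const]; linarith)
  have hsh : InShadow f (const (M.app r n)) := by
    refine ⟨hr, const y, hy, hlt h₃, ?_⟩
    obtain ⟨j, hj⟩ := exists_unit_lt' (M := M)
      (ε := (M.app (M.app f (const y)) k - unit k - c) / 2) (by linarith)
    exact .of_lt (hf.isReal hr) (hf.isReal hy) (i := j) (j := k)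
      (by linarith [h₆ _ le_rfl le_rfl j])
  obtain ⟨p, q, hp, hq, hpq⟩ := hf.exists_shaded hsh (hlt h0) (hlt hs.lt_one)
  have hp' : p ≤ M.app r n := by
    obtain ⟨j, hj⟩ := hp
    simp only [app_const] at hj
    linarith [unit_pos j]
  have hq' : M.app r n ≤ q := by
    obtain ⟨j, hj⟩ := hq
    simp only [app_const] at hj
    linarith [unit_pos j]
  exact h.inIoo_of_shaded hn (isReal_const _) (hpq.mono le_rfl hp' hq') (hpq.mono hp' hq' le_rfl)
    hp hq

-- Whatever part of `[s, t]` is not in `[s, q]` belongs to `[p, t]`. This joins representatives on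
-- the two sides of a common point.
omit h hn in
theorem Shaded.of_overlap {p q s t : M.D .rat} (h : Shaded f s q) (h' : Shaded f p t)
    (hpq : p ≤ q) (hst : s ≤ t) : Shaded f s t := by
  rcases le_total t q with htq | htq
  · exact h.mono le_rfl hst htq
  · rcases le_total p s with hps | hps
    · exact h'.mono hps hst le_rfl
    · exact h.glue h' hps hpq htq

omit h hn in
theorem RLt.le_of_const {x : M.D .seq} {p q : M.D .rat} (hx : IsReal x) (hp : RLt (const p) x)
    (hq : RLt x (const q)) : p < q := by
  obtain ⟨i, hi⟩ := hp.exists_lower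
  obtain ⟨j, hj⟩ := hq.exists_upper
  linarith [hx.lower_le_upper j i]

/-- Around a common point, the shaded intervals reaching to the two representatives overlap, so they
join representatives that are supposed to be separate. -/
theorem Components.disjoint {m : M.D .nat} (hm : M.app l m = M.zero) (hnm : n ≠ m) {x : M.D .seq}
    (hx : InIoo (M.app a n) (M.app b n) x) (hx' : InIoo (M.app a m) (M.app b m) x) : False := by
  obtain ⟨p, q, h₁, h₂, h₃, h₄⟩ := h.exists_shaded hn hx
  obtain ⟨p', q', h₁', h₂', h₃', h₄'⟩ := h.exists_shaded hm hx'
  rcases le_total (M.app r n) (M.app r m) with hr | hr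
  · exact h.2.2.1 n m hn hm hnm (h₂.of_overlap h₁' (h₃'.le_of_const hx.1 h₄).le hr)
  · exact h.2.2.1 m n hm hn hnm.symm (h₂'.of_overlap h₁ (h₃.le_of_const hx.1 h₄').le hr)

theorem Components.inShadow (hf : Cont f) {x : M.D .seq}
    (hx : InIoo (M.app a n) (M.app b n) x) :
    InShadow f x ∧ RLt (const 0) x ∧ RLt x (const 1) := by
  obtain ⟨p, q, h₁, h₂, h₃, h₄⟩ := h.exists_shaded hn hx
  exact hf.inShadow hx.1 (h₁.glue h₂ h₁.2.1 le_rfl h₂.2.1) h₃ h₄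

omit hn in
theorem Components.cover (hf : Cont f) {x : M.D .seq} (hx : InShadow f x)
    (h0 : RLt (const 0) x) (h1 : RLt x (const 1)) :
    ∃ n, M.app l n = M.zero ∧ InIoo (M.app a n) (M.app b n) x := by
  obtain ⟨p, q, hp, hq, hpq⟩ := hf.exists_shaded hx h0 h1
  have hxr := hx.1.1
  have hlt := hp.le_of_const hxr hq
  -- A rational strictly above `p` is positive, as required for finding its representative.
  obtain ⟨s, hps, hsq⟩ := exists_between hlt
  obtain ⟨n, hn, hs⟩ := h.2.2.2 s (hpq.1.trans_lt hps) (hpq.mono hps.le le_rfl hsq.le)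
  have hss := h.shaded hn
  refine ⟨n, hn, ?_⟩
  rcases hs with hs | hs
  · have hsr := hs.2.1
    have hleft := hpq.of_overlap hs hsq.le (hps.le.trans hsr)
    rcases le_total (M.app r n) q with hrq | hrq
    · exact h.inIoo_of_shaded hn hxr hleft (hpq.mono (hps.le.trans hsr) hrq le_rfl) hp hq
    · obtain ⟨i, hi⟩ := hq.exists_upper
      exact h.inIoo_of_shaded hn hxr hleft hss hp (.of_lt_const hxr (i := i) (by linarith))
  · have hrs := hs.2.1
    have hright := hs.of_overlap hpq hps.le (hrs.trans hsq.le)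
    rcases le_total p (M.app r n) with hpr | hpr
    · exact h.inIoo_of_shaded hn hxr (hpq.mono le_rfl hpr (hrs.trans hsq.le)) hright hp hq
    · obtain ⟨i, hi⟩ := hp.exists_lower
      exact h.inIoo_of_shaded hn hxr hss hright (.const_of_lt hxr (j := i) (by linarith)) hq

end Components
end PrimeModel
end Bish

/-! ### Derivation of the Rising Sun Lemma from LPO. -/

namespace Bish

open PrimeModel

/-- The hypotheses from which the conclusion of the Rising Sun Lemma is derived, for `v3` the
function, `v2` the index sequence, and `v1`, `v0` the endpoints. -/
def familyHyps : List (Fm [.fn .nat .seq, .fn .nat .seq, .fn .nat .nat, .fn .seq .seq]) :=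
  [lpo, isCont v3, .ex (.fn .nat .rat) (components v4 v3 v0 v2 v1)]

theorem Env.exists_four {D : Ty → Type} {σ τ υ χ : Ty} (e : Env D [σ, τ, υ, χ]) :
    ∃ w x y z, e = Env.cons w (Env.cons x (Env.cons y (Env.cons z Env.nil))) := by
  obtain ⟨w, e, rfl⟩ := e.exists_cons
  obtain ⟨x, e, rfl⟩ := e.exists_cons
  obtain ⟨y, e, rfl⟩ := e.exists_cons
  obtain ⟨z, e, rfl⟩ := e.exists_cons
  refine ⟨w, x, y, z, ?_⟩
  rw [show e = Env.nil from funext fun _ => funext fun x => nomatch x]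

theorem familyHyps_iff {M : PrimeModel} (b a : M.D (.fn .nat .seq)) (l : M.D (.fn .nat .nat))
    (f : M.D (.fn .seq .seq)) (h : M.Holds familyHyps
      (Env.cons b (Env.cons a (Env.cons l (Env.cons f Env.nil))))) :
    M.Omniscient ∧ Cont f ∧ ∃ r, Components f l r a b := by
  simp only [familyHyps, Holds_cons, holds_lpo_iff, Holds_nil, and_true] at h
  obtain ⟨h₁, h₂, h₃⟩ := h
  refine ⟨h₁, by simpa using Cont.of_holds h₂, ?_⟩
  rw [holds_ex] at h₃
  obtain ⟨r, h₃⟩ := h₃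
  exact ⟨r, by simpa [holds_components] using h₃⟩

/-- The clauses quantify over real points, so they are not arithmetical and cannot be evaluated in
one model. The introduction rules are applied with the family as variables, and the remaining goals
are checked in all models of `familyHyps`. -/
theorem prf_isIntervalFamily : Prf familyHyps (isIntervalFamily v2 v1 v0) := by
  refine .andI ?_ (.andI (.allI (.impI (.andI ?_ (.andI ?_ (.impI ?_)))))
    (.allI (.allI (.impI (.impI (.impI (.allI (.impI ?_))))))))
  · refine .of_models fun M e h => ?_
    obtain ⟨b, a, l, f, rfl⟩ := e.exists_four
    obtain ⟨_, hf, r, hc⟩ := familyHyps_iff b a l f h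
    simpa [isIncreasingBinary, isBinary, holds_all, holds_imp] using hc.1
  · refine .of_models fun M e h => ?_
    obtain ⟨n, e, rfl⟩ := e.exists_cons
    obtain ⟨b, a, l, f, rfl⟩ := e.exists_four
    rw [List.forall_mem_cons] at h
    obtain ⟨_, hf, r, hc⟩ := familyHyps_iff b a l f ((Holds_map_wk M _ _ _).1 h.2)
    simpa [holds_inUnit] using hc.inUnit_left (by simpa using h.1)
  · refine .of_models fun M e h => ?_
    obtain ⟨n, e, rfl⟩ := e.exists_cons
    obtain ⟨b, a, l, f, rfl⟩ := e.exists_four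
    rw [List.forall_mem_cons] at h
    obtain ⟨_, hf, r, hc⟩ := familyHyps_iff b a l f ((Holds_map_wk M _ _ _).1 h.2)
    simpa [holds_inUnit] using hc.inUnit_right (by simpa using h.1)
  · refine .of_models fun M e h => ?_
    obtain ⟨n, e, rfl⟩ := e.exists_cons
    obtain ⟨b, a, l, f, rfl⟩ := e.exists_four
    rw [List.forall_mem_cons, List.forall_mem_cons] at h
    obtain ⟨_, hf, r, hc⟩ := familyHyps_iff b a l f ((Holds_map_wk M _ _ _).1 h.2.2)
    have := hc.exists_inIoo (n := n) (by simpa using h.2.1) hf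
    exact (not_of_neg (all_at h.1 (const (M.app r n))) (by simpa [holds_inIoo] using this)).elim
  · refine .of_models fun M e h => ?_
    obtain ⟨x, e, rfl⟩ := e.exists_cons
    obtain ⟨m, e, rfl⟩ := e.exists_cons
    obtain ⟨n, e, rfl⟩ := e.exists_cons
    obtain ⟨b, a, l, f, rfl⟩ := e.exists_four
    rw [List.forall_mem_cons] at h
    obtain ⟨hx, h⟩ := h
    have h := (Holds_map_wk M _ _ _).1 h
    simp only [Holds_cons] at h
    obtain ⟨hnm, hm, hn, h⟩ := h
    obtain ⟨_, hf, r, hc⟩ := familyHyps_iff b a l f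
      ((Holds_map_wk M _ _ _).1 ((Holds_map_wk M _ _ _).1 h))
    simp only [holds_and, holds_inIoo, holds_ne_nat, holds_eq, eval_app, eval_wk, eval_var,
      Env.cons_zero, Env.cons_succ, eval_zero] at hx hnm hm hn
    exact (hc.disjoint hn hm hnm hx.1 hx.2).elim

theorem prf_union : Prf familyHyps (.all .seq (Fm.iff
    (.and (inShadow v4 v0) (inIoo (rConst .qzero) (rConst .qone) v0))
    (.ex .nat (.and (.eq (.app v4 v0) .zero) (inIoo (.app v3 v0) (.app v2 v0) v1))))) := by
  refine .allI (.andI (.impI ?_) (.impI ?_))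
  · refine .of_models fun M e h => ?_
    obtain ⟨x, e, rfl⟩ := e.exists_cons
    obtain ⟨b, a, l, f, rfl⟩ := e.exists_four
    rw [List.forall_mem_cons] at h
    obtain ⟨_, hf, r, hc⟩ := familyHyps_iff b a l f ((Holds_map_wk M _ _ _).1 h.2)
    have hx := h.1
    simp only [holds_and, holds_inShadow, holds_inIoo, eval_var, Env.cons_zero, Env.cons_succ,
      eval_rConst, eval_qzero, eval_qone] at hx
    simpa [holds_inIoo] using hc.cover hf hx.1 hx.2.2.1 hx.2.2.2
  · refine .of_models fun M e h => ?_
    obtain ⟨x, e, rfl⟩ := e.exists_cons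
    obtain ⟨b, a, l, f, rfl⟩ := e.exists_four
    rw [List.forall_mem_cons] at h
    obtain ⟨_, hf, r, hc⟩ := familyHyps_iff b a l f ((Holds_map_wk M _ _ _).1 h.2)
    have hx := h.1
    simp only [holds_ex, holds_and, holds_inIoo, holds_eq, eval_app, eval_var, Env.cons_zero,
      Env.cons_succ, eval_zero] at hx
    obtain ⟨n, hn, hx⟩ := hx
    have := hc.inShadow hn hf hx
    simpa [holds_inShadow, holds_inIoo] using ⟨this.1, hx.1, this.2⟩

/-- The limited principle of omniscience implies the Rising Sun Lemma. -/
theorem prf_risingSun_of_LPO : Prf [LPO] RisingSun := by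
  refine .allI (.impI (.of_models fun M e h => ?_))
  simp only [List.map_cons, List.map_nil, List.forall_mem_cons] at h
  obtain ⟨hf, hlpo, -⟩ := h
  have : M.Omniscient := (holds_lpo_iff e).1 hlpo
  obtain ⟨f, e, rfl⟩ := e.exists_cons
  obtain ⟨l, r, a, b, hc⟩ := exists_components f
  -- The family found in `M` satisfies the hypotheses there, so the two derivations apply to it by
  -- soundness.
  have key : M.Holds familyHyps (Env.cons b (Env.cons a (Env.cons l (Env.cons f e)))) := by
    simp only [familyHyps, Holds_cons, holds_lpo, Holds_nil, and_true, true_and]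
    refine ⟨?_, ?_⟩
    · exact (M.holds_wk _ b _).2 ((M.holds_wk _ a _).2 ((M.holds_wk _ l _).2 hf))
    · rw [holds_ex]
      exact ⟨r, by simpa [holds_components] using hc⟩
  simp only [holds_ex]
  exact ⟨l, a, b, (holds_and _ _ _).2
    ⟨M.sound prf_isIntervalFamily key, M.sound prf_union key⟩⟩

end Bish

namespace Bish

/-! ### The first one of a binary sequence, and a linear function -/

/-- The recursion step for `firstOne`: keep a positive value, replace the value `0`. -/
def firstOneStep {Γ : Ctx} (l : Tm Γ (.fn .nat .nat)) : Tm Γ (.fn .nat (.fn .rat .rat)) :=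
  .lam (.lam (.natRec v0 (.lam (.lam
    (.qmul (natCast (.app l.wk.wk.wk.wk (.succ v3)))
      (.qmul (unitFrac (.succ v3)) (unitFrac (.succ .one)))))) (.qle v0 .qzero)))

/-- A binary sequence `l` turned into a sequence of rationals: the value is `0` up to the first `m`
with `l m = 1`, and constantly `1 / (3 (m + 1))` from then on. -/
def firstOne {Γ : Ctx} (l : Tm Γ (.fn .nat .nat)) : Tm Γ .seq :=
  .lam (.natRec (.qmul (natCast (.app l.wk .zero)) (unitFrac (.succ .one))) (firstOneStep l).wk v0)

/-- The function `x ↦ s x`, for `s` the real number `firstOne l`. -/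
def linearFn {Γ : Ctx} (l : Tm Γ (.fn .nat .nat)) : Tm Γ (.fn .seq .seq) :=
  .lam (.lam (.qmul (.app (firstOne l).wk.wk v0) (.app v1 v0)))

namespace PrimeModel

variable {M : PrimeModel} {Δ : Ctx}

theorem unit_succ_one : unit (M.succ M.one) = (1 / 3 : M.D .rat) := by
  rw [unit, cast_succ, cast_one]; norm_num

theorem app_firstOne_zero (l : Tm Δ (.fn .nat .nat)) (e : Env M.D Δ) :
    M.app (M.eval (firstOne l) e) M.zero = M.cast (M.app (M.eval l e) M.zero) * (1 / 3) := by
  simp [firstOne, unit_succ_one]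

theorem app_firstOne_succ (l : Tm Δ (.fn .nat .nat)) (e : Env M.D Δ) (n : M.D .nat) :
    M.app (M.eval (firstOne l) e) (M.succ n) =
      M.app (M.app (M.eval (firstOneStep l) e) n) (M.app (M.eval (firstOne l) e) n) := by
  simp [firstOne]

theorem app_firstOne_succ_of_pos {l : Tm Δ (.fn .nat .nat)} {e : Env M.D Δ} {n : M.D .nat}
    (h : 0 < M.app (M.eval (firstOne l) e) n) :
    M.app (M.eval (firstOne l) e) (M.succ n) = M.app (M.eval (firstOne l) e) n := by
  rw [← not_le, ← qleChar_eq_zero_iff] at h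
  rw [app_firstOne_succ]
  simp [firstOneStep, h]

theorem app_firstOne_succ_of_nonpos {l : Tm Δ (.fn .nat .nat)} {e : Env M.D Δ} {n : M.D .nat}
    (h : M.app (M.eval (firstOne l) e) n ≤ 0) :
    M.app (M.eval (firstOne l) e) (M.succ n) =
      M.cast (M.app (M.eval l e) (M.succ n)) * (unit (M.succ n) * (1 / 3)) := by
  rw [← qleChar_eq_one_iff] at h
  rw [app_firstOne_succ]
  simp [firstOneStep, h, unit_succ_one]

/-- What is used about the sequence `s` built from the binary sequence `l`. -/
structure IsFirstOne (l : M.D (.fn .nat .nat)) (s : M.D .seq) : Prop where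
  nonneg : ∀ n, 0 ≤ M.app s n
  le_third : ∀ n, M.app s n ≤ 1 / 3
  regular : ∀ m n, M.app s m ≤ M.app s n + (unit m + unit n) / 3
  stable : ∀ m n, 0 < M.app s m → M.cast m ≤ M.cast n → M.app s n = M.app s m
  pos : ∀ n, M.app l n = M.one → 0 < M.app s n
  exists_of_pos : ∀ n, 0 < M.app s n → ∃ m, M.app l m = M.one

theorem binary_of_holds {l : Tm Δ (.fn .nat .nat)} {e : Env M.D Δ} (h : M.holds (isBinary l) e)
    (n : M.D .nat) : M.app (M.eval l e) n = M.zero ∨ M.app (M.eval l e) n = M.one := by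
  simpa using all_at h n

/-- By induction on `k`: either nothing changes after `i`, or the value at `i` was not yet positive
and a change occurs at some later m, to 1/(3(m+1)). Regularity and stability of the sequence both
come from this. -/
theorem firstOne_add {e : Env M.D Δ} {l : Tm Δ (.fn .nat .nat)} (h : M.holds (isBinary l) e)
    (i k : M.D .nat) : M.app (M.eval (firstOne l) e) (add i k) = M.app (M.eval (firstOne l) e) i ∨
      M.app (M.eval (firstOne l) e) i ≤ 0 ∧ 0 ≤ M.app (M.eval (firstOne l) e) (add i k) ∧
      M.app (M.eval (firstOne l) e) (add i k) ≤ unit i / 3 := by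
  have := all_at (all_nat_of (M := M) (e := Env.cons i e) (φ := .or
    (.eq (.app (firstOne l).wk.wk (natAdd v1 v0)) (.app (firstOne l).wk.wk v1))
    (.and (qLe (.app (firstOne l).wk.wk v1) .qzero)
      (.and (qLe .qzero (.app (firstOne l).wk.wk (natAdd v1 v0)))
        (qLe (.app (firstOne l).wk.wk (natAdd v1 v0)) (.qmul (unitFrac v1)
          (unitFrac (.succ .one))))))) [(isBinary l).wk] (by simpa) ?_ ?_) k
  · simpa [unit_succ_one, div_eq_mul_inv] using this
  · simp
  · intro M' e' n hH h
    obtain ⟨i, e', rfl⟩ := e'.exists_cons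
    simp only [Holds_cons, holds_wk, Holds_nil, and_true] at hH
    simp only [holds_or, holds_and, holds_eq, holds_qLe, eval_app, eval_wk, eval_natAdd, eval_var,
      Env.cons_zero, Env.cons_succ, eval_qzero, eval_qmul, eval_unitFrac, eval_succ, eval_one,
      unit_succ_one, add_succ] at h ⊢
    rcases le_or_gt (M'.app (M'.eval (firstOne l) e') (add i n)) 0 with h₀ | h₀
    · right
      have h₁ : M'.app (M'.eval (firstOne l) e') i ≤ 0 := h.elim (fun h => h ▸ h₀) (·.1)
      have h₂ : unit (M'.succ (add i n)) ≤ unit i := unit_anti (by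
        rw [cast_succ, cast_add]; linarith [cast_nonneg n])
      have h₃ := unit_pos (M'.succ (add i n))
      rw [app_firstOne_succ_of_nonpos h₀]
      refine ⟨h₁, ?_⟩
      rcases binary_of_holds hH (M'.succ (add i n)) with h | h <;>
        rw [h] <;> simp only [cast_zero, cast_one] <;> constructor <;> linarith
    · rw [app_firstOne_succ_of_pos h₀]
      exact h

theorem isFirstOne {e : Env M.D Δ} {l : Tm Δ (.fn .nat .nat)} (h : M.holds (isBinary l) e) :
    IsFirstOne (M.eval l e) (M.eval (firstOne l) e) := by
  have hz : 0 ≤ M.app (M.eval (firstOne l) e) M.zero ∧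
      M.app (M.eval (firstOne l) e) M.zero ≤ 1 / 3 := by
    rw [app_firstOne_zero]
    rcases binary_of_holds h M.zero with h | h <;> rw [h] <;> norm_num
  have hn : ∀ n, 0 ≤ M.app (M.eval (firstOne l) e) n ∧ M.app (M.eval (firstOne l) e) n ≤ 1 / 3 := by
    intro n
    have := firstOne_add h M.zero n
    rw [zero_add] at this
    rcases this with h | ⟨-, h₁, h₂⟩
    · rwa [h]
    · exact ⟨h₁, by linarith [unit_le_one M.zero]⟩
  refine ⟨fun n => (hn n).1, fun n => (hn n).2, fun m n => ?_, fun m n hm hmn => ?_, fun n hl => ?_,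
    fun n hs => ?_⟩
  · have := unit_pos m
    have := unit_pos n
    have := hn m
    have := hn n
    obtain ⟨k, rfl | rfl⟩ := exists_add m n
    · rcases firstOne_add h m k with h | h <;> linarith
    · rcases firstOne_add h n k with h | h <;> linarith
  · obtain ⟨k, rfl | rfl⟩ := exists_add m n
    · rcases firstOne_add h m k with h | h
      · exact h
      · linarith
    · have hk : k = M.zero := cast_injective (by
        rw [cast_add] at hmn
        rw [cast_zero]
        linarith [cast_nonneg k])
      rw [hk, add_zero]
  · rcases nat_cases n with rfl | ⟨n, rfl⟩
    · rw [app_firstOne_zero, hl, cast_one]; norm_num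
    · rcases le_or_gt (M.app (M.eval (firstOne l) e) n) 0 with h₀ | h₀
      · rw [app_firstOne_succ_of_nonpos h₀, hl, cast_one]
        linarith [unit_pos (M.succ n)]
      · rwa [app_firstOne_succ_of_pos h₀]
  · have := all_at (all_nat_of (M := M) (e := e) (φ := .or
      (qLe (.app (firstOne l).wk v0) .qzero) (.ex .nat (.eq (.app l.wk.wk v0) .one)))
      [isBinary l] (by simpa) (fun M' e' hH => ?_) fun M' e' n hH h => ?_) n
    · simp only [holds_or, holds_qLe, holds_ex, holds_eq, eval_app, eval_wk, eval_var,
        Env.cons_zero, eval_qzero, eval_one] at this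
      exact this.resolve_left hs.not_ge
    · simp only [Holds_cons, Holds_nil, and_true] at hH
      simp only [holds_or, holds_qLe, holds_ex, holds_eq, eval_app, eval_wk, eval_var,
        Env.cons_zero, eval_qzero, eval_one]
      rcases binary_of_holds hH M'.zero with h | h
      · exact .inl (by rw [app_firstOne_zero, h]; simp)
      · exact .inr ⟨_, h⟩
    · simp only [Holds_cons, Holds_nil, and_true] at hH
      simp only [holds_or, holds_qLe, holds_ex, holds_eq, eval_app, eval_wk, eval_var,
        Env.cons_zero, eval_qzero, eval_one] at h ⊢
      rcases h with h₀ | h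
      · rcases binary_of_holds hH (M'.succ n) with h | h
        · exact .inl (by rw [app_firstOne_succ_of_nonpos h₀, h]; simp)
        · exact .inr ⟨_, h⟩
      · exact .inr h

@[simp] theorem app_linearFn (l : Tm Δ (.fn .nat .nat)) (e : Env M.D Δ) (x : M.D .seq)
    (n : M.D .nat) : M.app (M.app (M.eval (linearFn l) e) x) n =
      M.app (M.eval (firstOne l) e) n * M.app x n := by
  simp [linearFn]

end PrimeModel
end Bish

namespace Bish

open PrimeModel

/-! ### Continuity of the linear function -/

/-- A slope of at most 1/3 does not enlarge the error `c`. -/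
theorem PrimeModel.IsFirstOne.mul_le {M : PrimeModel} {l : M.D (.fn .nat .nat)} {s : M.D .seq}
    (h : IsFirstOne l s) {a b c : M.D .rat} (n : M.D .nat) (hc : 0 ≤ c) (hab : a ≤ b + c) :
    M.app s n * a ≤ M.app s n * b + c := by
  have h₁ := mul_le_mul_of_nonneg_left hab (h.nonneg n)
  have h₂ := mul_le_mul_of_nonneg_right (h.le_third n) hc
  rw [mul_add] at h₁
  linarith

/-- This is what the factor 1/3 is for. Terms of `x` are at most 2 in absolute value, so the change
of `x` contributes a third of the allowed error and the change of `s` two thirds; the product is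
regular without reindexing. -/
theorem PrimeModel.IsFirstOne.isReal_mul {M : PrimeModel} {l : M.D (.fn .nat .nat)} {s : M.D .seq}
    (h : IsFirstOne l s) {x : M.D .seq} (hx : InUnit x) (m n : M.D .nat) :
    M.app s m * M.app x m ≤ M.app s n * M.app x n + (unit m + unit n) := by
  have h₀ := unit_pos m
  have h₀' := unit_pos n
  have h₁ : M.app s m * (M.app x m - M.app x n) ≤ 1 / 3 * (unit m + unit n) :=
    (mul_le_mul_of_nonneg_left (by linarith [hx.1 m n]) (h.nonneg m)).trans
      (mul_le_mul_of_nonneg_right (h.le_third m) (by linarith))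
  have h₂ : |M.app x n| ≤ 2 := abs_le.2
    ⟨by linarith [hx.nonneg n, unit_le_one n], by linarith [hx.le_one n, unit_le_one n]⟩
  have h₃ : |M.app s m - M.app s n| ≤ (unit m + unit n) / 3 := abs_le.2
    ⟨by linarith [h.regular n m], by linarith [h.regular m n]⟩
  have h₄ := (le_abs_self (M.app x n * (M.app s m - M.app s n))).trans_eq (abs_mul _ _)
  have h₅ := mul_le_mul h₂ h₃ (abs_nonneg _) (by norm_num)
  have h₆ : M.app s m * M.app x m - M.app s n * M.app x n =
    M.app s m * (M.app x m - M.app x n) + M.app x n * (M.app s m - M.app s n) := by ring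
  linarith

variable {Δ : Ctx}

theorem prf_isReal_linearFn (l : Tm Δ (.fn .nat .nat)) :
    Prf [isBinary l] (.all .seq (.imp (inUnit v0) (isReal (.app (linearFn l).wk v0)))) := by
  refine .allI (.impI (.allI (.allI (.of_models fun M e h => ?_))))
  obtain ⟨n, e, rfl⟩ := e.exists_cons
  obtain ⟨m, e, rfl⟩ := e.exists_cons
  obtain ⟨x, e, rfl⟩ := e.exists_cons
  simp only [List.map_cons, List.map_nil, List.forall_mem_cons, holds_wk] at h
  simpa using (isFirstOne h.2.1).isReal_mul (x := x) (by simpa using InUnit.of_holds h.1) m n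

theorem prf_linearFn_congr (l : Tm Δ (.fn .nat .nat)) :
    Prf [isBinary l] (.all .seq (.all .seq (.imp (inUnit v1) (.imp (inUnit v0)
      (.imp (rEq v1 v0)
        (rEq (.app (linearFn l).wk.wk v1) (.app (linearFn l).wk.wk v0))))))) := by
  refine .allI (.allI (.impI (.impI (.impI (.andI (.allI ?_) (.allI ?_))))))
  all_goals
    refine .of_models fun M e h => ?_
    obtain ⟨n, e, rfl⟩ := e.exists_cons
    obtain ⟨y, e, rfl⟩ := e.exists_cons
    obtain ⟨x, e, rfl⟩ := e.exists_cons
    simp only [List.map_cons, List.map_nil, List.forall_mem_cons, holds_wk, rEq, holds_and] at h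
    obtain ⟨⟨h₁, h₂⟩, -, -, hl, -⟩ := h
    have h₁ := all_at h₁ n
    have h₂ := all_at h₂ n
    simp only [holds_qLe, eval_app, eval_wk, eval_var, Env.cons_zero, Env.cons_succ, eval_qadd,
      eval_twoFrac, app_linearFn] at h₁ h₂ ⊢
    exact (isFirstOne hl).mul_le n (by linarith [unit_pos n]) (by assumption)

/-- As the slope is at most 1, `δ = ε` works. -/
theorem prf_linearFn_cont (l : Tm Δ (.fn .nat .nat)) :
    Prf [isBinary l] (.all .seq (.imp (inUnit v0)
      (.all .rat (.imp (qLt .qzero v0)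
        (.ex .rat (.and (qLt .qzero v0)
          (.all .seq (.imp (inUnit v0) (.imp (rClose v3 v0 v1)
            (rClose (.app (linearFn l).wk.wk.wk.wk v3)
              (.app (linearFn l).wk.wk.wk.wk v0) v2)))))))))) := by
  refine .allI (.impI (.allI (.impI (.of_models fun M e h => ?_))))
  obtain ⟨ε, e, rfl⟩ := e.exists_cons
  obtain ⟨x, e, rfl⟩ := e.exists_cons
  simp only [List.map_cons, List.map_nil, List.forall_mem_cons, holds_wk] at h
  obtain ⟨hε, -, hl, -⟩ := h
  rw [holds_ex]
  refine ⟨ε, (holds_and _ _ _).2 ⟨by simpa using hε, ?_⟩⟩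
  -- The rest quantifies over all reals and must be derived. The choice of `δ` is handed to the
  -- derivation as the equation of the two variables.
  refine M.sound (H := [.eq v0 v1, qLt .qzero v1, (isBinary l).wk.wk.wk])
    (.allI (.impI (.impI (.allI (.of_models fun M e h => ?_))))) ?_
  · obtain ⟨n, e, rfl⟩ := e.exists_cons
    obtain ⟨y, e, rfl⟩ := e.exists_cons
    obtain ⟨δ, e, rfl⟩ := e.exists_cons
    obtain ⟨ε, e, rfl⟩ := e.exists_cons
    obtain ⟨x, e, rfl⟩ := e.exists_cons
    simp only [List.map_cons, List.map_nil, List.forall_mem_cons, holds_wk, holds_eq, eval_var,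
      Env.cons_zero, Env.cons_succ, holds_qLt, eval_qzero] at h
    obtain ⟨hxy, -, rfl, hε, hl, -⟩ := h
    have hxy := all_at hxy n
    simp only [holds_and, holds_qLe, eval_app, eval_wk, eval_var, Env.cons_zero, Env.cons_succ,
      eval_qadd, eval_twoFrac, app_linearFn] at hxy ⊢
    have hc : 0 ≤ δ + 2 * unit n := by linarith [unit_pos n]
    exact ⟨(isFirstOne hl).mul_le n hc hxy.1, (isFirstOne hl).mul_le n hc hxy.2⟩
  · simpa [hl] using hε

theorem prf_isCont_linearFn (l : Tm Δ (.fn .nat .nat)) :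
    Prf [isBinary l] (isCont (linearFn l)) :=
  .andI (prf_isReal_linearFn l) (.andI (prf_linearFn_congr l) (prf_linearFn_cont l))

namespace PrimeModel

variable {M : PrimeModel}

/-- The formula for being a real number holds of `x`.  As a universal formula, it says more than
`IsReal x`. -/
def HoldsReal (x : M.D .seq) : Prop := M.holds (isReal v0) (Env.cons x Env.nil)

/-- The formula for being a point of the unit interval holds of `x`. -/
def HoldsUnit (x : M.D .seq) : Prop := M.holds (inUnit v0) (Env.cons x Env.nil)

/-- The truth of the formula depends on the term only through its value. -/
theorem holds_isReal_iff (x : Tm Δ .seq) (e : Env M.D Δ) :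
    M.holds (isReal x) e ↔ HoldsReal (M.eval x e) := by
  have : isReal x = (isReal v0).subst (Sub.cons x Sub.nil) := by
    simp only [isReal, qLe, Fm.subst, Tm.subst, Tm.wk_subst_lift]; rfl
  rw [this, M.holds_subst, eval_cons, eval_nil, HoldsReal]

theorem holds_inUnit_iff (x : Tm Δ .seq) (e : Env M.D Δ) :
    M.holds (inUnit x) e ↔ HoldsUnit (M.eval x e) := by
  have : inUnit x = (inUnit v0).subst (Sub.cons x Sub.nil) := by
    simp only [inUnit, isReal, rLe, qLe, Fm.subst, Tm.subst, Tm.wk_subst_lift]; rfl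
  rw [this, M.holds_subst, eval_cons, eval_nil, HoldsUnit]

theorem holds_isCont_iff (f : Tm Δ (.fn .seq .seq)) (e : Env M.D Δ) :
    M.holds (isCont f) e ↔ M.holds (isCont v0) (Env.cons (M.eval f e) Env.nil) := by
  have : isCont f = (isCont v0).subst (Sub.cons f Sub.nil) := by
    simp only [isCont, isReal, rLe, rEq, rClose, qLe, Fm.subst, Tm.subst, Tm.wk_subst_lift]; rfl
  rw [this, M.holds_subst, eval_cons, eval_nil]

theorem HoldsUnit.real {x : M.D .seq} (h : HoldsUnit x) : HoldsReal x :=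
  ((holds_and _ _ _).1 h).1

theorem HoldsReal.isReal {x : M.D .seq} (h : HoldsReal x) : IsReal x := by
  simpa using IsReal.of_holds h

theorem holdsUnit_const {q : M.D .rat} (h0 : 0 ≤ q) (h1 : q ≤ 1) : HoldsUnit (const q) := by
  have : M.holds (inUnit (rConst v0)) (Env.cons q Env.nil) := by
    refine M.sound (H := [qLe .qzero v0, qLe v0 .qone])
      (.andI (.allI (.allI ?_)) (.andI (.allI ?_) (.allI ?_))) (by simp [h0, h1])
    · refine .of_models fun M e h => ?_
      obtain ⟨n, e, rfl⟩ := e.exists_cons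
      obtain ⟨m, e, rfl⟩ := e.exists_cons
      simp only [holds_qLe, eval_app, eval_wk, eval_var, Env.cons_zero, Env.cons_succ, eval_qadd,
        eval_unitFrac, eval_rConst, app_const]
      linarith [unit_pos m, unit_pos n]
    all_goals
      refine .of_models fun M e h => ?_
      obtain ⟨n, e, rfl⟩ := e.exists_cons
      obtain ⟨q, e, rfl⟩ := e.exists_cons
      simp only [List.map_cons, List.map_nil, List.forall_mem_cons, holds_wk, holds_qLe, eval_app,
        eval_wk, eval_var, Env.cons_zero, eval_qadd, eval_twoFrac, eval_rConst, app_const,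
        eval_qzero, eval_qone] at h ⊢
      linarith [unit_pos n, h.1, h.2.1]
  rw [holds_inUnit_iff] at this
  simpa using this

theorem holdsReal_const (q : M.D .rat) : HoldsReal (const q) := by
  have : M.holds (isReal (rConst v0)) (Env.cons q Env.nil) := by
    refine M.sound (H := []) (.allI (.allI (.of_models fun M e h => ?_))) (by simp)
    obtain ⟨n, e, rfl⟩ := e.exists_cons
    obtain ⟨m, e, rfl⟩ := e.exists_cons
    simp only [holds_qLe, eval_app, eval_wk, eval_var, Env.cons_zero, Env.cons_succ, eval_qadd,
      eval_unitFrac, eval_rConst, app_const]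
    linarith [unit_pos m, unit_pos n]
  rw [holds_isReal_iff] at this
  simpa using this

/-! ### The intervals of the linear function -/

/-- The conclusion of the Rising Sun Lemma, in a prime model. -/
structure IsRisingSun (f : M.D (.fn .seq .seq)) (l : M.D (.fn .nat .nat))
    (a b : M.D (.fn .nat .seq)) : Prop where
  left : ∀ n, M.app l n = M.zero → HoldsUnit (M.app a n)
  right : ∀ n, M.app l n = M.zero → HoldsUnit (M.app b n)
  disjoint : ∀ m n, M.app l m = M.zero → M.app l n = M.zero → m ≠ n → ∀ x, HoldsReal x →
    RLt (M.app a m) x → RLt x (M.app b m) → RLt (M.app a n) x → ¬ RLt x (M.app b n)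
  cover : ∀ x, HoldsUnit x → (∃ y, HoldsUnit y ∧ RLt x y ∧ RLt (M.app f x) (M.app f y)) →
    RLt (const 0) x → RLt x (const 1) →
    ∃ n, M.app l n = M.zero ∧ RLt (M.app a n) x ∧ RLt x (M.app b n)
  sub : ∀ n x, M.app l n = M.zero → HoldsReal x → RLt (M.app a n) x → RLt x (M.app b n) →
    (∃ y, RLt (M.app f x) (M.app f y)) ∧ RLt (const 0) x ∧ RLt x (const 1)

theorem IsRisingSun.of_holds {Δ : Ctx} {e : Env M.D Δ} {f : M.D (.fn .seq .seq)}
    {l : M.D (.fn .nat .nat)} {a b : M.D (.fn .nat .seq)}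
    (h₁ : M.holds (isIntervalFamily v2 v1 v0)
      (Env.cons b (Env.cons a (Env.cons l (Env.cons f e)))))
    (h₂ : M.holds (.all .seq (Fm.iff
      (.and (inShadow v4 v0) (inIoo (rConst .qzero) (rConst .qone) v0))
      (.ex .nat (.and (.eq (.app v4 v0) .zero) (inIoo (.app v3 v0) (.app v2 v0) v1)))))
      (Env.cons b (Env.cons a (Env.cons l (Env.cons f e))))) :
    IsRisingSun f l a b := by
  simp only [isIntervalFamily, holds_and] at h₁
  obtain ⟨-, h₃, h₄⟩ := h₁
  have key : ∀ n, M.app l n = M.zero → HoldsUnit (M.app a n) ∧ HoldsUnit (M.app b n) := by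
    intro n hn
    have := imp_mp (all_at h₃ n) (by simpa using hn)
    rw [holds_and, holds_and, holds_inUnit_iff, holds_inUnit_iff] at this
    simpa using And.intro this.1 this.2.1
  refine ⟨fun n hn => (key n hn).1, fun n hn => (key n hn).2, ?_, ?_, ?_⟩
  · intro m n hm hn hmn x hx h₅ h₆ h₇ h₈
    have := not_of_neg (all_at (imp_mp (imp_mp (imp_mp (all_at (all_at h₄ m) n)
      (by simpa using hm)) (by simpa using hn)) (by simpa [holds_ne_nat] using hmn)) x)
    refine this ?_
    simp only [inIoo, holds_and, holds_isReal_iff, holds_rLt]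
    simpa using ⟨⟨hx, h₅, h₆⟩, hx, h₇, h₈⟩
  · intro x hx ⟨y, hy, hxy⟩ h₅ h₆
    have := imp_mp ((holds_and _ _ _).1 (all_at h₂ x)).1 (by
      simp only [inShadow, inIoo, holds_and, holds_ex, holds_inUnit_iff, holds_isReal_iff,
        holds_rLt]
      refine ⟨⟨by simpa using hx, y, by simpa using hy, by simpa using hxy⟩, ?_⟩
      simpa using ⟨hx.real, h₅, h₆⟩)
    simp only [inIoo, holds_and, holds_ex, holds_rLt] at this
    obtain ⟨n, h₇, -, h₈⟩ := this
    exact ⟨n, by simpa using h₇, by simpa using h₈⟩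
  · intro n x hn hx h₅ h₆
    have := imp_mp ((holds_and _ _ _).1 (all_at h₂ x)).2 (by
      simp only [inIoo, holds_and, holds_ex, holds_isReal_iff, holds_rLt]
      exact ⟨n, by simpa using hn, by simpa using hx, by simpa using h₅, by simpa using h₆⟩)
    simp only [inShadow, inIoo, holds_and, holds_ex, holds_rLt] at this
    obtain ⟨⟨-, y, -, -, h₇⟩, -, h₈⟩ := this
    exact ⟨⟨y, by simpa using h₇⟩, by simpa using h₈⟩

/-- At an index where `x` is separated from one of the others, the midpoint of the two terms is
beyond both enclosures. Taking the one of `y`, `z` with the smaller lower bound, it is below both.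
Such a rational is a common point of two intervals. -/
theorem RLt.exists_const_between_left {x y z : M.D .seq} (hx : IsReal x) (hy : IsReal y)
    (hz : IsReal z) (h : RLt x y) (h' : RLt x z) :
    ∃ q, RLt x (const q) ∧ RLt (const q) y ∧ RLt (const q) z := by
  obtain ⟨i, hi⟩ := h
  obtain ⟨j, hj⟩ := h'
  have h₁ := hx.lower_le_upper i j
  have h₂ := hx.lower_le_upper j i
  rcases le_total (M.app y i - unit i) (M.app z j - unit j) with h | h
  · refine ⟨(M.app x i + M.app y i) / 2, .of_lt_const hx (i := i) (by linarith),
      .const_of_lt hy (j := i) (by linarith), .const_of_lt hz (j := j) (by linarith)⟩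
  · refine ⟨(M.app x j + M.app z j) / 2, .of_lt_const hx (i := j) (by linarith),
      .const_of_lt hy (j := i) (by linarith), .const_of_lt hz (j := j) (by linarith)⟩

theorem RLt.exists_const_between_right {x y z : M.D .seq} (hx : IsReal x) (hy : IsReal y)
    (hz : IsReal z) (h : RLt y x) (h' : RLt z x) :
    ∃ q, RLt y (const q) ∧ RLt z (const q) ∧ RLt (const q) x := by
  obtain ⟨i, hi⟩ := h
  obtain ⟨j, hj⟩ := h'
  rcases le_total (M.app y i + unit i) (M.app z j + unit j) with h | h
  · refine ⟨(M.app z j + M.app x j) / 2, .of_lt_const hy (i := i) (by linarith),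
      .of_lt_const hz (i := j) (by linarith), .const_of_lt hx (j := j) (by linarith)⟩
  · refine ⟨(M.app y i + M.app x i) / 2, .of_lt_const hy (i := i) (by linarith),
      .of_lt_const hz (i := j) (by linarith), .const_of_lt hx (j := i) (by linarith)⟩

end PrimeModel
end Bish

namespace Bish
namespace PrimeModel

variable {M : PrimeModel} {α l : M.D (.fn .nat .nat)} {s : M.D .seq} {f : M.D (.fn .seq .seq)}
  {a b : M.D (.fn .nat .seq)}

theorem IsFirstOne.pos_of_rLt (hs : IsFirstOne α s)
    (hf : ∀ x n, M.app (M.app f x) n = M.app s n * M.app x n) {x y : M.D .seq}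
    (h : RLt (M.app f x) (M.app f y)) : ∃ n, 0 < M.app s n := by
  obtain ⟨n, hn⟩ := h
  refine ⟨n, (hs.nonneg n).lt_of_ne fun h => ?_⟩
  rw [hf, hf, ← h] at hn
  linarith [unit_pos n]

/-- If the slope is positive, then the function is greater at `1` than at any `x < 1`. -/
theorem IsFirstOne.rLt_one (hs : IsFirstOne α s)
    (hf : ∀ x n, M.app (M.app f x) n = M.app s n * M.app x n) {x : M.D .seq} (hx : IsReal x)
    (h1 : RLt x (const 1)) {n : M.D .nat} (hn : 0 < M.app s n) :
    RLt (M.app f x) (M.app f (const 1)) := by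
  obtain ⟨i, hi⟩ := h1.exists_upper
  have hg := mul_pos hn (sub_pos.2 hi)
  -- The slack in the order costs two units and the error of `x`, multiplied by a slope of at most
  -- 1/3, a third of one; three suffice. Since `k` is beyond `n`, the slope has its final value.
  obtain ⟨k, hk, hu⟩ := exists_unit_lt (M := M)
    (ε := M.app s n * (1 - (M.app x i + unit i)) / 3) (by linarith) n
  refine ⟨k, ?_⟩
  rw [hf, hf, app_const, hs.stable n k hn hk]
  have h₁ := mul_le_mul_of_nonneg_left (hx k i) hn.le
  have h₂ := mul_le_mul_of_nonneg_right (hs.le_third n) (unit_pos k).le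
  have := unit_pos k
  linarith

variable (hs : IsFirstOne α s) (hf : ∀ x n, M.app (M.app f x) n = M.app s n * M.app x n)
  (hI : IsRisingSun f l a b)

include hs hf hI

theorem IsRisingSun.exists_interval {n : M.D .nat} (hn : 0 < M.app s n) {x : M.D .seq}
    (hx : HoldsUnit x) (h0 : RLt (const 0) x) (h1 : RLt x (const 1)) :
    ∃ n, M.app l n = M.zero ∧ RLt (M.app a n) x ∧ RLt x (M.app b n) :=
  hI.cover x hx ⟨const 1, holdsUnit_const zero_le_one le_rfl, h1,
    hs.rLt_one hf hx.real.isReal h1 hn⟩ h0 h1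

/-- If an interval has a point, then its left endpoint is `0`. -/
theorem IsRisingSun.not_zero_rLt {n : M.D .nat} (hn : M.app l n = M.zero) {x : M.D .seq}
    (hx : HoldsReal x) (ha : RLt (M.app a n) x) (hb : RLt x (M.app b n)) :
    ¬ RLt (const 0) (M.app a n) := fun h => by
  obtain ⟨⟨y, hy⟩, -, h1⟩ := hI.sub n x hn hx ha hb
  obtain ⟨k, hk⟩ := hs.pos_of_rLt hf hy
  have hx' := hx.isReal
  have ha' := (hI.left n hn).real.isReal
  have hb' := (hI.right n hn).real.isReal
  -- With a positive slope, the left endpoint, if positive, is itself a point of the shadow, so it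
  -- lies in some interval. That one differs from the given interval and meets it just to the right
  -- of the endpoint.
  obtain ⟨m, hm, h₁, h₂⟩ := hI.exists_interval hs hf hk (hI.left n hn) h
    (ha.trans ha' hx' (isReal_const 1) h1)
  obtain ⟨q, hq, hq₁, hq₂⟩ := RLt.exists_const_between_left ha' hb' (hI.right m hm).real.isReal
    (ha.trans ha' hx' hb' hb) h₂
  refine hI.disjoint n m hn hm ?_ (const q) (holdsReal_const q) hq hq₁
    (h₁.trans (hI.left m hm).real.isReal ha' (isReal_const q) hq) hq₂
  rintro rfl
  exact RLt.irrefl h₁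

/-- If an interval has a point, then its right endpoint is `1`. -/
theorem IsRisingSun.not_rLt_one {n : M.D .nat} (hn : M.app l n = M.zero) {x : M.D .seq}
    (hx : HoldsReal x) (ha : RLt (M.app a n) x) (hb : RLt x (M.app b n)) :
    ¬ RLt (M.app b n) (const 1) := fun h => by
  obtain ⟨⟨y, hy⟩, h0, -⟩ := hI.sub n x hn hx ha hb
  obtain ⟨k, hk⟩ := hs.pos_of_rLt hf hy
  have hx' := hx.isReal
  have ha' := (hI.left n hn).real.isReal
  have hb' := (hI.right n hn).real.isReal
  obtain ⟨m, hm, h₁, h₂⟩ := hI.exists_interval hs hf hk (hI.right n hn)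
    (h0.trans (isReal_const 0) hx' hb' hb) h
  obtain ⟨q, hq₁, hq₂, hq⟩ := RLt.exists_const_between_right hb' ha' (hI.left m hm).real.isReal
    (ha.trans ha' hx' hb' hb) h₁
  refine hI.disjoint n m hn hm ?_ (const q) (holdsReal_const q) hq₁ hq hq₂
    (hq.trans (isReal_const q) hb' (hI.right m hm).real.isReal h₂)
  rintro rfl
  exact RLt.irrefl h₂

/-- An interval with endpoints `0` and `1` shows that the slope is positive. -/
theorem IsRisingSun.exists_eq_one {n : M.D .nat} (hn : M.app l n = M.zero)
    (ha : ¬ RLt (const 0) (M.app a n)) (hb : ¬ RLt (M.app b n) (const 1)) :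
    ∃ m, M.app α m = M.one := by
  -- The endpoint conditions locate the terms of index `k` within two units of 0 and 1, and
  -- regularity costs one more; three units must be less than 1/2.
  obtain ⟨k, hk⟩ := exists_unit_lt' (M := M) (ε := 1 / 6) (by norm_num)
  have hak : ¬ (0 + 2 * unit k < M.app (M.app a n) k) := fun h => ha ⟨k, by rwa [app_const]⟩
  have hbk : ¬ (M.app (M.app b n) k + 2 * unit k < 1) := fun h => hb ⟨k, by rwa [app_const]⟩
  obtain ⟨⟨y, hy⟩, -⟩ := hI.sub n (const (1 / 2)) hn (holdsReal_const _)
    (.of_lt_const (hI.left n hn).real.isReal (i := k) (by linarith))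
    (.const_of_lt (hI.right n hn).real.isReal (j := k) (by linarith))
  obtain ⟨m, hm⟩ := hs.pos_of_rLt hf hy
  exact hs.exists_of_pos m hm

end PrimeModel

/-! ### Derivation of LPO from the Rising Sun Lemma. -/

open PrimeModel

/-- The types of a sequence of natural numbers, two sequences of real numbers, an index sequence,
and a function. -/
abbrev linearCtx : Ctx :=
  [.fn .nat .nat, .fn .nat .seq, .fn .nat .seq, .fn .nat .nat, .fn .seq .seq]

/-- The hypotheses from which an instance of omniscience is derived, for `v0` the binary sequence,
`v4` the linear function, `v3` the index sequence, and `v2`, `v1` the endpoints. -/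
def linearHyps : List (Fm linearCtx) :=
  [isBinary v0, .eq v4 (linearFn v0), (isIntervalFamily v2 v1 v0).wk,
    (Fm.all .seq (Fm.iff (.and (inShadow v4 v0) (inIoo (rConst .qzero) (rConst .qone) v0))
      (.ex .nat (.and (.eq (.app v4 v0) .zero) (inIoo (.app v3 v0) (.app v2 v0) v1))))).wk]

theorem linearHyps_iff {M : PrimeModel} {α l : M.D (.fn .nat .nat)} {a b : M.D (.fn .nat .seq)}
    {f : M.D (.fn .seq .seq)} (h : M.Holds linearHyps
      (Env.cons α (Env.cons b (Env.cons a (Env.cons l (Env.cons f Env.nil)))))) :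
    ∃ s, IsFirstOne α s ∧ (∀ x n, M.app (M.app f x) n = M.app s n * M.app x n) ∧
      IsRisingSun f l a b := by
  simp only [linearHyps, Holds_cons, holds_wk] at h
  obtain ⟨h₁, h₂, h₃, h₄, -⟩ := h
  refine ⟨_, by simpa using isFirstOne h₁, fun x n => ?_, .of_holds h₃ h₄⟩
  simp only [holds_eq, eval_var, Env.cons_succ, Env.cons_zero] at h₂
  rw [congrArg (M.app · x) h₂, app_linearFn]

/-- If there is an interval, then its endpoints are `0` and `1`. -/
theorem prf_endpoints : Prf (.eq (.app v3 .zero) .zero :: linearHyps)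
    (Fm.neg (.or (rLt (rConst .qzero) (.app v2 .zero)) (rLt (.app v1 .zero) (rConst .qone)))) := by
  refine .impI (.of_models fun M e h => ?_)
  have hlt := h _ List.mem_cons_self
  obtain ⟨α, e', rfl⟩ := e.exists_cons
  obtain ⟨b, a, l, f, rfl⟩ := e'.exists_four
  have hH : M.Holds linearHyps
      (Env.cons α (Env.cons b (Env.cons a (Env.cons l (Env.cons f Env.nil))))) :=
    fun ψ hψ => h ψ (by simp [hψ])
  have hl : M.app l M.zero = M.zero := by
    simpa using h (.eq (.app v3 .zero) .zero) (by simp)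
  have hne := hH ((isIntervalFamily v2 v1 v0).wk) (by simp [linearHyps])
  simp only [holds_wk, isIntervalFamily, holds_and] at hne
  have hne := imp_mp (all_at hne.2.1 M.zero) (by simpa using hl)
  simp only [holds_and] at hne
  refine (not_of_neg hne.2.2 ?_).elim
  -- Non-emptiness is a negated universal formula. To contradict it, the absence of points must hold
  -- as a formula, so it is derived; the elements of `M` alone would not suffice.
  have key : Prf (.or (rLt (rConst .qzero) (.app v2 .zero)) (rLt (.app v1 .zero) (rConst .qone)) ::
      .eq (.app v3 .zero) .zero :: linearHyps)
      (.all .seq (Fm.neg (inIoo (.app v3 .zero) (.app v2 .zero) v0))) := by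
    refine .allI (.impI (.of_models fun M e h => ?_))
    obtain ⟨x, e, rfl⟩ := e.exists_cons
    obtain ⟨α, e', rfl⟩ := e.exists_cons
    obtain ⟨b, a, l, f, rfl⟩ := e'.exists_four
    rw [List.forall_mem_cons] at h
    obtain ⟨hx, h⟩ := h
    have h := (Holds_map_wk M _ _ _).1 h
    simp only [Holds_cons] at h
    obtain ⟨hlt, hl, h⟩ := h
    obtain ⟨s, hs, hf, hI⟩ := linearHyps_iff h
    simp only [inIoo, holds_and, holds_isReal_iff, holds_rLt, holds_or, holds_eq, eval_app,
      eval_var, Env.cons_zero, Env.cons_succ, eval_zero, eval_rConst, eval_qzero,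
      eval_qone] at hx hlt hl
    rcases hlt with hlt | hlt
    · exact (hI.not_zero_rLt hs hf hl hx.1 hx.2.1 hx.2.2 hlt).elim
    · exact (hI.not_rLt_one hs hf hl hx.1 hx.2.1 hx.2.2 hlt).elim
  -- The non-emptiness clause has an index variable with the value zero, where `key` has the term
  -- zero.
  have : M.holds ((Fm.all (Γ := [.nat, .fn .nat .seq, .fn .nat .seq, .fn .nat .nat, .fn .seq .seq])
      .seq (Fm.neg (inIoo (.app v3 v1) (.app v2 v1) v0))).subst
        (Sub.cons .zero (fun _ x => .var x.succ)))
      (Env.cons α (Env.cons b (Env.cons a (Env.cons l (Env.cons f Env.nil))))) := M.sound key h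
  rw [M.holds_subst, eval_cons, eval_zero] at this
  simp only [eval_var, Env.cons_succ] at this
  exact this

/-- If the index sequence starts with 1, it is constantly 1 and there are no intervals. A positive
slope would require one that contains 1/2. -/
theorem prf_eq_zero : Prf (.eq (.app v3 .zero) .one :: linearHyps)
    (.all .nat (.eq (.app v1 v0) .zero)) := by
  refine .allI (.of_models fun M e h => ?_)
  obtain ⟨n, e, rfl⟩ := e.exists_cons
  obtain ⟨α, e, rfl⟩ := e.exists_cons
  obtain ⟨b, a, l, f, rfl⟩ := e.exists_four
  have h := (Holds_map_wk M _ _ _).1 h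
  simp only [Holds_cons] at h
  obtain ⟨hl, h⟩ := h
  obtain ⟨s, hs, hf, hI⟩ := linearHyps_iff h
  have hα := binary_of_holds (h (isBinary v0) (by simp [linearHyps])) n
  simp only [holds_eq, eval_app, eval_var, Env.cons_zero, Env.cons_succ, eval_zero,
    eval_one] at hα hl ⊢
  refine hα.resolve_right fun hn => ?_
  have hinc := h ((isIntervalFamily v2 v1 v0).wk) (by simp [linearHyps])
  simp only [holds_wk, isIntervalFamily, isIncreasingBinary, holds_and] at hinc
  have hall := all_nat_of (φ := .eq (.app v3 v0) .one) [.eq (.app v2 .zero) .one,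
    .all .nat (.imp (.eq (.app v3 v0) .one) (.eq (.app v3 (.succ v0)) .one))]
    (e := Env.cons b (Env.cons a (Env.cons l (Env.cons f Env.nil))))
    (by simpa using ⟨hl, hinc.1.2⟩) (fun M' e' h => by simpa using ((Holds_cons M' _ _ _).1 h).1)
    fun M' e' n h hn => by
      simp only [Holds_cons] at h
      simpa using imp_mp (all_at h.2.1 n) hn
  -- The index 3 gives the error 1/4, which separates 1/2 from 0 and from 1.
  obtain ⟨k, hk, -⟩ := hI.exists_interval hs hf (hs.pos n hn) (x := const (1 / 2))
    (holdsUnit_const (by norm_num) (by norm_num))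
    (.const_of_lt (isReal_const _) (j := M.succ (M.succ M.one)) (by
      rw [app_const, unit, cast_succ, cast_succ, cast_one]; norm_num))
    (.of_lt_const (isReal_const _) (i := M.succ (M.succ M.one)) (by
      rw [app_const, unit, cast_succ, cast_succ, cast_one]; norm_num))
  have := all_at hall k
  simp only [holds_eq, eval_app, eval_var, Env.cons_zero, Env.cons_succ, eval_one] at this
  exact one_ne_zero' (this.symm.trans hk)

/-- The Rising Sun Lemma implies the limited principle of omniscience. -/
theorem prf_LPO_of_risingSun : Prf [RisingSun] LPO := by
  refine .allI (.impI (.of_models fun M e h => ?_))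
  obtain ⟨α, e, rfl⟩ := e.exists_cons
  obtain rfl : e = Env.nil := funext fun _ => funext fun x => nomatch x
  simp only [List.map_cons, List.map_nil, List.forall_mem_cons, holds_wk] at h
  obtain ⟨hα, hRS, -⟩ := h
  have hF := M.sound (prf_isCont_linearFn v0) (e := Env.cons α Env.nil) (by simpa using hα)
  rw [holds_isCont_iff] at hF
  have hRS := imp_mp (all_at hRS (M.eval (linearFn v0) (Env.cons α Env.nil))) hF
  simp only [holds_ex] at hRS
  obtain ⟨l, a, b, hRS⟩ := hRS
  rw [holds_and] at hRS
  have hH : M.Holds linearHyps (Env.cons α (Env.cons b (Env.cons a (Env.cons l (Env.cons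
      (M.eval (linearFn v0) (Env.cons α Env.nil)) Env.nil))))) := by
    simp only [linearHyps, Holds_cons, holds_wk, Holds_nil, and_true]
    refine ⟨?_, ?_, hRS⟩
    · change M.holds ((isBinary v0).subst (Sub.cons v0 Sub.nil : Sub _ linearCtx)) _
      rw [M.holds_subst, eval_cons, eval_nil, eval_var]
      exact hα
    · change M.holds (.eq v4 ((linearFn v0).subst (Sub.cons v0 Sub.nil))) _
      rw [holds_eq, M.eval_subst, eval_cons, eval_nil]
      simp
  simp only [holds_or]
  have hl := (holds_and _ _ _).1 ((holds_and _ _ _).1 hRS.1).1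
  -- The first value of the index sequence tells whether there is an interval, and this decides the
  -- instance of LPO.
  rcases binary_of_holds hl.1 M.zero with h | h
  · right
    have hend := not_of_neg (M.sound prf_endpoints
      ((Holds_cons M _ _ _).2 ⟨by simpa using h, hH⟩))
    simp only [holds_or, holds_rLt, eval_app, eval_var, Env.cons_zero, Env.cons_succ, eval_zero,
      eval_rConst, eval_qzero, eval_qone, not_or] at hend
    obtain ⟨s, hs, hf, hI⟩ := linearHyps_iff hH
    simpa using hI.exists_eq_one hs hf (by simpa using h) hend.1 hend.2
  · left
    have := M.sound prf_eq_zero ((Holds_cons M _ _ _).2 ⟨by simpa using h, hH⟩)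
    change M.holds ((Fm.all (Γ := [.fn .nat .nat]) .nat (.eq (.app v1 v0) .zero)).subst
      (Sub.cons v0 Sub.nil : Sub _ linearCtx)) _ at this
    rw [M.holds_subst, eval_cons, eval_nil, eval_var] at this
    exact this

end Bish

theorem proposition1p3p8 : Bish.Provable (Bish.Fm.iff Bish.LPO Bish.RisingSun) :=
  .andI (.impI Bish.prf_risingSun_of_LPO) (.impI Bish.prf_LPO_of_risingSun)
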